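/- **Setting.** Let $R$ be a finite irreducible (reduced, crystallographic) root system in a finite dimensional real vector space $V$, with positive roots $R^+$. Let $H_{\alpha,n}=\{\mu\in V\mid\langle\mu,\alpha^\vee\rangle=n\}$ ($\alpha\in R^+$, $n\in\mathbb Z$), let $s_{\alpha,n}$ be the affine reflection $\mu\mapsto\mu-(\langle\mu,\alpha^\vee\rangle-n)\alpha$ and $t_\gamma$ the translation by $\gamma$. Let $\widehat{\mathcal W}$ be the affine Weyl group generated by all $s_{\alpha,n}$, $\mathcal A$ the set of alcoves (the connected components of $V\setminus\bigcup H_{\alpha,n}$), and $A_e$ the alcove in the dominant chamber with $0$ in its closure. $\widehat{\mathcal W}$ acts simply transitively on $\mathcal A$, and for $w,s\in\widehat{\mathcal W}$ one puts $w(A_e)\,s:=(ws)(A_e)$. Let $\mathcal V=\mathcal A/\mathbb ZR$ be the set of orbits under translations by $\mathbb ZR$. Fix a simple affine reflection $s$, i.e. the reflection at a hyperplane $H_{\alpha,n}$ whose intersection with the closure of $A_e$ has codimension $1$. Let $k$ be a field of characteristic $\neq2$ such that $\alpha^\vee\notin k\beta^\vee$ in $X^\vee\otimes_{\mathbb Z}k$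 for all $\alpha\ne\beta$ in $R^+$, where $X^\vee$ is the coweight lattice. Let $S$ be the symmetric algebra of $X^\vee\otimes_{\mathbb Z} k$. For a commutative flat $S$-algebra $T$ let $I_T\subset R^+$ be the set of $\alpha$ such that $\alpha^\vee$ is not invertible in $T$, let $\widehat{\mathcal W}_T$ be the group generated by the $t_\gamma$ ($\gamma\in\mathbb ZR$) and the $s_{\alpha,m}$ ($\alpha\in I_T$, $m\in\mathbb Z$), and let $R_T^+$ be the set of $\alpha\in R^+$ with $s_{\alpha,m}\in\widehat{\mathcal W}_T$ for some $m$. $T$ is a *base ring* if $I_T=R_T^+$. The partial order $\preceq_T$ on $\mathcal A$ is generated by $A\preceq_T t_\gamma(A)$ for $\gamma\in\mathbb Z_{\ge0}R^+$ and $A\preceq_Ts_{\alpha,n}(A)$ for $\alpha\in R^+_T$ with $A\subset\{\langle\cdot,\alpha^\vee\rangle<n\}$. A set of alcoves is *$T$-open* if it is an order ideal for $\preceq_T$; $X_{\preceq_T}$ denotes the smallest $T$-open set containing $X$. Let $\mathcal Z_S\subset\prod_{x\in\mathcal V}S$ be the subalgebra of all $(z_x)$ with $z_x\equiv z_{s_{\alpha,0}x}\bmod\alpha^\vee$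 for all $x\in\mathcal V$, $\alpha\in R^+$. Put $\mathcal Z_T=\mathcal Z_S\otimes_ST\subset\prod_{x\in\mathcal V}T$ and $\mathcal Z_T^s=\{z\in\mathcal Z_T\mid z_{xs}=z_x\text{ for all }x\in\mathcal V\}$. Let $T^\emptyset=T[(\alpha^\vee)^{-1}\mid\alpha\in R^+]$. For a $\mathcal Z_T$-module $M$ and $x\in\mathcal V$ let $M^x$ be the image of $M$ in the $x$-component of $M\otimes_TT^\emptyset$; that is, $M^x$ is the quotient of $M$ by all $m$ such that $dm\in\{z\in\mathcal Z_T\mid z_x=0\}M$ for some product $d$ of positive coroots. The category $\mathbf P_T$ is the full subcategory of the category of presheaves $\mathscr M$ of $\mathcal Z_T$-modules on the $T$-open subsets of $\mathcal A$ formed by all $\mathscr M$ that are - flabby: all restriction maps are surjective; - finitary: $\mathscr M(\emptyset)=0$, and for some finite $\mathcal T\subset\mathcal A$ all maps $\mathscr M(\mathcal J)\to\mathscr M((\mathcal J\cap\mathcal T)_{\preceq_T})$ are isomorphisms; - root torsion free: each $\alpha^\vee$, $\alpha\in R^+$, acts injectively on each $\mathscr M(\mathcal J)$; - subject to the support condition: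 $\mathscr M(\mathcal J)^x\to\mathscr M((\mathcal J\cap x)_{\preceq_T})^x$ is an isomorphism for all $T$-open $\mathcal J$ and all $x\in\mathcal V$. For a presheaf $\mathscr M$ let $\mathscr M^+(\mathcal J)$ be the image of $\mathscr M(\mathcal J)$ in $\bigoplus_{x\in\mathcal V}\mathscr M((\mathcal J\cap x)_{\preceq_T})^x$. Put $\mathcal J^\sharp=\mathcal J\cup\mathcal Js$. The *wall crossing functor* is $\vartheta_{T,s}\mathscr M=(\epsilon_s\mathscr M)^+$ with $(\epsilon_s\mathscr M)(\mathcal J)=\mathcal Z_T\otimes_{\mathcal Z_T^s}\mathscr M(\mathcal J^\sharp)$. For a flat homomorphism $T\to T'$ of base rings (a homomorphism of $S$-algebras that makes $T'$ flat over $T$), the *base change functor* sends $\mathscr M$ to $\mathscr M\boxtimes_TT'=\mathscr N^+$, where $\mathscr N$ is the presheaf of $\mathcal Z_{T'}$-modules on the $T'$-open sets given by $\mathscr N(\mathcal J)=\mathscr M(\mathcal J_{\preceq_T})\otimes_TT'$. **Statement.** Let $T\to T'$ be a flat homomorphism of base rings. If $\mathcal J$ is $T$-open, then so is $\mathcal J^\sharp$,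 and the same holds for $T'$. The constructions above give functors $\vartheta_{T,s}\colon\mathbf P_T\to\mathbf P_T$, $\vartheta_{T',s}\colon\mathbf P_{T'}\to\mathbf P_{T'}$ and $\cdot\boxtimes_TT'\colon\mathbf P_T\to\mathbf P_{T'}$, and wall crossing commutes naturally with base change: there is an isomorphism of functors $$\vartheta_{T,s}(\cdot)\boxtimes_TT'\;\cong\;\vartheta_{T',s}(\cdot\boxtimes_TT')\colon\ \mathbf P_T\to\mathbf P_{T'}.$$ -/

import Mathlib

open CategoryTheory TensorProduct Opposite

universe u

noncomputable section

namespace AlcoveSheaf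

section Geometry

variable {ι V N : Type u} [AddCommGroup V] [Module ℝ V] [AddCommGroup N] [Module ℝ N]
  {P : RootPairing ι ℝ V N} (b : P.Base)

/-- The system `R⁺` of positive roots attached to the base `b`, as a set of indices. -/
def PosRoot : Set ι := {i | P.root i ∈ AddSubmonoid.closure (P.root '' b.support)}

/-- The affine hyperplane `H_{α,n}` of all `μ` with `⟨μ, α^∨⟩ = n`. -/
def hyperplane (P : RootPairing ι ℝ V N) (i : ι) (n : ℤ) : Set V := {μ | P.coroot' i μ = n}

/-- The negative half space `H_{α,n}^-`. -/
def negHalfSpace (P : RootPairing ι ℝ V N) (i : ι) (n : ℤ) : Set V := {μ | P.coroot' i μ < n}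

/-- The affine reflection `s_{α,n} : μ ↦ μ - (⟨μ, α^∨⟩ - n) α`. -/
def affReflection (P : RootPairing ι ℝ V N) (i : ι) (n : ℤ) : V ≃ᵃ[ℝ] V :=
  AffineEquiv.constVAdd ℝ V ((n : ℝ) • P.root i) * (P.reflection i).toAffineEquiv

lemma affReflection_apply (i : ι) (n : ℤ) (μ : V) :
    affReflection P i n μ = μ - (P.coroot' i μ - n) • P.root i := by
  simp [affReflection, RootPairing.reflection_apply, sub_smul]
  abel

/-- The translation `t_γ`. -/
def translation (γ : V) : V ≃ᵃ[ℝ] V := AffineEquiv.constVAdd ℝ V γ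

/-- The root lattice `ℤR`. -/
def rootLattice (P : RootPairing ι ℝ V N) : AddSubgroup V := AddSubgroup.closure (Set.range P.root)

/-- The cone `ℤ_{≥0} R⁺`. -/
def posCone : AddSubmonoid V := AddSubmonoid.closure (P.root '' PosRoot b)

/-- The affine Weyl group, generated by all `s_{α,n}`. -/
def affineWeyl : Subgroup (V ≃ᵃ[ℝ] V) :=
  Subgroup.closure {g | ∃ i ∈ PosRoot b, ∃ n : ℤ, g = affReflection P i n}

/-- The complement in `V` of the union of all hyperplanes `H_{α,n}`. -/
def regularSet : Set V := (⋃ i ∈ PosRoot b, ⋃ n : ℤ, hyperplane P i n)ᶜ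

variable [TopologicalSpace V]

/-- The set `𝒜` of alcoves: the connected components of the complement of all hyperplanes. -/
def Alcove : Type u :=
  {A : Set V // ∃ v ∈ regularSet b, A = connectedComponentIn (regularSet b) v}

variable {b}

/-- `IsImage g A B`: the alcove `B` is the image `g(A)`. -/
def IsImage (g : V ≃ᵃ[ℝ] V) (A B : Alcove b) : Prop := B.1 = g '' A.1

variable (b)

/-- `C` is the fundamental alcove `A_e`: it lies in the dominant chamber and has `0` in its
closure. -/
def IsFundamental (C : Alcove b) : Prop :=
  (∀ μ ∈ C.1, ∀ i ∈ PosRoot b, 0 < P.coroot' i μ) ∧ (0 : V) ∈ closure C.1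

/-- `s` is a simple affine reflection: a reflection `s_{α,n}` whose hyperplane meets the closure of
the fundamental alcove in codimension one, i.e. in a set that spans the hyperplane affinely. -/
def IsSimpleAffineReflection (s : V ≃ᵃ[ℝ] V) : Prop :=
  ∃ i ∈ PosRoot b, ∃ n : ℤ, s = affReflection P i n ∧
    ∃ C : Alcove b, IsFundamental b C ∧
      (affineSpan ℝ (hyperplane P i n ∩ closure C.1) : Set V) = hyperplane P i n

/-- The right action: `IsRightTranslate b s A B` says `B = A s`, that is, `A = w(A_e)` and
`B = (w s)(A_e)` for an element `w` of the affine Weyl group. -/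
def IsRightTranslate (s : V ≃ᵃ[ℝ] V) (A B : Alcove b) : Prop :=
  ∃ w ∈ affineWeyl b, ∃ C : Alcove b, IsFundamental b C ∧ IsImage w C A ∧ IsImage (w * s) C B

/-- `J^♯ = J ∪ J s`. -/
def sharp (s : V ≃ᵃ[ℝ] V) (J : Set (Alcove b)) : Set (Alcove b) :=
  J ∪ {B | ∃ A ∈ J, IsRightTranslate b s A B}

/-- Two alcoves are equivalent if they lie in the same `ℤR`-orbit. -/
def orbitSetoid : Setoid (Alcove b) where
  r A B := ∃ γ ∈ rootLattice P, IsImage (translation γ) A B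
  iseqv :=
    { refl := fun A => ⟨0, zero_mem _, by simp [IsImage, translation]⟩
      symm := by
        rintro A B ⟨γ, hγ, h⟩
        refine ⟨-γ, neg_mem hγ, ?_⟩
        unfold IsImage at *
        rw [h, Set.image_image]
        simp [translation]
      trans := by
        rintro A B C ⟨γ, hγ, h⟩ ⟨δ, hδ, h'⟩
        refine ⟨δ + γ, add_mem hδ hγ, ?_⟩
        unfold IsImage at *
        rw [h', h, Set.image_image]
        simp [translation] }

/-- The set `𝒱 = 𝒜/ℤR` of `ℤR`-orbits of alcoves. -/
def Orbit : Type u := Quotient (orbitSetoid b)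

variable {b}

/-- The orbit map `π : 𝒜 → 𝒱`. -/
def orbit (A : Alcove b) : Orbit b := Quotient.mk (orbitSetoid b) A

end Geometry

section BaseRing

variable {ι V N : Type u} [AddCommGroup V] [Module ℝ V] [AddCommGroup N] [Module ℝ N]

/-- The coweight lattice `X^∨`. -/
def coweightLattice (P : RootPairing ι ℝ V N) : AddSubgroup N where
  carrier := {v | ∀ i, ∃ n : ℤ, P.root' i v = n}
  zero_mem' i := ⟨0, by simp⟩
  add_mem' {v w} hv hw i := by
    obtain ⟨m, hm⟩ := hv i
    obtain ⟨n, hn⟩ := hw i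
    exact ⟨m + n, by rw [map_add, hm, hn]; push_cast; rfl⟩
  neg_mem' {v} hv i := by
    obtain ⟨m, hm⟩ := hv i
    exact ⟨-m, by rw [map_neg, hm]; push_cast; rfl⟩

variable (k : Type u) [Field k]

/-- The symmetric algebra `S` of the `k`-vector space `X^∨ ⊗ k`. -/
abbrev SymRing (P : RootPairing ι ℝ V N) : Type u :=
  SymmetricAlgebra k (k ⊗[ℤ] coweightLattice P)

variable (P : RootPairing ι ℝ V N) [P.IsCrystallographic]

/-- The coroot `α^∨` as an element of the coweight lattice. -/
def corootLattice (i : ι) : coweightLattice P :=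
  ⟨P.coroot i, fun j => by
    obtain ⟨z, hz⟩ := P.exists_value (S := ℤ) j i
    exact ⟨z, by simpa using hz.symm⟩⟩

/-- The image of `α^∨` in `X^∨ ⊗ k`. -/
def corootVec (i : ι) : k ⊗[ℤ] coweightLattice P := 1 ⊗ₜ corootLattice P i

/-- The image of `α^∨` in an `S`-algebra `T`. -/
def corootIn (T : Type u) [CommRing T] [Algebra (SymRing k P) T] (i : ι) : T :=
  algebraMap (SymRing k P) T (SymmetricAlgebra.ι k _ (corootVec k P i))

variable {P} (b : P.Base)

/-- The GKM condition: the characteristic of `k` is not `2`, and the coroots of two different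
positive roots are never proportional over `k`. -/
def GKM : Prop :=
  ringChar k ≠ 2 ∧ ∀ i ∈ PosRoot b, ∀ j ∈ PosRoot b, i ≠ j →
    corootVec k P i ∉ Submodule.span k {corootVec k P j}

variable (T : Type u) [CommRing T] [Algebra (SymRing k P) T]

/-- The set `I_T` of positive roots whose coroot is not invertible in `T`. -/
def nonUnitRoots : Set ι := {i | i ∈ PosRoot b ∧ ¬ IsUnit (corootIn k P T i)}

/-- The subgroup `Ŵ_T` generated by the translations in `ℤR` and the `s_{α,m}`, `α ∈ I_T`. -/
def affineWeylT : Subgroup (V ≃ᵃ[ℝ] V) :=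
  Subgroup.closure
    ({g | ∃ γ ∈ rootLattice P, g = translation γ} ∪
      {g | ∃ i ∈ nonUnitRoots k b T, ∃ m : ℤ, g = affReflection P i m})

/-- The set `R_T⁺` of positive roots `α` such that `Ŵ_T` contains some `s_{α,m}`. -/
def integralRoots : Set ι :=
  {i | i ∈ PosRoot b ∧ ∃ m : ℤ, affReflection P i m ∈ affineWeylT k b T}

/-- A base ring: a commutative flat `S`-algebra that is saturated. -/
structure IsBaseRing : Prop where
  flat : Module.Flat (SymRing k P) T
  saturated : nonUnitRoots k b T = integralRoots k b T

variable [TopologicalSpace V]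

/-- The relations that generate the partial order `⪯_T`. -/
def Step (A B : Alcove b) : Prop :=
  (∃ γ ∈ posCone b, IsImage (translation γ) A B) ∨
    (∃ i ∈ integralRoots k b T, ∃ n : ℤ,
      A.1 ⊆ negHalfSpace P i n ∧ IsImage (affReflection P i n) A B)

/-- The order `⪯_T` on alcoves. -/
def LeT (A B : Alcove b) : Prop := Relation.ReflTransGen (Step k b T) A B

/-- A set of alcoves is `T`-open if it is an order ideal for `⪯_T`. -/
def IsTOpen (J : Set (Alcove b)) : Prop := ∀ A ∈ J, ∀ B, LeT k b T B A → B ∈ J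

/-- The partially ordered set (hence category) of open subsets of `𝒜_T`. -/
abbrev TOpen : Type u := {J : Set (Alcove b) // IsTOpen k b T J}

/-- The smallest `T`-open set containing a set `X` of alcoves. -/
def openHull (X : Set (Alcove b)) : TOpen k b T :=
  ⟨{B | ∃ A ∈ X, LeT k b T B A},
    fun _ ⟨A, hA, h⟩ _ h' => ⟨A, hA, Relation.ReflTransGen.trans h' h⟩⟩

variable {k b T}

lemma openHull_mono {X Y : Set (Alcove b)} (h : X ⊆ Y) :
    openHull k b T X ≤ openHull k b T Y :=
  fun _ ⟨A, hA, hB⟩ => ⟨A, h hA, hB⟩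

lemma openHull_le {X : Set (Alcove b)} (J : TOpen k b T) (h : X ⊆ J.1) :
    openHull k b T X ≤ J :=
  fun _ ⟨A, hA, hB⟩ => J.2 A (h hA) _ hB

/-- The open set `(J ∩ x)_{⪯_T}` for an orbit `x`. -/
def orbitPart (J : TOpen k b T) (x : Orbit b) : TOpen k b T :=
  openHull k b T (J.1 ∩ {A | orbit A = x})

lemma orbitPart_le (J : TOpen k b T) (x : Orbit b) : orbitPart J x ≤ J :=
  openHull_le J Set.inter_subset_left

lemma orbitPart_mono {J J' : TOpen k b T} (h : J ≤ J') (x : Orbit b) :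
    orbitPart J x ≤ orbitPart J' x :=
  openHull_mono (Set.inter_subset_inter_left _ h)

end BaseRing

section StructureAlgebra

variable {ι V N : Type u} [AddCommGroup V] [Module ℝ V] [AddCommGroup N] [Module ℝ N]
  [TopologicalSpace V] {P : RootPairing ι ℝ V N} [P.IsCrystallographic]
  (k : Type u) [Field k] (b : P.Base)

/-- The structure algebra `𝒵_S`: all families `(z_x)` in `S` indexed by the (finite) set of orbits
with `z_x ≡ z_{s_α x} mod α^∨` for every orbit `x` and every positive root `α`. -/
def structureAlgebra : Subalgebra (SymRing k P) (Orbit b → SymRing k P) where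
  carrier := {z | ∀ i ∈ PosRoot b, ∀ A B : Alcove b, IsImage (affReflection P i 0) A B →
    corootIn k P (SymRing k P) i ∣ z (orbit A) - z (orbit B)}
  mul_mem' {z w} hz hw i hi A B h := by
    have := dvd_add ((hz i hi A B h).mul_right (w (orbit A)))
      ((hw i hi A B h).mul_left (z (orbit B)))
    convert this using 1
    simp only [Pi.mul_apply]
    ring
  add_mem' {z w} hz hw i hi A B h := by
    have := dvd_add (hz i hi A B h) (hw i hi A B h)
    convert this using 1
    simp only [Pi.add_apply]
    ring
  algebraMap_mem' r i hi A B h := by simp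

variable (T : Type u) [CommRing T] [Algebra (SymRing k P) T]

/-- The structure algebra `𝒵_T = T ⊗_S 𝒵_S`. -/
abbrev ZT : Type u := T ⊗[SymRing k P] structureAlgebra k b

variable {b}

/-- The coordinate homomorphism `𝒵_T → T`, `z ↦ z_x`. -/
def coord (x : Orbit b) : ZT k b T →ₐ[T] T :=
  Algebra.TensorProduct.lift (AlgHom.id T T)
    ((Algebra.ofId (SymRing k P) T).comp
      ((Pi.evalAlgHom (SymRing k P) (fun _ : Orbit b => SymRing k P) x).comp
        (structureAlgebra k b).val))
    (fun _ _ => Commute.all _ _)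

lemma coord_tmul (x : Orbit b) (t : T) (z : structureAlgebra k b) :
    coord k T x (t ⊗ₜ z) = t * algebraMap (SymRing k P) T (z.1 x) := by
  simp [coord, Algebra.ofId_apply]

variable (b)

/-- The image of `α^∨` in `𝒵_T`. -/
def corootZ (i : ι) : ZT k b T := algebraMap T (ZT k b T) (corootIn k P T i)

/-- The subalgebra `𝒵_T^s` of all `z` with `z_{xs} = z_x` for all orbits `x`. -/
def invariants (s : V ≃ᵃ[ℝ] V) : Subalgebra T (ZT k b T) where
  carrier := {z | ∀ A B : Alcove b, IsRightTranslate b s A B →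
    coord k T (orbit B) z = coord k T (orbit A) z}
  mul_mem' hz hw A B h := by simp only [map_mul, hz A B h, hw A B h]
  add_mem' hz hw A B h := by simp only [map_add, hz A B h, hw A B h]
  algebraMap_mem' r A B h := by simp only [AlgHom.commutes]

variable (T' : Type u) [CommRing T'] [Algebra (SymRing k P) T'] [Algebra T T']
  [IsScalarTower (SymRing k P) T T']

/-- The homomorphism `𝒵_T → 𝒵_{T'}` induced by `T → T'`. -/
def changeZ : ZT k b T →+* ZT k b T' :=
  (Algebra.TensorProduct.map (IsScalarTower.toAlgHom (SymRing k P) T T')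
    (AlgHom.id (SymRing k P) (structureAlgebra k b))).toRingHom

end StructureAlgebra

section Stalks

variable {ι V N : Type u} [AddCommGroup V] [Module ℝ V] [AddCommGroup N] [Module ℝ N]
  [TopologicalSpace V] {P : RootPairing ι ℝ V N} [P.IsCrystallographic]
  (k : Type u) [Field k] {b : P.Base} (T : Type u) [CommRing T] [Algebra (SymRing k P) T]

variable (b) in
/-- The multiplicative set generated by the coroots `α^∨`, `α ∈ R⁺`, in `𝒵_T`. Localising a
`𝒵_T`-module at it is the same as applying `· ⊗_T T^∅`. -/
def corootMonoid : Submonoid (ZT k b T) := Submonoid.closure (corootZ k b T '' PosRoot b)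

variable (b) in
/-- `M` is root torsion free if every `α^∨` acts injectively. -/
def RootTorsionFree (M : Type u) [AddCommGroup M] [Module (ZT k b T) M] : Prop :=
  ∀ i ∈ PosRoot b, Function.Injective (fun m : M => corootZ k b T i • m)

/-- The kernel of the canonical map from `M` to the `x`-component `(M ⊗_T T^∅)^x` of `M ⊗_T T^∅`.
With `I_x = ker (𝒵_T → T, z ↦ z_x)`, this component is the localisation of
`M / I_x M = 𝒵_T^x ⊗ M` at the coroots. -/
def stalkKer (x : Orbit b) (M : Type u) [AddCommGroup M] [Module (ZT k b T) M] :
    Submodule (ZT k b T) M where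
  carrier := {m | ∃ d ∈ corootMonoid k b T,
    d • m ∈ (RingHom.ker (coord k T x) • ⊤ : Submodule (ZT k b T) M)}
  zero_mem' := ⟨1, one_mem _, by simp⟩
  add_mem' := by
    rintro m n ⟨d, hd, hm⟩ ⟨e, he, hn⟩
    refine ⟨d * e, mul_mem hd he, ?_⟩
    rw [smul_add]
    refine add_mem ?_ ?_
    · rw [mul_comm, mul_smul]
      exact Submodule.smul_mem _ _ hm
    · rw [mul_smul]
      exact Submodule.smul_mem _ _ hn
  smul_mem' := by
    rintro z m ⟨d, hd, hm⟩
    refine ⟨d, hd, ?_⟩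
    rw [smul_comm]
    exact Submodule.smul_mem _ _ hm

lemma stalkKer_le_comap (x : Orbit b) {M M' : Type u} [AddCommGroup M] [Module (ZT k b T) M]
    [AddCommGroup M'] [Module (ZT k b T) M'] (f : M →ₗ[ZT k b T] M') :
    stalkKer k T x M ≤ (stalkKer k T x M').comap f := by
  rintro m ⟨d, hd, hm⟩
  refine ⟨d, hd, ?_⟩
  rw [← map_smul]
  have h := Submodule.mem_map_of_mem (f := f) hm
  rw [Submodule.map_smul''] at h
  exact Submodule.smul_mono le_rfl le_top h

/-- The stalk `M^x`: the image of `M` in `(M ⊗_T T^∅)^x`, written as `M` modulo the kernel. -/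
abbrev Stalk (x : Orbit b) (M : Type u) [AddCommGroup M] [Module (ZT k b T) M] : Type u :=
  M ⧸ stalkKer k T x M

/-- The map on stalks induced by a homomorphism. -/
def stalkMap (x : Orbit b) {M M' : Type u} [AddCommGroup M] [Module (ZT k b T) M]
    [AddCommGroup M'] [Module (ZT k b T) M'] (f : M →ₗ[ZT k b T] M') :
    Stalk k T x M →ₗ[ZT k b T] Stalk k T x M' :=
  (stalkKer k T x M).mapQ (stalkKer k T x M') f (stalkKer_le_comap k T x f)

end Stalks

section Presheaves

variable {ι V N : Type u} [AddCommGroup V] [Module ℝ V] [AddCommGroup N] [Module ℝ N]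
  [TopologicalSpace V] {P : RootPairing ι ℝ V N} [P.IsCrystallographic]
  (k : Type u) [Field k] (b : P.Base) (T : Type u) [CommRing T] [Algebra (SymRing k P) T]

/-- The category of presheaves of `𝒵_T`-modules on `𝒜_T`. -/
abbrev PSh : Type (u + 1) := (TOpen k b T)ᵒᵖ ⥤ ModuleCat.{u} (ZT k b T)

variable {k b T}

/-- The restriction homomorphism for `J' ⊆ J`. -/
def res (M : PSh k b T) {J' J : TOpen k b T} (h : J' ≤ J) :
    M.obj (op J) →ₗ[ZT k b T] M.obj (op J') := (M.map (homOfLE h).op).hom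

lemma res_res (M : PSh k b T) {J'' J' J : TOpen k b T} (h : J' ≤ J) (h' : J'' ≤ J')
    (m : M.obj (op J)) : res M h' (res M h m) = res M (h'.trans h) m := by
  unfold res
  rw [← LinearMap.comp_apply, ← ModuleCat.hom_comp, ← Functor.map_comp]
  rfl

lemma res_naturality {M M' : PSh k b T} (f : M ⟶ M') {J' J : TOpen k b T} (h : J' ≤ J)
    (m : M.obj (op J)) : res M' h ((f.app (op J)).hom m) = (f.app (op J')).hom (res M h m) := by
  unfold res
  rw [← LinearMap.comp_apply, ← ModuleCat.hom_comp, ← f.naturality]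
  rfl

/-- A presheaf is flabby if all restriction homomorphisms are surjective. -/
def Flabby (M : PSh k b T) : Prop :=
  ∀ (J' J : TOpen k b T) (h : J' ≤ J), Function.Surjective (res M h)

/-- A presheaf is supported on a set `X` of alcoves if every restriction
`M(J) → M((J ∩ X)_{⪯_T})` is an isomorphism. -/
def SupportedOn (M : PSh k b T) (X : Set (Alcove b)) : Prop :=
  ∀ J : TOpen k b T, Function.Bijective
    (res M (openHull_le J (Set.inter_subset_left : J.1 ∩ X ⊆ J.1)))

/-- A presheaf is finitary if `M(∅) = 0` and it is supported on a finite set. -/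
def Finitary (M : PSh k b T) : Prop :=
  Subsingleton (M.obj (op (openHull k b T ∅))) ∧ ∃ X : Set (Alcove b), X.Finite ∧ SupportedOn M X

/-- The support condition: `M(J)^x → M((J ∩ x)_{⪯_T})^x` is an isomorphism for all `J`, `x`. -/
def SupportCondition (M : PSh k b T) : Prop :=
  ∀ (J : TOpen k b T) (x : Orbit b), Function.Bijective (stalkMap k T x (res M (orbitPart_le J x)))

variable (k b T) in
/-- The objects of the category `𝐏_T`, a full subcategory of the category of presheaves. -/
def IsP : ObjectProperty (PSh k b T) := fun M =>
  Flabby M ∧ Finitary M ∧ (∀ J : TOpen k b T, RootTorsionFree k b T (M.obj (op J))) ∧ SupportCondition M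

/-- The component `M(J) → M((J ∩ x)_{⪯_T}) → M((J ∩ x)_{⪯_T})^x` of `γ^x`. -/
def gammaAt (M : PSh k b T) (J : TOpen k b T) (x : Orbit b) :
    M.obj (op J) →ₗ[ZT k b T] Stalk k T x (M.obj (op (orbitPart J x))) :=
  (stalkKer k T x (M.obj (op (orbitPart J x)))).mkQ ∘ₗ res M (orbitPart_le J x)

/-- The kernel of `γ : M(J) → ⨁_x M((J ∩ x)_{⪯_T})^x`. -/
def gammaKer (M : PSh k b T) (J : TOpen k b T) : Submodule (ZT k b T) (M.obj (op J)) :=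
  ⨅ x : Orbit b, LinearMap.ker (gammaAt M J x)

lemma mem_gammaKer {M : PSh k b T} {J : TOpen k b T} {m : M.obj (op J)} :
    m ∈ gammaKer M J ↔
      ∀ x : Orbit b, res M (orbitPart_le J x) m ∈ stalkKer k T x (M.obj (op (orbitPart J x))) := by
  simp [gammaKer, gammaAt, Submodule.mem_iInf]

lemma gammaKer_res (M : PSh k b T) {J' J : TOpen k b T} (h : J' ≤ J) :
    gammaKer M J ≤ (gammaKer M J').comap (res M h) := by
  intro m hm
  rw [mem_gammaKer] at hm
  rw [Submodule.mem_comap, mem_gammaKer]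
  intro x
  have := stalkKer_le_comap k T x (res M (orbitPart_mono h x)) (hm x)
  rw [Submodule.mem_comap, res_res] at this
  rwa [res_res]

lemma gammaKer_map {M M' : PSh k b T} (f : M ⟶ M') (J : TOpen k b T) :
    gammaKer M J ≤ (gammaKer M' J).comap (f.app (op J)).hom := by
  intro m hm
  rw [mem_gammaKer] at hm
  rw [Submodule.mem_comap, mem_gammaKer]
  intro x
  rw [res_naturality]
  exact stalkKer_le_comap k T x (f.app (op (orbitPart J x))).hom (hm x)

/-- The presheaf `M⁺`, the image of `γ`: its sections over `J` are `M(J)` modulo the kernel of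
`γ`. -/
def plusObj (M : PSh k b T) : PSh k b T where
  obj J := ModuleCat.of _ (M.obj J ⧸ gammaKer M J.unop)
  map {J J'} h := ModuleCat.ofHom ((gammaKer M J.unop).mapQ (gammaKer M J'.unop) (M.map h).hom
    (gammaKer_res M (leOfHom h.unop)))
  map_id J := by
    refine ModuleCat.hom_ext (Submodule.linearMap_qext _ (LinearMap.ext fun m => ?_))
    exact congrArg (gammaKer M J.unop).mkQ (congrArg (fun g => g.hom m) (M.map_id J))
  map_comp {J J' J''} f g := by
    refine ModuleCat.hom_ext (Submodule.linearMap_qext _ (LinearMap.ext fun m => ?_))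
    exact congrArg (gammaKer M J''.unop).mkQ (congrArg (fun g => g.hom m) (M.map_comp f g))

variable (k b T) in
/-- The functor `M ↦ M⁺`. -/
def plus : PSh k b T ⥤ PSh k b T where
  obj M := plusObj M
  map {M M'} f :=
    { app := fun J => ModuleCat.ofHom ((gammaKer M J.unop).mapQ (gammaKer M' J.unop) (f.app J).hom
        (gammaKer_map f J.unop))
      naturality := fun J J' h => by
        refine ModuleCat.hom_ext (Submodule.linearMap_qext _ (LinearMap.ext fun m => ?_))
        exact congrArg (gammaKer M' J'.unop).mkQ (congrArg (fun g => g.hom m) (f.naturality h)) }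
  map_id M := by
    ext J : 2
    exact ModuleCat.hom_ext (Submodule.linearMap_qext _ (LinearMap.ext fun m => rfl))
  map_comp f g := by
    ext J : 2
    exact ModuleCat.hom_ext (Submodule.linearMap_qext _ (LinearMap.ext fun m => rfl))

/-! ### Wall crossing -/

variable (k b T) in
/-- The functor `J ↦ J^♯` on open sets. (The hull changes nothing when `J^♯` is open.) -/
def sharpFunctor (s : V ≃ᵃ[ℝ] V) : TOpen k b T ⥤ TOpen k b T :=
  Monotone.functor (f := fun J => openHull k b T (sharp b s J.1)) fun _ _ h =>
    openHull_mono (Set.union_subset_union h fun _ ⟨A, hA, hB⟩ => ⟨A, h hA, hB⟩)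

variable (k b T) in
/-- The functor `ε_s`, with `(ε_s M)(J) = 𝒵 ⊗_{𝒵^s} M(J^♯)`. -/
def epsilon (s : V ≃ᵃ[ℝ] V) : PSh k b T ⥤ PSh k b T :=
  (Functor.whiskeringLeft _ _ _).obj (sharpFunctor k b T s).op ⋙
    (Functor.whiskeringRight _ _ _).obj
      (ModuleCat.restrictScalars (R := invariants k b T s) (S := ZT k b T)
          (invariants k b T s).val.toRingHom ⋙
        ModuleCat.extendScalars (R := invariants k b T s) (S := ZT k b T)
          (invariants k b T s).val.toRingHom)

variable (k b T) in
/-- The wall crossing functor `ϑ_{T,s} = (ε_s ·)⁺`. -/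
def wallCrossing (s : V ≃ᵃ[ℝ] V) : PSh k b T ⥤ PSh k b T :=
  epsilon k b T s ⋙ plus k b T

/-! ### Base change -/

variable (k b T)
variable (T' : Type u) [CommRing T'] [Algebra (SymRing k P) T'] [Algebra T T']
  [IsScalarTower (SymRing k P) T T']

/-- The functor `J ↦ J_{⪯_T}` from `T'`-open to `T`-open sets. -/
def hullFunctor : TOpen k b T' ⥤ TOpen k b T :=
  Monotone.functor (f := fun J => openHull k b T J.1) fun _ _ h => openHull_mono h

/-- The base change functor `· ⊠_T T' = (i^*(· ⊗_T T'))⁺`. Here `i^*` is the presheaf pullback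
along the identity `𝒜_{T'} → 𝒜_T`, so `(i^*M)(J) = M(J_{⪯_T})`, and the `𝒵_{T'}`-module
`M ⊗_T T'` is written as `𝒵_{T'} ⊗_{𝒵_T} M`, where `𝒵_{T'} = T' ⊗_T 𝒵_T`. -/
def baseChange : PSh k b T ⥤ PSh k b T' :=
  (Functor.whiskeringRight _ _ _).obj (ModuleCat.extendScalars (changeZ k b T T')) ⋙
    (Functor.whiskeringLeft _ _ _).obj (hullFunctor k b T T').op ⋙ plus k b T'

end Presheaves

end AlcoveSheaf

end

/-!
Wall crossing and base change are both of the form "apply a naive functor, then apply `(·)⁺`". The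
naive functors `ε_s` and base change commute for formal reasons, and it has to be shown that the
intermediate `(·)⁺` makes no difference on either side.

*Alcoves.* The affine Weyl group is generated by the reflections in the walls of any given alcove
(`affineWeyl_le_wallGroup`) and, by the exchange condition `exists_shorter_mul`, acts freely on the
alcoves (`eq_one_of_sameSide`). Hence right translation `A ↦ A s` is an involution `r` of the set of
alcoves that commutes with the affine Weyl group, and since `s` is a wall reflection, the only
hyperplane that separates `A` from `A s` is their common wall. These properties are collected in
`IsRightTranslation`. They show that `J^♯` is open if `J` is, that open hulls commute with `♯`
(`IsRightTranslation.openHull_sharp`), and that a relation `A ⪯ B s` between alcoves `A` and `B` of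
the same orbit implies `A ⪯ B` (`IsRightTranslation.leT_of_leT_apply`).

*The three functors.* If `M` is flabby and finitary, then `M⁺` belongs to `𝐏_T` (`isP_plusObj`). The
point is finiteness of the support, which comes from the finiteness of the set of orbits and from
Dickson's lemma (`exists_finite_dominating`). Flabbiness and finiteness of the support are easy to
check for `ε_s M` and for the naive base change of `M`.

*Stalks.* For a set `X` of orbits the family which is the product of all positive coroots on `X` and
zero elsewhere lies in `𝒵` (`orbitElem`). It is an idempotent up to a product of coroots, so the
kernel of `M → M^x` consists of the elements that `orbitElem {x}` kills up to such a product
(`stalkKer_eq_rootTorsion`). As a consequence, a surjection of presheaves becomes an isomorphism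
under `(·)⁺` as soon as, over open sets generated by alcoves in an orbit `x`, its kernel vanishes in
the stalk at `x` (`isIso_plus_map`).

*Dropping the intermediate `(·)⁺`.* Apply this to the base change and to `ε_s` of the projection
`M → M⁺`. For base change this is direct (`isIso_plus_preBaseChange_plusUnit`). For `ε_s`, an element
that vanishes in the stalks at `x` and at `x s` is killed, up to coroots, by the element
`orbitElem {x, x s}`, which lies in `𝒵_T^s` and can therefore be moved across the tensor product. For
`M` in `𝐏_T` the support condition, together with the comparison of open hulls in
`IsRightTranslation.orbitPart_openHull_sharp`, guarantees that the kernel of the projection of the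
base change of `M` is of this kind (`IsRightTranslation.isIso_plus_epsilon_preBaseChange`).

*The naive functors commute.* The open sets agree by `IsRightTranslation.sharpHullIso`. On
coefficients, `𝒵_{T'} ⊗_{𝒵_T} 𝒵_T ⊗_{𝒵_T^s} M` and `𝒵_{T'} ⊗_{𝒵_{T'}^s} (𝒵_{T'} ⊗_{𝒵_T} M)` agree
because `𝒵_T^s → 𝒵_T` and `𝒵_{T'}^s → 𝒵_{T'}` form a pushout square of rings: as there are finitely
many orbits, `𝒵_T^s` is an equalizer of maps to a finite free module, and its formation commutes with
the flat base change `T → T'` (`isPushout_of_flat`, `indResCompIso`). The isomorphisms are put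
together in `compIsoOfUnits`.
-/

noncomputable section

namespace AlcoveSheaf

/-! ### Alcoves and the affine Weyl group -/

section AlcoveGeometry

variable {ι V N : Type u} [AddCommGroup V] [Module ℝ V] [AddCommGroup N] [Module ℝ N]
  {P : RootPairing ι ℝ V N} {b : P.Base}

lemma coroot'_reflectionPerm_self (i : ι) (v : V) :
    P.coroot' (P.reflectionPerm i i) v = -P.coroot' i v := by
  rw [RootPairing.coroot'_reflectionPerm]
  simp [RootPairing.reflection_apply]
  ring

lemma root_reflectionPerm_self (i : ι) : P.root (P.reflectionPerm i i) = -P.root i := by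
  rw [RootPairing.root_reflectionPerm]; simp

lemma coroot'_root_self (i : ι) : P.coroot' i (P.root i) = 2 := by simp

variable (b) in
lemma posRoot_or_neg (i : ι) : i ∈ PosRoot b ∨ P.reflectionPerm i i ∈ PosRoot b := by
  rcases b.root_mem_or_neg_mem i with h | h
  · exact Or.inl h
  · right
    rwa [PosRoot, Set.mem_ofPred_eq, root_reflectionPerm_self]

lemma affReflection_reflectionPerm_self (i : ι) (n : ℤ) :
    affReflection P (P.reflectionPerm i i) (-n) = affReflection P i n := by
  ext v
  rw [affReflection_apply, affReflection_apply, coroot'_reflectionPerm_self,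
    root_reflectionPerm_self]
  push_cast
  module

lemma affReflection_mul_self (i : ι) (n : ℤ) :
    affReflection P i n * affReflection P i n = 1 := by
  ext v
  simp only [AffineEquiv.coe_mul, Function.comp_apply, affReflection_apply, map_sub, map_smul, coroot'_root_self,
    smul_eq_mul, AffineEquiv.coe_one, id_eq]
  module

@[simp] lemma affReflection_affReflection (i : ι) (n : ℤ) (v : V) :
    affReflection P i n (affReflection P i n v) = v := by
  have := congrArg (fun g : V ≃ᵃ[ℝ] V => g v) (affReflection_mul_self (P := P) i n)
  simpa using this

lemma coroot'_affReflection_self (i : ι) (n : ℤ) (v : V) :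
    P.coroot' i (affReflection P i n v) - n = -(P.coroot' i v - n) := by
  rw [affReflection_apply, map_sub, map_smul, coroot'_root_self, smul_eq_mul]
  ring

lemma mem_regularSet {v : V} : v ∈ regularSet b ↔ ∀ (i : ι) (n : ℤ), P.coroot' i v ≠ n := by
  simp only [regularSet, Set.mem_compl_iff, Set.mem_iUnion, not_exists, hyperplane,
    Set.mem_ofPred_eq]
  constructor
  · intro h i n hn
    rcases posRoot_or_neg b i with hi | hi
    · exact h i hi n hn
    · refine h _ hi (-n) ?_
      rw [coroot'_reflectionPerm_self, hn]; push_cast; rfl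
  · intro h i _ n
    exact h i n

variable (b) in
lemma affReflection_mem_affineWeyl (i : ι) (n : ℤ) : affReflection P i n ∈ affineWeyl b := by
  rcases posRoot_or_neg b i with hi | hi
  · exact Subgroup.subset_closure ⟨i, hi, n, rfl⟩
  · rw [← affReflection_reflectionPerm_self]
    exact Subgroup.subset_closure ⟨_, hi, -n, rfl⟩

lemma translation_add (γ δ : V) : translation (γ + δ) = translation γ * translation δ := by
  ext v; simp [translation]

lemma translation_zero : translation (0 : V) = 1 := by
  ext v; simp [translation]

lemma translation_neg (γ : V) : translation (-γ) = (translation γ)⁻¹ := by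
  rw [eq_inv_iff_mul_eq_one, ← translation_add, neg_add_cancel, translation_zero]

@[simp] lemma translation_apply (γ v : V) : translation γ v = γ + v := by
  simp [translation]

lemma translation_root (i : ι) :
    translation (P.root i) = affReflection P i 1 * affReflection P i 0 := by
  ext v
  simp only [AffineEquiv.coe_mul, Function.comp_apply, affReflection_apply, map_sub, map_smul, coroot'_root_self,
    smul_eq_mul, translation_apply]
  push_cast
  module

variable (b) in
lemma translation_mem_affineWeyl {γ : V} (hγ : γ ∈ rootLattice P) :
    translation γ ∈ affineWeyl b := by
  induction hγ using AddSubgroup.closure_induction with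
  | mem x hx =>
    obtain ⟨i, rfl⟩ := hx
    rw [translation_root]
    exact mul_mem (affReflection_mem_affineWeyl b _ _) (affReflection_mem_affineWeyl b _ _)
  | zero => rw [translation_zero]; exact one_mem _
  | add x y _ _ hx hy => rw [translation_add]; exact mul_mem hx hy
  | neg x _ hx => rw [translation_neg]; exact inv_mem hx

lemma root_mem_rootLattice (i : ι) : P.root i ∈ rootLattice P :=
  AddSubgroup.subset_closure ⟨i, rfl⟩

lemma coroot'_int_of_mem_rootLattice [P.IsCrystallographic] {γ : V} (hγ : γ ∈ rootLattice P) (i : ι) :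
    ∃ m : ℤ, P.coroot' i γ = m := by
  induction hγ using AddSubgroup.closure_induction with
  | mem x hx =>
    obtain ⟨j, rfl⟩ := hx
    obtain ⟨z, hz⟩ := P.exists_value (S := ℤ) j i
    exact ⟨z, by simpa using hz.symm⟩
  | zero => exact ⟨0, by simp⟩
  | add x y _ _ hx hy =>
    obtain ⟨m, hm⟩ := hx
    obtain ⟨n, hn⟩ := hy
    exact ⟨m + n, by rw [map_add, hm, hn]; push_cast; rfl⟩
  | neg x _ hx =>
    obtain ⟨m, hm⟩ := hx
    exact ⟨-m, by rw [map_neg, hm]; push_cast; rfl⟩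

/-- The affine automorphism `g` has a linear part that permutes roots and coroots through `σ`, and
maps the origin into the root lattice. Every element of the affine Weyl group is of this kind. -/
structure PermutesRoots (P : RootPairing ι ℝ V N) (σ : Equiv.Perm ι) (g : V ≃ᵃ[ℝ] V) : Prop where
  root : ∀ i, g.linear (P.root i) = P.root (σ i)
  coroot : ∀ i v, P.coroot' (σ i) (g.linear v) = P.coroot' i v
  zero : g 0 ∈ rootLattice P

lemma AffineEquiv.apply_eq_linear_add (g : V ≃ᵃ[ℝ] V) (v : V) : g v = g.linear v + g 0 := by
  have := g.map_vadd 0 v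
  simpa using this

lemma PermutesRoots.linear_mem {σ : Equiv.Perm ι} {g : V ≃ᵃ[ℝ] V} (h : PermutesRoots P σ g) {γ : V}
    (hγ : γ ∈ rootLattice P) : g.linear γ ∈ rootLattice P := by
  induction hγ using AddSubgroup.closure_induction with
  | mem x hx =>
    obtain ⟨j, rfl⟩ := hx
    rw [h.root]; exact root_mem_rootLattice _
  | zero => simp
  | add x y _ _ hx hy => rw [map_add]; exact add_mem hx hy
  | neg x _ hx => rw [map_neg]; exact neg_mem hx

lemma PermutesRoots.one : PermutesRoots P 1 1 := ⟨fun _ => rfl, fun _ _ => rfl, zero_mem _⟩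

lemma PermutesRoots.mul {σ τ : Equiv.Perm ι} {g h : V ≃ᵃ[ℝ] V} (hg : PermutesRoots P σ g)
    (hh : PermutesRoots P τ h) : PermutesRoots P (σ * τ) (g * h) where
  root i := by
    show g.linear (h.linear _) = _
    rw [hh.root, hg.root]; rfl
  coroot i v := by
    show P.coroot' (σ (τ i)) (g.linear (h.linear v)) = _
    rw [hg.coroot, hh.coroot]
  zero := by
    rw [AffineEquiv.coe_mul, Function.comp_apply, AffineEquiv.apply_eq_linear_add]
    exact add_mem (hg.linear_mem hh.zero) hg.zero

lemma PermutesRoots.translation {γ : V} (hγ : γ ∈ rootLattice P) :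
    PermutesRoots P 1 (AlcoveSheaf.translation γ) where
  root _ := rfl
  coroot _ _ := rfl
  zero := by simpa using hγ

lemma PermutesRoots.affReflection (i : ι) (n : ℤ) :
    PermutesRoots P (P.reflectionPerm i) (affReflection P i n) where
  root j := by
    show P.reflection i (P.root j) = _
    rw [RootPairing.root_reflectionPerm]
  coroot j v := by
    show P.coroot' _ (P.reflection i v) = _
    rw [RootPairing.coroot'_reflectionPerm]
    simp
  zero := by
    rw [affReflection_apply]
    have : (0 : V) - (P.coroot' i 0 - n) • P.root i = n • P.root i := by
      simp [Int.cast_smul_eq_zsmul]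
    rw [this]
    exact zsmul_mem (root_mem_rootLattice i) n

lemma exists_permutesRoots {g : V ≃ᵃ[ℝ] V} (hg : g ∈ affineWeyl b) :
    ∃ σ, PermutesRoots P σ g := by
  induction hg using Subgroup.closure_induction_left with
  | one => exact ⟨1, PermutesRoots.one⟩
  | mul_left x hx y _ hy =>
    obtain ⟨i, _, n, rfl⟩ := hx
    obtain ⟨σ, hσ⟩ := hy
    exact ⟨_, (PermutesRoots.affReflection i n).mul hσ⟩
  | inv_mul_cancel x hx y _ hy =>
    obtain ⟨i, _, n, rfl⟩ := hx
    obtain ⟨σ, hσ⟩ := hy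
    rw [inv_eq_of_mul_eq_one_left (affReflection_mul_self i n)]
    exact ⟨_, (PermutesRoots.affReflection i n).mul hσ⟩

/-- An element of the affine Weyl group moves the hyperplane `H_{i,n}` to some `H_{j,m}`. -/
lemma PermutesRoots.exists_coroot' [P.IsCrystallographic] {σ : Equiv.Perm ι} {g : V ≃ᵃ[ℝ] V}
    (h : PermutesRoots P σ g) (i : ι) :
    ∃ m : ℤ, (∀ v, P.coroot' (σ i) (g v) = P.coroot' i v + m) ∧
      ∀ n : ℤ, g * AlcoveSheaf.affReflection P i n =
        AlcoveSheaf.affReflection P (σ i) (n + m) * g := by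
  obtain ⟨m, hm⟩ := coroot'_int_of_mem_rootLattice h.zero (σ i)
  have key : ∀ v, P.coroot' (σ i) (g v) = P.coroot' i v + m := fun v => by
    rw [AffineEquiv.apply_eq_linear_add, map_add, h.coroot, hm]
  refine ⟨m, key, fun n => ?_⟩
  ext v
  simp only [AffineEquiv.coe_mul, Function.comp_apply]
  rw [affReflection_apply, affReflection_apply, AffineEquiv.apply_eq_linear_add, map_sub, map_smul,
    h.root, key, AffineEquiv.apply_eq_linear_add g v]
  push_cast
  module

/-- Two points lie on the same side of every hyperplane. -/
def SameSide (P : RootPairing ι ℝ V N) (u v : V) : Prop :=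
  ∀ (i : ι) (n : ℤ), P.coroot' i u < n ↔ P.coroot' i v < n

lemma SameSide.lt_iff {u v : V} (h : SameSide P u v) (i : ι) (n : ℤ) :
    n < P.coroot' i u ↔ n < P.coroot' i v := by
  have := h (P.reflectionPerm i i) (-n)
  rw [coroot'_reflectionPerm_self, coroot'_reflectionPerm_self] at this
  push_cast at this
  simpa using this

lemma SameSide.refl (u : V) : SameSide P u u := fun _ _ => Iff.rfl

lemma SameSide.symm {u v : V} (h : SameSide P u v) : SameSide P v u := fun i n => (h i n).symm

lemma SameSide.mem_regularSet {u v : V} (h : SameSide P u v) (hu : u ∈ regularSet b) :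
    v ∈ regularSet b := by
  rw [AlcoveSheaf.mem_regularSet] at hu ⊢
  intro i n hn
  rcases lt_or_gt_of_ne (hu i n) with h1 | h1
  · exact absurd ((h i n).1 h1) (by rw [hn]; exact lt_irrefl _)
  · exact absurd ((h.lt_iff i n).1 h1) (by rw [hn]; exact lt_irrefl _)

lemma SameSide.map [P.IsCrystallographic] {u v : V} (h : SameSide P u v) {σ : Equiv.Perm ι}
    {g : V ≃ᵃ[ℝ] V} (hg : PermutesRoots P σ g) : SameSide P (g u) (g v) := by
  intro i n
  obtain ⟨m, hm, -⟩ := hg.exists_coroot' (σ.symm i)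
  rw [Equiv.apply_symm_apply] at hm
  rw [hm, hm]
  have := h (σ.symm i) (n - m)
  push_cast at this
  rw [← lt_sub_iff_add_lt, ← lt_sub_iff_add_lt]
  exact this

lemma convex_sameSide (a : V) : Convex ℝ {v | SameSide P a v} := by
  have : {v | SameSide P a v} = ⋂ (i : ι) (n : ℤ), ({v | P.coroot' i a < n ↔ P.coroot' i v < n}) := by
    ext v; simp [SameSide]
  rw [this]
  refine convex_iInter fun i => convex_iInter fun n => ?_
  by_cases h : P.coroot' i a < n
  · simp only [h, true_iff]
    exact convex_halfSpace_lt (P.coroot' i).isLinear _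
  · simp only [h, false_iff, not_lt]
    exact convex_halfSpace_ge (P.coroot' i).isLinear _

lemma image_sameSide [P.IsCrystallographic] {σ : Equiv.Perm ι} {g : V ≃ᵃ[ℝ] V} (hg : PermutesRoots P σ g)
    (hg' : ∃ τ, PermutesRoots P τ g⁻¹) (a : V) :
    g '' {v | SameSide P a v} = {v | SameSide P (g a) v} := by
  obtain ⟨τ, hτ⟩ := hg'
  ext v
  constructor
  · rintro ⟨w, hw, rfl⟩
    exact SameSide.map hw hg
  · intro hv
    refine ⟨g⁻¹ v, ?_, g.apply_symm_apply v⟩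
    have := SameSide.map hv hτ
    rwa [show g⁻¹ (g a) = a from g.symm_apply_apply a] at this

lemma finiteDimensional_of_isRootSystem [Finite ι] [P.IsRootSystem] : FiniteDimensional ℝ V := by
  rw [FiniteDimensional, Module.finite_def, ← RootPairing.IsRootSystem.span_root_eq_top (P := P)]
  exact Submodule.fg_span (Set.finite_range _)

variable [TopologicalSpace V]

lemma Alcove.nonempty (A : Alcove b) : A.1.Nonempty := by
  obtain ⟨S, v, hv, rfl⟩ := A
  exact ⟨v, mem_connectedComponentIn hv⟩

lemma Alcove.subset_regularSet (A : Alcove b) : A.1 ⊆ regularSet b := by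
  obtain ⟨S, v, hv, rfl⟩ := A
  exact connectedComponentIn_subset _ _

/-- The alcove of a regular point. -/
def alcoveOf {v : V} (hv : v ∈ regularSet b) : Alcove b :=
  ⟨connectedComponentIn (regularSet b) v, v, hv, rfl⟩

lemma mem_alcoveOf {v : V} (hv : v ∈ regularSet b) : v ∈ (alcoveOf hv).1 :=
  mem_connectedComponentIn hv

lemma IsImage.unique {g : V ≃ᵃ[ℝ] V} {A B B' : Alcove b} (h : IsImage g A B)
    (h' : IsImage g A B') : B = B' := Subtype.ext (h.trans h'.symm)

variable [IsTopologicalAddGroup V] [ContinuousSMul ℝ V] [T2Space V]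
  [Finite ι] [P.IsRootSystem]

lemma continuous_coroot' (i : ι) : Continuous (P.coroot' i) :=
  haveI := finiteDimensional_of_isRootSystem (P := P)
  LinearMap.continuous_of_finiteDimensional _

lemma connectedComponentIn_regularSet {a : V} (ha : a ∈ regularSet b) :
    connectedComponentIn (regularSet b) a = {v | SameSide P a v} := by
  apply Set.Subset.antisymm
  · intro v hv
    have hc : IsPreconnected (connectedComponentIn (regularSet b) a) :=
      isPreconnected_connectedComponentIn
    have hsub : connectedComponentIn (regularSet b) a ⊆ regularSet b :=
      connectedComponentIn_subset _ _
    have ha' := mem_connectedComponentIn ha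
    intro i n
    have him := (hc.image _ (continuous_coroot' (P := P) i).continuousOn).ordConnected
    have hnot : (n : ℝ) ∉ P.coroot' i '' connectedComponentIn (regularSet b) a := by
      rintro ⟨w, hw, h⟩
      exact mem_regularSet.1 (hsub hw) i n h
    constructor
    · intro h
      by_contra h'
      exact hnot (him.out (Set.mem_image_of_mem _ ha') (Set.mem_image_of_mem _ hv)
        ⟨h.le, not_lt.1 h'⟩)
    · intro h
      by_contra h'
      exact hnot (him.out (Set.mem_image_of_mem _ hv) (Set.mem_image_of_mem _ ha')
        ⟨h.le, not_lt.1 h'⟩)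
  · exact (convex_sameSide a).isPreconnected.subset_connectedComponentIn (SameSide.refl a)
      fun v hv => SameSide.mem_regularSet hv ha

/-- An alcove consists of all points on the same side of every hyperplane as one of its points. -/
lemma Alcove.eq_sameSide (A : Alcove b) {a : V} (ha : a ∈ A.1) : A.1 = {v | SameSide P a v} := by
  have hreg := A.subset_regularSet ha
  obtain ⟨S, v, hv, rfl⟩ := A
  exact (connectedComponentIn_eq ha).trans (connectedComponentIn_regularSet hreg)

lemma Alcove.sameSide (A : Alcove b) {a a' : V} (ha : a ∈ A.1) (ha' : a' ∈ A.1) :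
    SameSide P a a' := by
  rw [A.eq_sameSide ha] at ha'
  exact ha'

lemma Alcove.ext_of_mem {A B : Alcove b} {v : V} (hA : v ∈ A.1) (hB : v ∈ B.1) : A = B :=
  Subtype.ext (by rw [A.eq_sameSide hA, B.eq_sameSide hB])

variable [P.IsCrystallographic]

/-- The affine Weyl group acts on the set of alcoves. -/
lemma exists_isImage {g : V ≃ᵃ[ℝ] V} (hg : g ∈ affineWeyl b) (A : Alcove b) :
    ∃ B : Alcove b, IsImage g A B := by
  obtain ⟨a, ha⟩ := A.nonempty
  obtain ⟨σ, hσ⟩ := exists_permutesRoots hg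
  have hreg : g a ∈ regularSet b := by
    rw [mem_regularSet]
    intro i n hn
    obtain ⟨m, hm, -⟩ := hσ.exists_coroot' (σ.symm i)
    rw [Equiv.apply_symm_apply] at hm
    refine mem_regularSet.1 (A.subset_regularSet ha) (σ.symm i) (n - m) ?_
    rw [hm] at hn
    push_cast
    linarith
  refine ⟨alcoveOf hreg, ?_⟩
  rw [IsImage, A.eq_sameSide ha, image_sameSide hσ (exists_permutesRoots (inv_mem hg)),
    (alcoveOf hreg).eq_sameSide (mem_alcoveOf hreg)]

end AlcoveGeometry

/-! ### Walls of an alcove -/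

section Walls

variable {ι V N : Type u} [AddCommGroup V] [Module ℝ V] [AddCommGroup N] [Module ℝ N]
  {P : RootPairing ι ℝ V N} {b : P.Base}

/-- The hyperplane `H_{i,n}` separates the points `u` and `v`. -/
def Separates (P : RootPairing ι ℝ V N) (i : ι) (n : ℤ) (u v : V) : Prop :=
  (P.coroot' i u - n) * (P.coroot' i v - n) < 0

/-- `g` is the reflection in a wall of the alcove of `c`: its hyperplane is the only one that
separates `c` from `g c`. -/
def IsWallReflection (P : RootPairing ι ℝ V N) (c : V) (g : V ≃ᵃ[ℝ] V) : Prop :=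
  (∃ i n, g = affReflection P i n) ∧
    ∀ (j : ι) (m : ℤ), Separates P j m c (g c) → affReflection P j m = g

lemma SameSide.separates {i : ι} {n : ℤ} {u u' v v' : V} (hu : SameSide P u u')
    (hv : SameSide P v v') (h : Separates P i n u v) : Separates P i n u' v' := by
  unfold Separates at *
  rcases mul_neg_iff.1 h with ⟨h1, h2⟩ | ⟨h1, h2⟩
  · exact mul_neg_of_pos_of_neg (sub_pos.2 ((hu.lt_iff i n).1 (sub_pos.1 h1)))
      (sub_neg.2 ((hv i n).1 (sub_neg.1 h2)))
  · exact mul_neg_of_neg_of_pos (sub_neg.2 ((hu i n).1 (sub_neg.1 h1)))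
      (sub_pos.2 ((hv.lt_iff i n).1 (sub_pos.1 h2)))

/-- An alcove is cut out by one strict inequality for each root. -/
lemma sameSide_iff_floor_lt {c v : V} (hc : c ∈ regularSet b) :
    SameSide P c v ↔ ∀ i, (⌊P.coroot' i c⌋ : ℝ) < P.coroot' i v := by
  rw [mem_regularSet] at hc
  constructor
  · intro h i
    exact (h.lt_iff i _).1 (lt_of_le_of_ne (Int.floor_le _) (hc i _).symm)
  · intro h i n
    constructor
    · intro hn
      have h1 := h (P.reflectionPerm i i)
      rw [coroot'_reflectionPerm_self, coroot'_reflectionPerm_self] at h1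
      have h2 : -(n : ℤ) ≤ ⌊-P.coroot' i c⌋ := by
        rw [Int.le_floor]; push_cast; linarith
      have h3 : ((-n : ℤ) : ℝ) ≤ (⌊-P.coroot' i c⌋ : ℝ) := by exact_mod_cast h2
      push_cast at h3
      linarith
    · intro hn
      have h1 := (h i).trans hn
      exact Int.floor_lt.1 (by exact_mod_cast h1)

section Root

variable [Finite ι] [P.IsReduced]

/-- A hyperplane determines its affine reflection. -/
lemma affReflection_eq_of_hyperplane_subset {i j : ι} {n m : ℤ}
    (h : ∀ v, P.coroot' i v = n → P.coroot' j v = m) :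
    affReflection P j m = affReflection P i n := by
  have h0 : P.coroot' j (((n : ℝ) / 2) • P.root i) = m := h _ (by simp)
  have hker : ∀ x, P.coroot' i x = 0 → P.coroot' j x = 0 := fun x hx => by
    have := h (((n : ℝ) / 2) • P.root i + x) (by rw [map_add, hx]; simp)
    rw [map_add, h0] at this
    linarith
  set t : ℝ := P.coroot' j (P.root i) / 2 with ht
  have hprop : ∀ x, P.coroot' j x = t * P.coroot' i x := fun x => by
    have := hker (x - (P.coroot' i x / 2) • P.root i) (by
      rw [map_sub, map_smul, coroot'_root_self, smul_eq_mul]; ring)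
    rw [map_sub, map_smul, smul_eq_mul, sub_eq_zero] at this
    rw [this, ht]; ring
  have hco : P.flip.root j = t • P.flip.root i := by
    show P.coroot j = t • P.coroot i
    refine P.flip.toPerfPair.injective (LinearMap.ext fun x => ?_)
    simpa using hprop x
  have : IsAddTorsionFree V := IsAddTorsionFree.of_isTorsionFree ℝ V
  have hro : t • P.root j = P.root i := RootPairing.smul_coroot_eq_of_root_eq_smul (P := P.flip) i j t hco
  by_cases hij : i = j
  · subst hij
    have : (n : ℝ) = m := by simpa using h0
    rw [Int.cast_injective this]
  · have hdep : ¬ LinearIndependent ℝ ![P.root i, P.root j] := by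
      intro hli
      have := LinearIndependent.pair_iff.1 hli 1 (-t) (by rw [← hro]; module)
      exact one_ne_zero this.1
    have hneg := P.isReduced_iff'.1 inferInstance i j hij hdep
    have hi : i = P.reflectionPerm j j := P.root.injective (by rw [hneg, root_reflectionPerm_self])
    have hm : m = -n := by
      have : P.coroot' j (((n : ℝ) / 2) • P.root i) = -n := by rw [hneg]; simp
      rw [h0] at this
      exact_mod_cast this
    rw [hi, hm, ← affReflection_reflectionPerm_self (P := P) j, neg_neg]

end Root

end Walls

section WallTheory

open Filter Topology

variable {ι V N : Type u} [AddCommGroup V] [Module ℝ V] [AddCommGroup N] [Module ℝ N]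
  {P : RootPairing ι ℝ V N} {b : P.Base}

lemma PermutesRoots.exists_separates [P.IsCrystallographic] {σ : Equiv.Perm ι} {w : V ≃ᵃ[ℝ] V}
    (hw : PermutesRoots P σ w) {i : ι} {n : ℤ} {u v : V} (h : Separates P i n (w u) (w v)) :
    ∃ j m, Separates P j m u v ∧ w * AlcoveSheaf.affReflection P j m =
      AlcoveSheaf.affReflection P i n * w := by
  obtain ⟨m, hm, hm'⟩ := hw.exists_coroot' (σ.symm i)
  rw [Equiv.apply_symm_apply] at hm hm'
  refine ⟨σ.symm i, n - m, ?_, ?_⟩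
  · unfold Separates at *
    rw [hm, hm] at h
    push_cast
    convert h using 2 <;> ring
  · rw [hm', sub_add_cancel]

variable [Finite ι] [P.IsReduced]

/-- If `p` lies on `H_{i,n}` and every point `p + ε x` with `⟨x, α_i^∨⟩ > 0` and `ε > 0` small lies
in the alcove of `c`, then `H_{i,n}` is a wall of that alcove. -/
lemma isWallReflection_of_eventually [P.IsCrystallographic] {c p : V} {i : ι} {n : ℤ}
    (hp : P.coroot' i p = n)
    (h : ∀ x, 0 < P.coroot' i x → ∀ᶠ ε in 𝓝[>] (0 : ℝ), SameSide P c (p + ε • x)) :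
    IsWallReflection P c (affReflection P i n) := by
  refine ⟨⟨i, n, rfl⟩, ?_⟩
  have hfix : affReflection P i n p = p := by rw [affReflection_apply, hp]; simp
  -- By symmetry it suffices to treat hyperplanes that have `c` on their positive side.
  suffices key : ∀ (j : ι) (m : ℤ), 0 < P.coroot' j c - m → P.coroot' j (affReflection P i n c) - m < 0 →
      affReflection P j m = affReflection P i n by
    intro j m hs
    rcases mul_neg_iff.1 hs with ⟨h1, h2⟩ | ⟨h1, h2⟩
    · exact key j m h1 h2
    · rw [← affReflection_reflectionPerm_self]
      refine key _ _ ?_ ?_ <;> rw [coroot'_reflectionPerm_self] <;> push_cast <;> linarith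
  intro j m h1 h2
  have hlin : ∀ x : V, Tendsto (fun ε : ℝ => P.coroot' j p - m + ε * P.coroot' j x) (𝓝[>] 0)
      (𝓝 (P.coroot' j p - m)) := fun x => by
    have : Tendsto (fun ε : ℝ => P.coroot' j p - m + ε * P.coroot' j x) (𝓝 0)
        (𝓝 (P.coroot' j p - m + 0 * P.coroot' j x)) := by
      refine Continuous.tendsto ?_ 0
      fun_prop
    rw [zero_mul, add_zero] at this
    exact this.mono_left nhdsWithin_le_nhds
  have hpos : ∀ x, 0 < P.coroot' i x →
      ∀ᶠ ε in 𝓝[>] (0 : ℝ), 0 < P.coroot' j p - m + ε * P.coroot' j x := fun x hx => by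
    filter_upwards [h x hx] with ε hε
    have := sub_pos.2 ((hε.lt_iff j m).1 (sub_pos.1 h1))
    rw [map_add, map_smul, smul_eq_mul] at this
    linarith
  have hneg : ∀ x, 0 < P.coroot' i x →
      ∀ᶠ ε in 𝓝[>] (0 : ℝ), P.coroot' j p - m + ε * P.coroot' j (P.reflection i x) < 0 := by
    intro x hx
    filter_upwards [h x hx] with ε hε
    have h3 := sub_neg.2 (((hε.map (PermutesRoots.affReflection i n)) j m).1 (sub_neg.1 h2))
    have h4 : affReflection P i n (p + ε • x) = p + ε • P.reflection i x := by
      rw [affReflection_apply, RootPairing.reflection_apply, map_add, map_smul, hp]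
      simp only [smul_eq_mul]
      module
    rw [h4, map_add, map_smul, smul_eq_mul] at h3
    linarith
  have hroot : 0 < P.coroot' i (P.root i) := by simp
  have hpm : P.coroot' j p = m := by
    have h5 := ge_of_tendsto (hlin _) ((hpos _ hroot).mono fun _ h => h.le)
    have h6 := le_of_tendsto (hlin _) ((hneg _ hroot).mono fun _ h => h.le)
    linarith
  have hcone : ∀ x, 0 < P.coroot' i x → 0 < P.coroot' j x := fun x hx => by
    obtain ⟨ε, hε, hε0⟩ := ((hpos x hx).and self_mem_nhdsWithin).exists
    rw [hpm, sub_self, zero_add] at hε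
    exact pos_of_mul_pos_right hε (le_of_lt hε0)
  have hnonneg : ∀ x, P.coroot' i x = 0 → 0 ≤ P.coroot' j x := fun x hx => by
    by_contra hlt
    push Not at hlt
    set r : ℝ := P.coroot' j (P.root i) with hr
    have hr0 : 0 < r := hcone _ hroot
    have := hcone (x + (-P.coroot' j x / r) • P.root i) (by
      rw [map_add, hx, zero_add, map_smul, coroot'_root_self, smul_eq_mul]
      exact mul_pos (div_pos (neg_pos.2 hlt) hr0) two_pos)
    rw [map_add, map_smul, smul_eq_mul, ← hr, div_mul_cancel₀ _ hr0.ne'] at this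
    linarith
  refine affReflection_eq_of_hyperplane_subset fun v hv => ?_
  have h7 := hnonneg (v - p) (by rw [map_sub, hv, hp, sub_self])
  have h8 := hnonneg (p - v) (by rw [map_sub, hv, hp, sub_self])
  rw [map_sub] at h7 h8
  linarith

/-- A point outside of an alcove is separated from it by one of its walls. The walls are found as
the members of a minimal set of half spaces that cuts out the alcove. -/
lemma exists_wall_separating [P.IsCrystallographic] {c v : V} (hc : c ∈ regularSet b)
    (hv : ¬ SameSide P c v) :
    ∃ i n, IsWallReflection P c (affReflection P i n) ∧ 0 < P.coroot' i c - n ∧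
      P.coroot' i v - n ≤ 0 := by
  set f : ι → V → ℝ := fun i v => P.coroot' i v - ⌊P.coroot' i c⌋ with hf
  have hfc : ∀ i, 0 < f i c := fun i =>
    sub_pos.2 ((sameSide_iff_floor_lt hc).1 (SameSide.refl c) i)
  have hcut : {v : V | ∀ i, 0 < f i v} = {v | SameSide P c v} := by
    ext w
    simp only [Set.mem_ofPred_eq, sameSide_iff_floor_lt hc, hf, sub_pos]
  obtain ⟨M, hM⟩ := Set.Finite.exists_minimal
    (s := {M : Set ι | ∀ w, (∀ i ∈ M, 0 < f i w) → SameSide P c w}) (Set.toFinite _)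
    ⟨Set.univ, fun w hw => by
      have : w ∈ {v : V | ∀ i, 0 < f i v} := fun i => hw i trivial
      rwa [hcut] at this⟩
  obtain ⟨i, hiM, hi⟩ : ∃ i ∈ M, f i v ≤ 0 := by
    by_contra! hcon
    exact hv (hM.prop v hcon)
  refine ⟨i, ⌊P.coroot' i c⌋, ?_, hfc i, hi⟩
  -- By minimality the half space of `i` cannot be dropped.
  obtain ⟨w, hw, hwc⟩ : ∃ w, (∀ k ∈ M, k ≠ i → 0 < f k w) ∧ ¬ SameSide P c w := by
    by_contra! hcon
    have : M \ {i} ∈ {M : Set ι | ∀ w, (∀ i ∈ M, 0 < f i w) → SameSide P c w} :=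
      fun w hw => hcon w fun k hk hki => hw k ⟨hk, hki⟩
    exact (hM.le_of_le this Set.sdiff_subset hiM).2 rfl
  have hiw : f i w ≤ 0 := by
    by_contra! hcon
    refine hwc (hM.prop w fun k hk => ?_)
    by_cases hki : k = i
    · rwa [hki]
    · exact hw k hk hki
  -- The segment from `c` to `w` meets the hyperplane of `i` in a point `p` of the open wall.
  set t : ℝ := f i c / (f i c - f i w) with ht
  have hden : 0 < f i c - f i w := by linarith [hfc i]
  have ht0 : 0 < t := div_pos (hfc i) hden
  have ht1 : t ≤ 1 := (div_le_one hden).2 (by linarith)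
  set p : V := (1 - t) • c + t • w with hp
  have hfp : ∀ k, f k p = (1 - t) * f k c + t * f k w := fun k => by
    simp only [hf, hp, map_add, map_smul, smul_eq_mul]; ring
  have hpi : f i p = 0 := by
    rw [hfp, ht]; field_simp; ring
  have hpk : ∀ k ∈ M, k ≠ i → 0 < f k p := fun k hk hki => by
    rw [hfp]
    have := mul_pos ht0 (hw k hk hki)
    have := mul_nonneg (sub_nonneg.2 ht1) (hfc k).le
    linarith
  refine isWallReflection_of_eventually (p := p) (sub_eq_zero.1 hpi) fun x hx => ?_
  have : ∀ᶠ ε in 𝓝[>] (0 : ℝ), ∀ k, k ∈ M → 0 < f k (p + ε • x) := by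
    refine eventually_all.2 fun k => ?_
    have hlin : ∀ ε : ℝ, f k (p + ε • x) = f k p + ε * P.coroot' k x := fun ε => by
      simp only [hf, map_add, map_smul, smul_eq_mul]; ring
    simp only [hlin]
    by_cases hki : k = i
    · subst hki
      filter_upwards [self_mem_nhdsWithin] with ε hε _
      rw [hpi, zero_add]
      exact mul_pos hε hx
    · by_cases hk : k ∈ M
      · have hcont : ContinuousAt (fun ε : ℝ => f k p + ε * P.coroot' k x) 0 := by fun_prop
        have := hcont.eventually (lt_mem_nhds (a := 0) (by simpa using hpk k hk hki))
        filter_upwards [nhdsWithin_le_nhds this] with ε hε _ using hε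
      · exact Eventually.of_forall fun _ h => absurd h hk
  filter_upwards [this] with ε hε using hM.prop _ hε

end WallTheory

/-! ### Simple transitivity on alcoves -/

section Freeness

variable {ι V N : Type u} [AddCommGroup V] [Module ℝ V] [AddCommGroup N] [Module ℝ N]
  {P : RootPairing ι ℝ V N} {b : P.Base}

/-- The subgroup generated by the reflections in the walls of the alcove of `c`. -/
def wallGroup (P : RootPairing ι ℝ V N) (c : V) : Subgroup (V ≃ᵃ[ℝ] V) :=
  Subgroup.closure {g | IsWallReflection P c g}

lemma wallGroup_le_affineWeyl (c : V) : wallGroup P c ≤ affineWeyl b := by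
  refine (Subgroup.closure_le _).2 ?_
  rintro g ⟨⟨i, n, rfl⟩, -⟩
  exact affReflection_mem_affineWeyl b i n

lemma IsWallReflection.mem {c : V} {g : V ≃ᵃ[ℝ] V} (h : IsWallReflection P c g) :
    g ∈ wallGroup P c := Subgroup.subset_closure h

lemma exists_list_of_mem_wallGroup {c : V} {w : V ≃ᵃ[ℝ] V} (hw : w ∈ wallGroup P c) :
    ∃ l : List (V ≃ᵃ[ℝ] V), (∀ g ∈ l, IsWallReflection P c g) ∧ l.prod = w := by
  induction hw using Subgroup.closure_induction_left with
  | one => exact ⟨[], by simp, rfl⟩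
  | mul_left g hg y _ hy =>
    obtain ⟨l, hl, rfl⟩ := hy
    exact ⟨g :: l, by simpa using ⟨hg, hl⟩, rfl⟩
  | inv_mul_cancel g hg y _ hy =>
    obtain ⟨l, hl, rfl⟩ := hy
    obtain ⟨i, n, hi⟩ := hg.1
    have : g⁻¹ = g := by
      rw [hi]
      exact inv_eq_of_mul_eq_one_left (affReflection_mul_self i n)
    exact ⟨g :: l, by simpa using ⟨hg, hl⟩, by rw [this]; rfl⟩

lemma PermutesRoots.mem_regularSet [P.IsCrystallographic] {σ : Equiv.Perm ι} {g : V ≃ᵃ[ℝ] V}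
    (hg : PermutesRoots P σ g) {v : V} (hv : v ∈ regularSet b) : g v ∈ regularSet b := by
  rw [AlcoveSheaf.mem_regularSet] at hv ⊢
  intro i n hn
  obtain ⟨m, hm, -⟩ := hg.exists_coroot' (σ.symm i)
  rw [Equiv.apply_symm_apply] at hm
  refine hv (σ.symm i) (n - m) ?_
  rw [hm] at hn
  push_cast
  linarith

/-- Reflecting `v` in a hyperplane that separates it from `c` moves it closer to `c`, for the
invariant quadratic form `∑ ⟨·, α^∨⟩²`. -/
lemma sum_sq_affReflection_lt [Fintype ι] {i : ι} {n : ℤ} {c v : V} (hc : 0 < P.coroot' i c - n)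
    (hv : P.coroot' i v - n < 0) :
    ∑ j, (P.coroot' j (affReflection P i n v - c)) ^ 2 < ∑ j, (P.coroot' j (v - c)) ^ 2 := by
  have hB : ∀ x, P.RootForm x x = ∑ j, (P.coroot' j x) ^ 2 := fun x => by
    rw [RootPairing.rootForm_apply_apply]
    exact Finset.sum_congr rfl fun j _ => by rw [sq]
  rw [← hB, ← hB]
  set r := P.root i with hr
  set x := v - c with hx
  set t := P.coroot' i v - n with ht
  have h1 : affReflection P i n v - c = x - t • r := by
    rw [affReflection_apply, hx]; abel
  have h2 : P.RootForm r x = P.RootForm r r * P.coroot' i x / 2 := by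
    have h := P.rootForm_reflection_reflection_apply i r x
    rw [RootPairing.reflection_apply_self, RootPairing.reflection_apply] at h
    simp only [map_neg, map_sub, map_smul, LinearMap.neg_apply, smul_eq_mul] at h
    rw [← hr] at h
    linarith
  have h3 : P.RootForm x r = P.RootForm r x := P.rootForm_symmetric.eq x r
  have h4 : 0 < P.RootForm r r := by
    rw [hB]
    refine lt_of_lt_of_le ?_ (Finset.single_le_sum (f := fun j => (P.coroot' j r) ^ 2)
      (fun j _ => sq_nonneg _) (Finset.mem_univ i))
    simp [hr]
  have h5 : P.coroot' i x = t - (P.coroot' i c - n) := by rw [hx, map_sub, ht]; ring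
  rw [h1]
  simp only [map_sub, map_smul, LinearMap.sub_apply, LinearMap.smul_apply, smul_eq_mul]
  rw [h3, h2, h5]
  nlinarith [mul_pos h4 (mul_pos_of_neg_of_neg hv (neg_lt_zero.2 hc))]

variable [P.IsCrystallographic]

/-- The exchange condition: if the wall of a wall reflection `s` separates `c` from `w c`, then
`s w` has a shorter expression than `w`. -/
lemma exists_shorter_mul {c : V} (hc : c ∈ regularSet b) {i : ι} {n : ℤ} (l : List (V ≃ᵃ[ℝ] V))
    (hl : ∀ g ∈ l, IsWallReflection P c g) (hs : Separates P i n c (l.prod c)) :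
    ∃ l' : List (V ≃ᵃ[ℝ] V), (∀ g ∈ l', IsWallReflection P c g) ∧ l'.length < l.length ∧
      affReflection P i n * l.prod = l'.prod := by
  induction l using List.reverseRecOn with
  | nil =>
    exfalso
    have : Separates P i n c c := hs
    exact absurd (mul_self_nonneg (P.coroot' i c - n)) (not_le.2 this)
  | append_singleton l g ih =>
    have hl' : ∀ g ∈ l, IsWallReflection P c g := fun x hx => hl x (by simp [hx])
    have hg : IsWallReflection P c g := hl g (by simp)
    have hmem : l.prod ∈ affineWeyl b :=
      wallGroup_le_affineWeyl c (list_prod_mem fun x hx => (hl' x hx).mem)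
    obtain ⟨σ, hσ⟩ := exists_permutesRoots hmem
    by_cases h : Separates P i n c (l.prod c)
    · obtain ⟨l', h1, h2, h3⟩ := ih hl' h
      refine ⟨l' ++ [g], ?_, by simpa using h2, ?_⟩
      · intro x hx
        rcases List.mem_append.1 hx with hx | hx
        · exact h1 x hx
        · rwa [List.mem_singleton.1 hx]
      · rw [List.prod_append, ← mul_assoc, h3, List.prod_append]
    · have hreg := sub_ne_zero.2 (mem_regularSet.1 (hσ.mem_regularSet hc) i n)
      have hcreg := sub_ne_zero.2 (mem_regularSet.1 hc i n)
      have h1 : 0 < (P.coroot' i c - n) * (P.coroot' i (l.prod c) - n) :=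
        lt_of_le_of_ne (not_lt.1 h) (mul_ne_zero hcreg hreg).symm
      have h2 : Separates P i n (l.prod c) (l.prod (g c)) := by
        have hs' : (P.coroot' i c - n) * (P.coroot' i (l.prod (g c)) - n) < 0 := by
          simpa [Separates] using hs
        unfold Separates
        rcases pos_and_pos_or_neg_and_neg_of_mul_pos h1 with ⟨h3, h4⟩ | ⟨h3, h4⟩
        · exact mul_neg_of_pos_of_neg h4 (by nlinarith)
        · exact mul_neg_of_neg_of_pos h4 (by nlinarith)
      obtain ⟨j, m, h5, h6⟩ := hσ.exists_separates h2
      refine ⟨l, hl', by simp, ?_⟩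
      rw [List.prod_append, List.prod_singleton, ← mul_assoc, ← h6, hg.2 j m h5, mul_assoc]
      obtain ⟨⟨i', n', rfl⟩, -⟩ := hg
      rw [affReflection_mul_self, mul_one]

variable [Finite ι] [P.IsReduced]

/-- The wall reflections of an alcove move every regular point into it. -/
lemma exists_wallGroup_sameSide {c a : V} (hc : c ∈ regularSet b) (ha : a ∈ regularSet b) :
    ∃ w ∈ wallGroup P c, SameSide P c (w a) := by
  classical
  have := Fintype.ofFinite ι
  -- The values of the coroots at `w a` are recorded by a permutation and integers; only finitely
  -- many of these keep `w a` within a given distance from `c`.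
  set Q : Equiv.Perm ι × (ι → ℤ) → ℝ :=
    fun x => ∑ i, (P.coroot' i a + x.2 i - P.coroot' (x.1 i) c) ^ 2 with hQ
  set K : Set (Equiv.Perm ι × (ι → ℤ)) :=
    {x | ∃ w ∈ wallGroup P c, ∀ i, P.coroot' (x.1 i) (w a) = P.coroot' i a + x.2 i} with hK
  have hQK : ∀ (x) (w : V ≃ᵃ[ℝ] V), (∀ i, P.coroot' (x.1 i) (w a) = P.coroot' i a + x.2 i) →
      Q x = ∑ j, (P.coroot' j (w a - c)) ^ 2 := fun x w h => by
    rw [hQ, ← Equiv.sum_comp x.1]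
    exact Finset.sum_congr rfl fun i _ => by rw [map_sub, h]
  have hdata : ∀ w ∈ wallGroup P c, ∃ x : Equiv.Perm ι × (ι → ℤ),
      ∀ i, P.coroot' (x.1 i) (w a) = P.coroot' i a + x.2 i := fun w hw => by
    obtain ⟨σ, hσ⟩ := exists_permutesRoots (wallGroup_le_affineWeyl (b := b) c hw)
    choose m hm _ using hσ.exists_coroot'
    exact ⟨(σ, m), fun i => hm i a⟩
  have hfin : ∀ B, {x | Q x ≤ B}.Finite := fun B => by
    have hsub : {x | Q x ≤ B} ⊆ ⋃ σ : Equiv.Perm ι, (Prod.mk σ) '' (Set.Icc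
        (fun i => ⌊P.coroot' (σ i) c - P.coroot' i a - (B + 1)⌋)
        (fun i => ⌈P.coroot' (σ i) c - P.coroot' i a + (B + 1)⌉)) := by
      rintro ⟨σ, m⟩ hx
      refine Set.mem_iUnion.2 ⟨σ, m, ?_, rfl⟩
      have hi : ∀ i, |P.coroot' i a + m i - P.coroot' (σ i) c| ≤ B + 1 := fun i => by
        have h1 : (P.coroot' i a + m i - P.coroot' (σ i) c) ^ 2 ≤ B :=
          (Finset.single_le_sum (f := fun i => (P.coroot' i a + m i - P.coroot' (σ i) c) ^ 2)
            (fun j _ => sq_nonneg _) (Finset.mem_univ i)).trans hx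
        rw [abs_le]
        constructor <;> nlinarith
      constructor <;> intro i
      · have := (abs_le.1 (hi i)).1
        have h2 := Int.floor_le (P.coroot' (σ i) c - P.coroot' i a - (B + 1))
        exact_mod_cast h2.trans (by linarith : _ ≤ (m i : ℝ))
      · have := (abs_le.1 (hi i)).2
        have h2 := Int.le_ceil (P.coroot' (σ i) c - P.coroot' i a + (B + 1))
        exact_mod_cast (by linarith : (m i : ℝ) ≤ _).trans h2
    exact (Set.finite_iUnion fun σ => (Set.finite_Icc _ _).image _).subset hsub
  obtain ⟨x₀, hx₀⟩ := hdata 1 (one_mem _)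
  obtain ⟨x, ⟨⟨w, hw, hxw⟩, hxB⟩, hmin⟩ := Set.exists_min_image (K ∩ {x | Q x ≤ Q x₀}) Q
    ((hfin _).inter_of_right _) ⟨x₀, ⟨1, one_mem _, hx₀⟩, le_refl (Q x₀)⟩
  refine ⟨w, hw, ?_⟩
  by_contra hcon
  obtain ⟨i, n, hwall, h1, h2⟩ := exists_wall_separating hc hcon
  obtain ⟨σ, hσ⟩ := exists_permutesRoots (wallGroup_le_affineWeyl (b := b) c hw)
  have h3 : P.coroot' i (w a) - n < 0 :=
    lt_of_le_of_ne h2 (sub_ne_zero.2 (mem_regularSet.1 (hσ.mem_regularSet ha) i n))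
  have hw' : affReflection P i n * w ∈ wallGroup P c := mul_mem hwall.mem hw
  obtain ⟨y, hy⟩ := hdata _ hw'
  have hlt : Q y < Q x := by
    rw [hQK y _ hy, hQK x w hxw]
    exact sum_sq_affReflection_lt h1 h3
  exact absurd (hmin y ⟨⟨_, hw', hy⟩, hlt.le.trans hxB⟩) (not_le.2 hlt)

/-- Every affine reflection is a product of wall reflections of a given alcove: among its conjugates
choose one whose hyperplane is closest to `c`; it is a wall. -/
lemma affReflection_mem_wallGroup {c : V} (hc : c ∈ regularSet b) (i : ι) (n : ℤ) :
    affReflection P i n ∈ wallGroup P c := by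
  classical
  have := Fintype.ofFinite ι
  set K : Set (ι × ℤ) := {x | ∃ w ∈ wallGroup P c,
    w * affReflection P i n = affReflection P x.1 x.2 * w ∧ 0 < P.coroot' x.1 c - x.2} with hK
  set Q : ι × ℤ → ℝ := fun x => P.coroot' x.1 c - x.2 with hQ
  have hfin : ∀ B, (K ∩ {x | Q x ≤ B}).Finite := fun B => by
    refine (Set.finite_iUnion fun j => (Set.finite_Icc ⌊P.coroot' j c - B⌋
      ⌈P.coroot' j c⌉).image (Prod.mk j)).subset ?_
    rintro ⟨j, m⟩ ⟨⟨w, -, -, h0⟩, hB⟩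
    refine Set.mem_iUnion.2 ⟨j, m, ⟨?_, ?_⟩, rfl⟩
    · have h2 := Int.floor_le (P.coroot' j c - B)
      have : P.coroot' j c - m ≤ B := hB
      exact_mod_cast h2.trans (by linarith : _ ≤ (m : ℝ))
    · have h2 := Int.le_ceil (P.coroot' j c)
      exact_mod_cast (by linarith : (m : ℝ) ≤ _).trans h2
  have hsign : ∀ w ∈ wallGroup P c, ∀ j m, w * affReflection P i n = affReflection P j m * w →
      ∃ x ∈ K, affReflection P x.1 x.2 = affReflection P j m ∧ Q x = |P.coroot' j c - m| := by
    intro w hw j m h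
    rcases lt_or_gt_of_ne (sub_ne_zero.2 (mem_regularSet.1 hc j m)) with h0 | h0
    · refine ⟨(P.reflectionPerm j j, -m), ⟨w, hw, ?_, ?_⟩, affReflection_reflectionPerm_self _ _, ?_⟩
      · rw [affReflection_reflectionPerm_self, h]
      · rw [coroot'_reflectionPerm_self]; push_cast; linarith
      · rw [abs_of_neg h0]
        simp only [hQ]
        rw [coroot'_reflectionPerm_self]; push_cast; ring
    · exact ⟨(j, m), ⟨w, hw, h, h0⟩, rfl, (abs_of_pos h0).symm⟩
  obtain ⟨x₀, hx₀, -⟩ := hsign 1 (one_mem _) i n (by rw [one_mul, mul_one])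
  obtain ⟨⟨j, m⟩, ⟨⟨w, hw, hxw, h0⟩, hxB⟩, hmin⟩ := Set.exists_min_image (K ∩ {x | Q x ≤ Q x₀}) Q
    (hfin _) ⟨x₀, hx₀, le_refl (Q x₀)⟩
  have hmin' : ∀ y ∈ K, Q (j, m) ≤ Q y := fun y hy => by
    rcases le_total (Q y) (Q x₀) with h | h
    · exact hmin y ⟨hy, h⟩
    · exact hxB.trans h
  suffices h : affReflection P j m ∈ wallGroup P c by
    have : affReflection P i n = w⁻¹ * affReflection P j m * w := by
      rw [mul_assoc, ← hxw, inv_mul_cancel_left]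
    rw [this]
    exact mul_mem (mul_mem (inv_mem hw) h) hw
  by_contra hnot
  simp only at h0
  -- The projection of `c` onto the hyperplane would lie in the alcove of `c`.
  set d : ℝ := P.coroot' j c - m with hd
  set p : V := c - (d / 2) • P.root j with hp
  have hpm : P.coroot' j p = m := by
    rw [hp, map_sub, map_smul, coroot'_root_self, smul_eq_mul, hd]; ring
  by_cases hpc : SameSide P c p
  · exact mem_regularSet.1 (hpc.mem_regularSet hc) j m hpm
  obtain ⟨k, l, hwall, h1, h2⟩ := exists_wall_separating hc hpc
  set f : ℝ := P.coroot' k c - l with hf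
  -- The root of the wall forms an acute angle with the root `j`.
  have hkj : 0 < P.pairingIn ℤ j k := by
    have h3 : P.coroot' k p - l = f - d / 2 * P.pairing j k := by
      rw [hp, map_sub, map_smul, RootPairing.root_coroot'_eq_pairing, smul_eq_mul, hf]; ring
    rw [h3] at h2
    by_contra! hle
    have h4 : P.pairing j k ≤ 0 := by
      rw [← P.algebraMap_pairingIn ℤ]
      exact Int.cast_nonpos.2 hle
    nlinarith
  have hjk : 0 < P.pairing k j := by
    rw [← P.algebraMap_pairingIn ℤ]
    exact Int.cast_pos.2 ((P.zero_lt_pairingIn_iff' ℤ).1 hkj)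
  have hperm := PermutesRoots.affReflection (P := P) k l
  obtain ⟨q, hq, hq'⟩ := hperm.exists_coroot' j
  obtain ⟨y, hyK, -, hyQ⟩ := hsign (affReflection P k l * w) (mul_mem hwall.mem hw)
    (P.reflectionPerm k j) (m + q) (by
      rw [mul_assoc, hxw, ← mul_assoc, hq', mul_assoc])
  have h5 := hmin' y hyK
  have h6 := hq (affReflection P k l c)
  rw [affReflection_affReflection] at h6
  have h7 : P.coroot' j (affReflection P k l c) - m = d - f * P.pairing k j := by
    rw [affReflection_apply, map_sub, map_smul, RootPairing.root_coroot'_eq_pairing, smul_eq_mul,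
      hd]; ring
  have h8 : Q y = |d - f * P.pairing k j| := by
    rw [hyQ, h6, ← h7]; push_cast; congr 1; ring
  rw [h8] at h5
  have h9 : d ≤ |d - f * P.pairing k j| := h5
  have hfp := mul_pos h1 hjk
  rcases le_abs.1 h9 with h10 | h10
  · linarith
  · -- In this case the hyperplane separates `c` from its image under the wall reflection.
    refine hnot ?_
    rw [hwall.2 j m]
    · exact hwall.mem
    · unfold Separates
      rw [h7]
      nlinarith

lemma affineWeyl_le_wallGroup {c : V} (hc : c ∈ regularSet b) : affineWeyl b ≤ wallGroup P c := by
  refine (Subgroup.closure_le _).2 ?_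
  rintro g ⟨i, -, n, rfl⟩
  exact affReflection_mem_wallGroup hc i n

/-- The affine Weyl group acts freely on the set of alcoves. -/
lemma eq_one_of_sameSide {c : V} (hc : c ∈ regularSet b) {w : V ≃ᵃ[ℝ] V} (hw : w ∈ affineWeyl b)
    (h : SameSide P c (w c)) : w = 1 := by
  obtain ⟨l, hl, rfl⟩ := exists_list_of_mem_wallGroup (affineWeyl_le_wallGroup hc hw)
  clear hw
  induction hn : l.length using Nat.strong_induction_on generalizing l with
  | _ n ih =>
    subst hn
    match l with
    | [] => rfl
    | g :: l =>
      have hg := hl g (by simp)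
      obtain ⟨⟨i, n, rfl⟩, -⟩ := hg
      have hsep : Separates P i n c (l.prod c) := by
        have h1 := h.symm.map (PermutesRoots.affReflection i n)
        rw [List.prod_cons, AffineEquiv.coe_mul, Function.comp_apply,
          affReflection_affReflection] at h1
        refine (SameSide.refl c).separates h1.symm ?_
        unfold Separates
        rw [coroot'_affReflection_self]
        have := sub_ne_zero.2 (mem_regularSet.1 hc i n)
        have := mul_self_pos.2 this
        linarith
      obtain ⟨l', h1, h2, h3⟩ := exists_shorter_mul hc l (fun x hx => hl x (by simp [hx])) hsep
      rw [List.prod_cons, h3] at h ⊢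
      exact ih _ (h2.trans (by simp)) l' h1 h rfl

end Freeness

/-! ### Right translation and the finiteness of the set of orbits -/

section RightTranslation

variable {ι V N : Type u} [AddCommGroup V] [Module ℝ V] [AddCommGroup N] [Module ℝ N]
  {P : RootPairing ι ℝ V N} {b : P.Base} [TopologicalSpace V]

/-- The map `r` is right translation `A ↦ A s` by `s`: it is an involution that commutes with the
affine Weyl group, and the only hyperplane that can separate `A` from `A s` is the one whose
reflection exchanges the two. -/
structure IsRightTranslation (b : P.Base) (s : V ≃ᵃ[ℝ] V) (r : Alcove b → Alcove b) : Prop where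
  isRightTranslate_iff : ∀ A B, IsRightTranslate b s A B ↔ B = r A
  involutive : ∀ A, r (r A) = A
  map : ∀ g ∈ affineWeyl b, ∀ A B, IsImage g A B → IsImage g (r A) (r B)
  separated : ∀ (A : Alcove b) (i : ι) (n : ℤ), A.1 ⊆ negHalfSpace P i n →
    (r A).1 ⊆ negHalfSpace P i n ∨ IsImage (affReflection P i n) A (r A)

lemma IsImage.apply_mem {g : V ≃ᵃ[ℝ] V} {A B : Alcove b} (h : IsImage g A B) {v : V}
    (hv : v ∈ A.1) : g v ∈ B.1 := by
  rw [h]; exact Set.mem_image_of_mem _ hv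

lemma IsImage.mul {g h : V ≃ᵃ[ℝ] V} {A B C : Alcove b} (hg : IsImage g B C) (hh : IsImage h A B) :
    IsImage (g * h) A C := by
  unfold IsImage at *
  rw [hg, hh, Set.image_image]; rfl

lemma IsImage.inv {g : V ≃ᵃ[ℝ] V} {A B : Alcove b} (hg : IsImage g A B) : IsImage g⁻¹ B A := by
  unfold IsImage at *
  rw [hg, Set.image_image]
  show _ = (fun x => g.symm (g x)) '' A.1
  simp

variable [IsTopologicalAddGroup V] [ContinuousSMul ℝ V] [T2Space V] [Finite ι] [P.IsRootSystem]

lemma IsFundamental.lt_one {C : Alcove b} (hC : IsFundamental b C) (i : ι)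
    {v : V} (hv : v ∈ C.1) : P.coroot' i v < 1 := by
  have hopen : IsOpen {v | P.coroot' i v < 1} := isOpen_lt (continuous_coroot' i) continuous_const
  obtain ⟨w, hw1, hw2⟩ := mem_closure_iff.1 hC.2 _ hopen (by simp)
  have := (C.sameSide hw2 hv) i 1
  push_cast at this
  exact this.1 hw1

lemma IsFundamental.unique {C C' : Alcove b} (hC : IsFundamental b C) (hC' : IsFundamental b C') :
    C = C' := by
  obtain ⟨c, hc⟩ := C.nonempty
  obtain ⟨c', hc'⟩ := C'.nonempty
  refine Alcove.ext_of_mem (v := c') ?_ hc'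
  rw [C.eq_sameSide hc]
  refine (sameSide_iff_floor_lt (C.subset_regularSet hc)).2 fun i => ?_
  rcases posRoot_or_neg b i with hi | hi
  · have : ⌊P.coroot' i c⌋ = 0 := Int.floor_eq_zero_iff.2 ⟨(hC.1 c hc i hi).le, hC.lt_one i hc⟩
    rw [this]
    exact_mod_cast hC'.1 c' hc' i hi
  · have h1 := hC.1 c hc _ hi
    have h2 := hC'.lt_one (P.reflectionPerm i i) hc'
    rw [coroot'_reflectionPerm_self] at h1 h2
    have h3 : ⌊P.coroot' i c⌋ < 0 := Int.floor_lt.2 (by push_cast; linarith)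
    have h4 : (⌊P.coroot' i c⌋ : ℝ) ≤ -1 := by exact_mod_cast Int.le_sub_one_of_lt h3
    linarith

variable [P.IsReduced] [P.IsCrystallographic]

lemma IsImage.eq_of_mem_affineWeyl {g h : V ≃ᵃ[ℝ] V} (hg : g ∈ affineWeyl b) (hh : h ∈ affineWeyl b)
    {A B : Alcove b} (hgA : IsImage g A B) (hhA : IsImage h A B) : g = h := by
  obtain ⟨a, ha⟩ := A.nonempty
  have h1 : IsImage (h⁻¹ * g) A A := hhA.inv.mul hgA
  have h2 := eq_one_of_sameSide (A.subset_regularSet ha) (mul_mem (inv_mem hh) hg)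
    (A.sameSide ha (h1.apply_mem ha))
  exact (inv_mul_eq_one.1 h2).symm

/-- The affine Weyl group acts transitively on the set of alcoves. -/
lemma exists_isImage_of_alcoves (C A : Alcove b) : ∃ w ∈ affineWeyl b, IsImage w C A := by
  obtain ⟨a, ha⟩ := A.nonempty
  obtain ⟨c, hc⟩ := C.nonempty
  obtain ⟨w, hw, hwa⟩ := exists_wallGroup_sameSide (C.subset_regularSet hc) (A.subset_regularSet ha)
  have hw' := wallGroup_le_affineWeyl (b := b) c hw
  obtain ⟨B, hB⟩ := exists_isImage hw' A
  have : B = C := Alcove.ext_of_mem (hB.apply_mem ha) (by rw [C.eq_sameSide hc]; exact hwa)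
  subst this
  exact ⟨w⁻¹, inv_mem hw', hB.inv⟩

/-- A simple affine reflection is a wall reflection of the fundamental alcove. -/
lemma IsSimpleAffineReflection.isWallReflection {s : V ≃ᵃ[ℝ] V} (hs : IsSimpleAffineReflection b s) :
    ∃ C : Alcove b, IsFundamental b C ∧ ∀ c ∈ C.1, IsWallReflection P c s := by
  obtain ⟨i, -, n, rfl, C, hC, hspan⟩ := hs
  refine ⟨C, hC, fun c hc => ⟨⟨i, n, rfl⟩, fun j m hsep => ?_⟩⟩
  refine affReflection_eq_of_hyperplane_subset fun v hv => ?_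
  let Q : AffineSubspace ℝ V :=
    { carrier := {v | P.coroot' j v = m}
      smul_vsub_vadd_mem' := fun t p q z hp hq hz => by
        simp only [Set.mem_ofPred_eq] at hp hq hz ⊢
        rw [vsub_eq_sub, vadd_eq_add, map_add, map_smul, map_sub, hp, hq, hz]
        simp }
  suffices h : affineSpan ℝ (hyperplane P i n ∩ closure C.1) ≤ Q by
    have hv' : v ∈ (affineSpan ℝ (hyperplane P i n ∩ closure C.1) : Set V) := by
      rw [hspan]; exact hv
    exact h hv'
  refine affineSpan_le.2 ?_
  rintro x ⟨hxi, hxC⟩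
  -- The point `x` is fixed by `s`, so it lies weakly on both sides of `H_{j,m}`.
  have hcont : ∀ k, Continuous (P.coroot' k) := continuous_coroot'
  have hne : P.coroot' j c - m ≠ 0 := sub_ne_zero.2 (mem_regularSet.1 (C.subset_regularSet hc) j m)
  have h1 : 0 ≤ (P.coroot' j c - m) * (P.coroot' j x - m) := by
    have hcl : IsClosed {x | 0 ≤ (P.coroot' j c - m) * (P.coroot' j x - m)} := by
      have := hcont j
      exact isClosed_le continuous_const (by fun_prop)
    refine closure_minimal (fun y hy => ?_) hcl hxC
    by_contra hlt
    exact lt_irrefl _ (((C.sameSide hy hc).separates (C.sameSide hy hc)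
      ((C.sameSide hc hy).separates (SameSide.refl y) (not_le.1 hlt))).trans_le (mul_self_nonneg _))
  have h2 : (P.coroot' j c - m) * (P.coroot' j (affReflection P i n x) - m) ≤ 0 := by
    have hcl : IsClosed {x | (P.coroot' j c - m) * (P.coroot' j (affReflection P i n x) - m) ≤ 0} := by
      have := hcont j
      have := hcont i
      simp only [affReflection_apply, map_sub, map_smul, smul_eq_mul]
      exact isClosed_le (by fun_prop) continuous_const
    refine closure_minimal (fun y hy => ?_) hcl hxC
    exact ((SameSide.refl c).separates ((C.sameSide hc hy).map (PermutesRoots.affReflection i n))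
      hsep).le
  have hfix : affReflection P i n x = x := by
    rw [affReflection_apply, show P.coroot' i x = n from hxi]; simp
  rw [hfix] at h2
  exact sub_eq_zero.1 ((mul_eq_zero.1 (le_antisymm h2 h1)).resolve_left hne)

/-- Right translation by a simple affine reflection is given by a map: the alcove `A s` is the image
of the fundamental alcove under `w s`, where `w` is the unique element with `w(A_e) = A`. -/
theorem IsSimpleAffineReflection.exists_isRightTranslation {s : V ≃ᵃ[ℝ] V}
    (hs : IsSimpleAffineReflection b s) : ∃ r, IsRightTranslation b s r := by
  obtain ⟨C, hC, hwall⟩ := hs.isWallReflection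
  obtain ⟨c, hc⟩ := C.nonempty
  obtain ⟨i₀, n₀, hs₀⟩ := (hwall c hc).1
  have hsmem : s ∈ affineWeyl b := hs₀ ▸ affReflection_mem_affineWeyl b i₀ n₀
  have hss : s * s = 1 := hs₀ ▸ affReflection_mul_self i₀ n₀
  choose u hu huC using fun A : Alcove b => exists_isImage_of_alcoves C A
  choose r hr using fun A => exists_isImage (mul_mem (hu A) hsmem) C
  have hiff : ∀ A B, IsRightTranslate b s A B ↔ B = r A := by
    intro A B
    constructor
    · rintro ⟨w, hw, C', hC', h1, h2⟩
      obtain rfl := hC.unique hC'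
      rw [h1.eq_of_mem_affineWeyl hw (hu A) (huC A)] at h2
      exact h2.unique (hr A)
    · rintro rfl
      exact ⟨u A, hu A, C, hC, huC A, hr A⟩
  refine ⟨r, hiff, fun A => ?_, fun g hg A B h => ?_, fun A i n hA => ?_⟩
  · refine ((hiff _ _).1 ⟨u A * s, mul_mem (hu A) hsmem, C, hC, hr A, ?_⟩).symm
    rw [mul_assoc, hss, mul_one]
    exact huC A
  · obtain ⟨B', hB'⟩ := exists_isImage hg (r A)
    have : B' = r B := (hiff _ _).1 ⟨g * u A, mul_mem hg (hu A), C, hC, h.mul (huC A), by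
      rw [mul_assoc]; exact hB'.mul (hr A)⟩
    rwa [← this]
  · by_cases hcase : P.coroot' i ((u A * s) c) < n
    · left
      intro v hv
      exact (((r A).sameSide ((hr A).apply_mem hc) hv) i n).1 hcase
    · right
      have hreg := mem_regularSet.1 ((r A).subset_regularSet ((hr A).apply_mem hc)) i n
      have hgt := lt_of_le_of_ne (not_lt.1 hcase) hreg.symm
      have hsep : Separates P i n (u A c) (u A (s c)) :=
        mul_neg_of_neg_of_pos (sub_neg.2 (hA ((huC A).apply_mem hc))) (sub_pos.2 hgt)
      obtain ⟨σ, hσ⟩ := exists_permutesRoots (hu A)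
      obtain ⟨j, m, h1, h2⟩ := hσ.exists_separates hsep
      rw [(hwall c hc).2 j m h1] at h2
      have h3 := (hr A).mul (huC A).inv
      rwa [h2, mul_inv_cancel_right] at h3

/-- There are only finitely many orbits of alcoves under translations by the root lattice: an
alcove `w(A_e)` is determined up to such a translation by the permutation of the roots that the
linear part of `w` induces. -/
lemma finite_orbit : Finite (Orbit b) := by
  by_cases hne : Nonempty (Alcove b)
  · obtain ⟨C⟩ := hne
    choose u hu huC using fun A : Alcove b => exists_isImage_of_alcoves C A
    choose σ hσ using fun A => exists_permutesRoots (hu A)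
    refine Finite.of_injective (fun x : Orbit b => σ (Quotient.out x)) fun x y hxy => ?_
    rw [← Quotient.out_eq x, ← Quotient.out_eq y]
    set A := Quotient.out x
    set B := Quotient.out y
    refine Quotient.sound ?_
    have hAB : (u A).linear = (u B).linear := by
      refine LinearEquiv.toLinearMap_injective ?_
      refine LinearMap.ext_on_range (v := P.root) RootPairing.IsRootSystem.span_root_eq_top fun i => ?_
      exact ((hσ A).root i).trans ((congrArg (fun τ : Equiv.Perm ι => P.root (τ i)) hxy).trans
        ((hσ B).root i).symm)
    refine ⟨u B 0 - u A 0, sub_mem (hσ B).zero (hσ A).zero, ?_⟩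
    have : translation (u B 0 - u A 0) * u A = u B := by
      ext v
      rw [AffineEquiv.coe_mul, Function.comp_apply, translation_apply,
        AffineEquiv.apply_eq_linear_add (u A) v, AffineEquiv.apply_eq_linear_add (u B) v, hAB]
      abel
    have h := (huC B).mul (huC A).inv
    rwa [← this, mul_inv_cancel_right] at h
  · have : IsEmpty (Orbit b) := ⟨fun x => hne ⟨Quotient.out x⟩⟩
    infer_instance

end RightTranslation

/-! ### Coordinates with respect to the simple roots -/

section Cone

variable {ι V N : Type u} [AddCommGroup V] [Module ℝ V] [AddCommGroup N] [Module ℝ N]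
  {P : RootPairing ι ℝ V N} {b : P.Base}

lemma posCone_le_rootLattice {γ : V} (hγ : γ ∈ posCone b) : γ ∈ rootLattice P := by
  induction hγ using AddSubmonoid.closure_induction with
  | mem x hx =>
    obtain ⟨j, hj, rfl⟩ := hx
    exact root_mem_rootLattice j
  | zero => exact zero_mem _
  | add x y _ _ hx hy => exact add_mem hx hy

variable [P.IsRootSystem]

lemma coord_closure_support_nat {v : V} (hv : v ∈ AddSubmonoid.closure (P.root '' b.support))
    (l : b.support) : ∃ n : ℕ, b.toWeightBasis.coord l v = n := by
  classical
  induction hv using AddSubmonoid.closure_induction with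
  | mem x hx =>
    obtain ⟨j, hj, rfl⟩ := hx
    rw [Module.Basis.coord_apply, show P.root j = P.root (⟨j, hj⟩ : b.support) from rfl,
      RootPairing.Base.toWeightBasis_repr_root, Finsupp.single_apply]
    split_ifs
    · exact ⟨1, by simp⟩
    · exact ⟨0, by simp⟩
  | zero => exact ⟨0, by simp⟩
  | add x y _ _ hx hy =>
    obtain ⟨m, hm⟩ := hx
    obtain ⟨n, hn⟩ := hy
    exact ⟨m + n, by rw [map_add, hm, hn]; push_cast; rfl⟩

lemma coord_root_nonneg {i : ι} (hi : i ∈ PosRoot b) (l : b.support) :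
    0 ≤ b.toWeightBasis.coord l (P.root i) := by
  obtain ⟨n, hn⟩ := coord_closure_support_nat (b := b) hi l
  rw [hn]
  exact n.cast_nonneg

lemma coord_posCone_nonneg {γ : V} (hγ : γ ∈ posCone b) (l : b.support) :
    0 ≤ b.toWeightBasis.coord l γ := by
  induction hγ using AddSubmonoid.closure_induction with
  | mem x hx =>
    obtain ⟨j, hj, rfl⟩ := hx
    exact coord_root_nonneg hj l
  | zero => simp
  | add x y _ _ hx hy => rw [map_add]; exact add_nonneg hx hy

lemma coord_rootLattice_int {γ : V} (hγ : γ ∈ rootLattice P) (l : b.support) :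
    ∃ m : ℤ, b.toWeightBasis.coord l γ = m := by
  induction hγ using AddSubgroup.closure_induction with
  | mem x hx =>
    obtain ⟨j, rfl⟩ := hx
    rcases b.root_mem_or_neg_mem j with h | h
    · obtain ⟨m, hm⟩ := coord_closure_support_nat h l
      exact ⟨m, hm⟩
    · obtain ⟨m, hm⟩ := coord_closure_support_nat h l
      exact ⟨-m, by rw [map_neg] at hm; push_cast; linarith⟩
  | zero => exact ⟨0, by simp⟩
  | add x y _ _ hx hy =>
    obtain ⟨m, hm⟩ := hx
    obtain ⟨n, hn⟩ := hy
    exact ⟨m + n, by rw [map_add, hm, hn]; push_cast; rfl⟩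
  | neg x _ hx =>
    obtain ⟨m, hm⟩ := hx
    exact ⟨-m, by rw [map_neg, hm]; push_cast; rfl⟩

/-- The elements of the root lattice with nonnegative coordinates with respect to the simple roots
are the elements of `ℤ_{≥0} R⁺`. -/
lemma mem_posCone_of_coord_nonneg {γ : V} (hγ : γ ∈ rootLattice P)
    (h : ∀ l : b.support, 0 ≤ b.toWeightBasis.coord l γ) : γ ∈ posCone b := by
  choose m hm using fun l => coord_rootLattice_int (b := b) hγ l
  rw [← b.toWeightBasis.sum_repr γ]
  refine sum_mem fun l _ => ?_
  have h1 : b.toWeightBasis.repr γ l = m l := hm l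
  have h2 : 0 ≤ m l := by exact_mod_cast (hm l) ▸ h l
  obtain ⟨n, hn⟩ := Int.eq_ofNat_of_zero_le h2
  rw [h1, hn, RootPairing.Base.toWeightBasis_apply]
  have : ((n : ℤ) : ℝ) • P.root l = n • P.root l := by
    rw [Int.cast_natCast, Nat.cast_smul_eq_nsmul]
  rw [this]
  have hl : P.root l ∈ AddSubmonoid.closure (P.root '' b.support) :=
    AddSubmonoid.subset_closure (Set.mem_image_of_mem _ l.2)
  exact nsmul_mem (AddSubmonoid.subset_closure (Set.mem_image_of_mem P.root hl)) n

variable [TopologicalSpace V] [IsTopologicalAddGroup V] [ContinuousSMul ℝ V] [T2Space V]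
  [Finite ι]

/-- Linear forms are bounded on alcoves. -/
lemma Alcove.exists_bound (A : Alcove b) (f : V →ₗ[ℝ] ℝ) :
    ∃ K : ℝ, ∀ u ∈ A.1, ∀ v ∈ A.1, |f u - f v| ≤ K := by
  obtain ⟨n, rfl⟩ := P.flip.toPerfPair.surjective f
  have hn : n ∈ Submodule.span ℝ (Set.range P.coroot) := by
    rw [RootPairing.IsRootSystem.span_coroot_eq_top]; trivial
  induction hn using Submodule.span_induction with
  | mem x hx =>
    obtain ⟨i, rfl⟩ := hx
    refine ⟨1, fun u hu v hv => ?_⟩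
    have key : ∀ u ∈ A.1, ∀ v ∈ A.1, P.coroot' i u - P.coroot' i v ≤ 1 := fun u hu v hv => by
      have h1 := (A.sameSide hv hu i (⌊P.coroot' i v⌋ + 1)).1
        (by push_cast; exact Int.lt_floor_add_one _)
      push_cast at h1
      linarith [Int.floor_le (P.coroot' i v)]
    have h1 := key v hv u hu
    have h2 := key u hu v hv
    exact abs_le.2 ⟨by change -1 ≤ P.coroot' i u - P.coroot' i v; linarith, h2⟩
  | zero => exact ⟨0, by simp⟩
  | add x y _ _ hx hy =>
    obtain ⟨K, hK⟩ := hx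
    obtain ⟨L, hL⟩ := hy
    refine ⟨K + L, fun u hu v hv => ?_⟩
    have := abs_add_le (P.flip.toPerfPair x u - P.flip.toPerfPair x v)
      (P.flip.toPerfPair y u - P.flip.toPerfPair y v)
    have h1 := hK u hu v hv
    have h2 := hL u hu v hv
    rw [map_add, LinearMap.add_apply, LinearMap.add_apply, add_sub_add_comm]
    linarith
  | smul t x _ hx =>
    obtain ⟨K, hK⟩ := hx
    refine ⟨|t| * K, fun u hu v hv => ?_⟩
    rw [map_smul, LinearMap.smul_apply, LinearMap.smul_apply, ← smul_sub, smul_eq_mul, abs_mul]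
    exact mul_le_mul_of_nonneg_left (hK u hu v hv) (abs_nonneg t)

end Cone

/-! ### The order on alcoves -/

section Order

variable {ι V N : Type u} [AddCommGroup V] [Module ℝ V] [AddCommGroup N] [Module ℝ N]
  {P : RootPairing ι ℝ V N} {b : P.Base} [TopologicalSpace V]

lemma orbit_eq_iff {A B : Alcove b} :
    orbit A = orbit B ↔ ∃ γ ∈ rootLattice P, IsImage (translation γ) A B := Quotient.eq

variable [P.IsCrystallographic]
  {k : Type u} [Field k] {T : Type u} [CommRing T] [Algebra (SymRing k P) T]

/-- Going up in the order moves points of an alcove by nonnegative combinations of simple roots. -/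
lemma LeT.exists_coord_le [P.IsRootSystem] {A B : Alcove b} (h : LeT k b T A B) {p : V}
    (hp : p ∈ A.1) :
    ∃ q ∈ B.1, ∀ l : b.support, b.toWeightBasis.coord l p ≤ b.toWeightBasis.coord l q := by
  induction h with
  | refl => exact ⟨p, hp, fun _ => le_rfl⟩
  | tail _ hstep ih =>
    obtain ⟨q, hq, hpq⟩ := ih
    rcases hstep with ⟨γ, hγ, him⟩ | ⟨i, hi, n, hneg, him⟩
    · refine ⟨_, him.apply_mem hq, fun l => (hpq l).trans ?_⟩
      rw [translation_apply, map_add]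
      linarith [coord_posCone_nonneg hγ l]
    · refine ⟨_, him.apply_mem hq, fun l => (hpq l).trans ?_⟩
      rw [affReflection_apply, map_sub, map_smul, smul_eq_mul]
      have h1 : P.coroot' i q < n := hneg hq
      have h2 := coord_root_nonneg hi.1 l
      nlinarith

lemma leT_of_posCone {A B : Alcove b} {γ : V} (hγ : γ ∈ posCone b)
    (h : IsImage (translation γ) A B) : LeT k b T A B :=
  Relation.ReflTransGen.single (Or.inl ⟨γ, hγ, h⟩)

lemma step_map {g : V ≃ᵃ[ℝ] V} (hg : ∃ γ ∈ rootLattice P, g = translation γ) {A B A' B' : Alcove b}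
    (h : Step k b T A B) (hA : IsImage g A A') (hB : IsImage g B B') : Step k b T A' B' := by
  obtain ⟨γ, hγ, rfl⟩ := hg
  rcases h with ⟨δ, hδ, him⟩ | ⟨i, hi, n, hneg, him⟩
  · refine Or.inl ⟨δ, hδ, ?_⟩
    have := (hB.mul him).mul hA.inv
    rwa [← translation_add, add_comm, translation_add, mul_inv_cancel_right] at this
  · obtain ⟨m, hm, hm'⟩ := (PermutesRoots.translation hγ).exists_coroot' i
    simp only [Equiv.Perm.coe_one, id_eq] at hm hm'
    refine Or.inr ⟨i, hi, n + m, ?_, ?_⟩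
    · rw [hA]
      rintro _ ⟨v, hv, rfl⟩
      show P.coroot' i _ < _
      rw [hm]
      have : P.coroot' i v < n := hneg hv
      push_cast
      linarith
    · have := (hB.mul him).mul hA.inv
      rwa [hm', mul_inv_cancel_right] at this

variable [IsTopologicalAddGroup V] [ContinuousSMul ℝ V] [T2Space V] [Finite ι] [P.IsRootSystem]

/-- The order is invariant under translations by the root lattice. -/
lemma LeT.translate {A B A' B' : Alcove b} (h : LeT k b T A B) {γ : V} (hγ : γ ∈ rootLattice P)
    (hA : IsImage (translation γ) A A') (hB : IsImage (translation γ) B B') : LeT k b T A' B' := by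
  induction h generalizing B' with
  | refl => rw [hA.unique hB]; exact Relation.ReflTransGen.refl
  | @tail B₁ B₂ _ hstep ih =>
    obtain ⟨B₁', hB₁'⟩ := exists_isImage (translation_mem_affineWeyl b hγ) B₁
    exact (ih hB₁').tail (step_map ⟨γ, hγ, rfl⟩ hstep hB₁' hB)

/-- If a translate of an alcove by the root lattice lies below it, then the translation is by a
nonpositive element, since otherwise some coordinate would be unbounded on the alcove. -/
lemma neg_mem_posCone_of_leT {A B : Alcove b} {γ : V} (hγ : γ ∈ rootLattice P)
    (him : IsImage (translation γ) A B) (h : LeT k b T B A) : -γ ∈ posCone b := by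
  refine mem_posCone_of_coord_nonneg (neg_mem hγ) fun l => ?_
  rw [map_neg, neg_nonneg]
  by_contra! hpos
  obtain ⟨K, hK⟩ := A.exists_bound (b.toWeightBasis.coord l)
  obtain ⟨p, hp⟩ := A.nonempty
  have key : ∀ n : ℕ, ∃ q ∈ A.1, b.toWeightBasis.coord l p + n * b.toWeightBasis.coord l γ ≤
      b.toWeightBasis.coord l q := fun n => by
    induction n with
    | zero => exact ⟨p, hp, by simp⟩
    | succ n ih =>
      obtain ⟨q, hq, hpq⟩ := ih
      obtain ⟨q', hq', hqq'⟩ := h.exists_coord_le (him.apply_mem hq)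
      refine ⟨q', hq', le_trans ?_ (hqq' l)⟩
      rw [translation_apply, map_add]
      push_cast
      linarith
  obtain ⟨n, hn⟩ := exists_nat_gt (K / b.toWeightBasis.coord l γ)
  rw [div_lt_iff₀ hpos] at hn
  obtain ⟨q, hq, hpq⟩ := key n
  have := (abs_le.1 (hK q hq p hp)).2
  linarith

/-- The alcoves of a given orbit that lie above a given alcove are all obtained from finitely many
of them by translations by `ℤ_{≥0} R⁺`. This is an instance of Dickson's lemma. -/
lemma exists_finite_dominating (A : Alcove b) (x : Orbit b) : ∃ F : Set (Alcove b), F.Finite ∧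
    ∀ B, orbit B = x → LeT k b T A B →
      ∃ C ∈ F, orbit C = x ∧ LeT k b T A C ∧ ∃ γ ∈ posCone b, IsImage (translation γ) C B := by
  obtain ⟨B₀, rfl⟩ : ∃ B₀ : Alcove b, orbit B₀ = x := Quotient.exists_rep x
  obtain ⟨p, hp⟩ := A.nonempty
  obtain ⟨q₀, hq₀⟩ := B₀.nonempty
  choose K hK using fun l => B₀.exists_bound (b.toWeightBasis.coord l)
  set d : b.support → ℝ := fun l => K l + b.toWeightBasis.coord l q₀ - b.toWeightBasis.coord l p
    with hd
  -- Alcoves above `A` in the orbit have coordinates bounded below, so we may shift them to `ℕ`.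
  set Γ : Set (Alcove b) := {B | orbit B = orbit B₀ ∧ LeT k b T A B} with hΓ
  have hcoord : ∀ B : Γ, ∃ γ ∈ rootLattice P, ∃ m : b.support → ℕ, IsImage (translation γ) B₀ B.1 ∧
      ∀ l, b.toWeightBasis.coord l γ = m l - ⌈d l⌉ := by
    rintro ⟨B, hB, hAB⟩
    obtain ⟨γ, hγ, him⟩ := orbit_eq_iff.1 hB.symm
    choose m hm using fun l => coord_rootLattice_int (b := b) hγ l
    have hnonneg : ∀ l, 0 ≤ m l + ⌈d l⌉ := fun l => by
      obtain ⟨q, hq, hpq⟩ := hAB.exists_coord_le hp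
      have hq' : q ∈ translation γ '' B₀.1 := him ▸ hq
      obtain ⟨q', hq', rfl⟩ := hq'
      have h1 := hpq l
      rw [translation_apply, map_add, hm] at h1
      have h2 := (abs_le.1 (hK l q' hq' q₀ hq₀)).2
      have h3 := Int.le_ceil (d l)
      have h4 : (0 : ℝ) ≤ m l + ⌈d l⌉ := by simp only [hd] at h3 ⊢; linarith
      exact_mod_cast h4
    choose n hn using fun l => Int.eq_ofNat_of_zero_le (hnonneg l)
    refine ⟨γ, hγ, n, him, fun l => ?_⟩
    rw [hm, eq_sub_iff_add_eq]
    exact_mod_cast hn l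
  choose g hg m him hm using hcoord
  have hpwo : (Set.range m).IsPWO := Set.isPWO_of_wellQuasiOrderedLE _
  have hfin : {y | Minimal (· ∈ Set.range m) y}.Finite :=
    (setOfPred_minimal_antichain _).finite_of_partiallyWellOrderedOn
      (hpwo.mono fun _ h => h.prop)
  have := hfin.to_subtype
  choose c hc using fun y : {y | Minimal (· ∈ Set.range m) y} => y.2.prop
  refine ⟨Set.range fun y => (c y).1, Set.finite_range _, fun B hB hAB => ?_⟩
  obtain ⟨y, hy, hmin⟩ := hpwo.exists_le_minimal (Set.mem_range_self ⟨B, hB, hAB⟩)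
  have hcy := hc ⟨y, hmin⟩
  refine ⟨_, ⟨⟨y, hmin⟩, rfl⟩, (c ⟨y, hmin⟩).2.1, (c ⟨y, hmin⟩).2.2,
    g ⟨B, hB, hAB⟩ - g (c ⟨y, hmin⟩), ?_, ?_⟩
  · refine mem_posCone_of_coord_nonneg (sub_mem (hg _) (hg _)) fun l => ?_
    rw [map_sub, hm, hm, hcy]
    have : (y l : ℝ) ≤ m ⟨B, hB, hAB⟩ l := by exact_mod_cast hy l
    linarith
  · have := (him ⟨B, hB, hAB⟩).mul (him (c ⟨y, hmin⟩)).inv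
    rwa [← translation_neg, ← translation_add, ← sub_eq_add_neg] at this

end Order

/-! ### Open sets and right translation -/

/-- A coroot that is invertible in `T` is invertible in `T'`. Hence the relations of
the order attached to `T'` also hold for the one attached to `T`, see `LeT.of_algebra`. -/
lemma nonUnitRoots_subset {ι V N : Type u} [AddCommGroup V] [Module ℝ V] [AddCommGroup N]
    [Module ℝ N] {P : RootPairing ι ℝ V N} {b : P.Base} [P.IsCrystallographic] {k : Type u} [Field k]
    {T : Type u} [CommRing T] [Algebra (SymRing k P) T] {T' : Type u} [CommRing T']
    [Algebra (SymRing k P) T'] [Algebra T T'] [IsScalarTower (SymRing k P) T T'] :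
    nonUnitRoots k b T' ⊆ nonUnitRoots k b T := by
  rintro i ⟨hi, h⟩
  refine ⟨hi, fun hu => h ?_⟩
  have := hu.map (algebraMap T T')
  rwa [corootIn, ← IsScalarTower.algebraMap_apply] at this

section Sharp

variable {ι V N : Type u} [AddCommGroup V] [Module ℝ V] [AddCommGroup N] [Module ℝ N]
  {P : RootPairing ι ℝ V N} {b : P.Base} [TopologicalSpace V] {s : V ≃ᵃ[ℝ] V}
  {r : Alcove b → Alcove b}

lemma IsRightTranslation.sharp_eq (hr : IsRightTranslation b s r) (J : Set (Alcove b)) :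
    sharp b s J = J ∪ r '' J := by
  ext B
  simp only [sharp, Set.mem_union, Set.mem_ofPred_eq, Set.mem_image, hr.isRightTranslate_iff]
  exact or_congr_right (exists_congr fun A => and_congr_right fun _ => eq_comm)

lemma IsRightTranslation.apply_mem_sharp (hr : IsRightTranslation b s r) {J : Set (Alcove b)}
    {A : Alcove b} (hA : A ∈ sharp b s J) : r A ∈ sharp b s J := by
  rw [hr.sharp_eq] at hA ⊢
  rcases hA with hA | ⟨B, hB, rfl⟩
  · exact Or.inr ⟨A, hA, rfl⟩
  · rw [hr.involutive]; exact Or.inl hB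

lemma subset_sharp (J : Set (Alcove b)) : J ⊆ sharp b s J := Set.subset_union_left

lemma sharp_mono {J J' : Set (Alcove b)} (h : J ⊆ J') : sharp b s J ⊆ sharp b s J' :=
  Set.union_subset_union h fun _ ⟨A, hA, hB⟩ => ⟨A, h hA, hB⟩

/-- The smallest set containing `J` that is stable under right translation is `J^♯`. -/
lemma IsRightTranslation.sharp_subset (hr : IsRightTranslation b s r) {J K : Set (Alcove b)}
    (h : J ⊆ K) (hK : ∀ A ∈ K, r A ∈ K) : sharp b s J ⊆ K := by
  rw [hr.sharp_eq]
  exact Set.union_subset h (Set.image_subset_iff.2 fun A hA => hK A (h hA))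

lemma IsRightTranslation.orbit_congr (hr : IsRightTranslation b s r) {A B : Alcove b}
    (h : orbit A = orbit B) : orbit (r A) = orbit (r B) := by
  obtain ⟨γ, hγ, him⟩ := orbit_eq_iff.1 h
  exact orbit_eq_iff.2 ⟨γ, hγ, hr.map _ (translation_mem_affineWeyl b hγ) _ _ him⟩

variable [P.IsCrystallographic] {k : Type u} [Field k] {T : Type u} [CommRing T]
  [Algebra (SymRing k P) T]

lemma LeT.refl (A : Alcove b) : LeT k b T A A := Relation.ReflTransGen.refl

lemma LeT.trans {A B C : Alcove b} (h : LeT k b T A B) (h' : LeT k b T B C) : LeT k b T A C :=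
  Relation.ReflTransGen.trans h h'

lemma subset_openHull (X : Set (Alcove b)) : X ⊆ (openHull k b T X).1 :=
  fun A hA => ⟨A, hA, LeT.refl A⟩

lemma openHull_eq_of_isTOpen {J : Set (Alcove b)} (hJ : IsTOpen k b T J) :
    (openHull k b T J).1 = J :=
  Set.Subset.antisymm (openHull_le ⟨J, hJ⟩ subset_rfl) (subset_openHull J)

/-- Right translation is compatible with the generating relations of the order, except that it may
exchange the two alcoves. -/
lemma IsRightTranslation.step (hr : IsRightTranslation b s r) {A B : Alcove b}
    (h : Step k b T A B) : LeT k b T (r A) (r B) ∨ r A = B := by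
  rcases h with ⟨γ, hγ, him⟩ | ⟨i, hi, n, hneg, him⟩
  · exact Or.inl (leT_of_posCone hγ
      (hr.map _ (translation_mem_affineWeyl b (posCone_le_rootLattice hγ)) _ _ him))
  · rcases hr.separated A i n hneg with h | h
    · exact Or.inl (Relation.ReflTransGen.single (Or.inr ⟨i, hi, n, h,
        hr.map _ (affReflection_mem_affineWeyl b i n) _ _ him⟩))
    · exact Or.inr (h.unique him)

/-- The open hull of a set that is stable under right translation is stable as well. -/
lemma IsRightTranslation.apply_mem_openHull (hr : IsRightTranslation b s r) {X : Set (Alcove b)}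
    (hX : ∀ A ∈ X, r A ∈ X) {A : Alcove b} (hA : A ∈ (openHull k b T X).1) :
    r A ∈ (openHull k b T X).1 := by
  obtain ⟨B, hB, hAB⟩ := hA
  induction hAB using Relation.ReflTransGen.head_induction_on with
  | refl => exact subset_openHull X (hX B hB)
  | head hstep htail ih =>
    rcases hr.step hstep with h | h
    · exact (openHull k b T X).2 _ ih _ h
    · rw [h]; exact ⟨B, hB, htail⟩

/-- If `J` is open, so is `J^♯`: a generating relation `B ⪯ A s` of the order gives
`B s ⪯ A` on right translation, unless `B = A`. -/
lemma IsRightTranslation.isTOpen_sharp (hr : IsRightTranslation b s r) {J : Set (Alcove b)}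
    (hJ : IsTOpen k b T J) : IsTOpen k b T (sharp b s J) := by
  intro A hA B hBA
  induction hBA using Relation.ReflTransGen.head_induction_on with
  | refl => exact hA
  | @head B C hstep _ hC =>
    rw [hr.sharp_eq] at hC ⊢
    rcases hC with hC | ⟨D, hD, rfl⟩
    · exact Or.inl (hJ C hC B (Relation.ReflTransGen.single hstep))
    · rcases hr.step hstep with h | h
      · rw [hr.involutive] at h
        exact Or.inr ⟨r B, hJ D hD _ h, hr.involutive B⟩
      · have : B = D := by rw [← hr.involutive B, h, hr.involutive]
        exact Or.inl (this ▸ hD)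

/-- Taking the smallest open superset commutes with `J ↦ J^♯`. -/
lemma IsRightTranslation.openHull_sharp (hr : IsRightTranslation b s r) (X : Set (Alcove b)) :
    (openHull k b T (sharp b s X)).1 = sharp b s (openHull k b T X).1 := by
  apply Set.Subset.antisymm
  · exact openHull_le ⟨_, hr.isTOpen_sharp (openHull k b T X).2⟩ (sharp_mono (subset_openHull X))
  · exact hr.sharp_subset (openHull_mono (subset_sharp X))
      fun A hA => hr.apply_mem_openHull (fun B hB => hr.apply_mem_sharp hB) hA

section BaseChange

variable {T' : Type u} [CommRing T'] [Algebra (SymRing k P) T'] [Algebra T T']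
  [IsScalarTower (SymRing k P) T T']

lemma LeT.of_algebra {A B : Alcove b} (h : LeT k b T' A B) : LeT k b T A B := by
  induction h with
  | refl => exact LeT.refl A
  | tail _ hstep ih =>
    refine ih.tail (Or.imp_right ?_ hstep)
    rintro ⟨i, ⟨hi, m, hm⟩, h⟩
    refine ⟨i, ⟨hi, m, Subgroup.closure_mono (Set.union_subset_union_right _ ?_) hm⟩, h⟩
    rintro g ⟨j, hj, h⟩
    exact ⟨j, nonUnitRoots_subset hj, h⟩

variable (k T T') in
lemma openHull_openHull (X : Set (Alcove b)) :
    openHull k b T (openHull k b T' X).1 = openHull k b T X := by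
  refine le_antisymm (openHull_le _ ?_) (openHull_mono (subset_openHull X))
  rintro A ⟨B, hB, hAB⟩
  exact ⟨B, hB, hAB.of_algebra⟩

end BaseChange

variable [IsTopologicalAddGroup V] [ContinuousSMul ℝ V] [T2Space V] [Finite ι] [P.IsRootSystem]

/-- If `A` and `B` lie in the same orbit and `A` lies below `B s`, then `A` lies below `B`. Indeed,
writing `A = t_γ B`, one finds `t_{2γ} B ⪯ t_γ B s ⪯ B` or `t_γ B s ⪯ B s`, so `γ ≤ 0`. -/
lemma IsRightTranslation.leT_of_leT_apply (hr : IsRightTranslation b s r) {A B : Alcove b}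
    (hAB : orbit A = orbit B) (h : LeT k b T A (r B)) : LeT k b T A B := by
  obtain ⟨γ, hγ, him⟩ := orbit_eq_iff.1 hAB.symm
  have him' := hr.map _ (translation_mem_affineWeyl b hγ) _ _ him
  suffices hneg : -γ ∈ posCone b by
    refine leT_of_posCone hneg ?_
    rw [translation_neg]
    exact him.inv
  have hstable : ∀ C ∈ ({B, r B} : Set (Alcove b)), r C ∈ ({B, r B} : Set (Alcove b)) := by
    rintro C (rfl | rfl)
    · exact Or.inr rfl
    · exact Or.inl (hr.involutive B)
  have hmem : A ∈ (openHull k b T {B, r B}).1 := ⟨r B, Or.inr rfl, h⟩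
  obtain ⟨C, rfl | rfl, hC⟩ := hr.apply_mem_openHull hstable hmem
  · -- Here `t_γ C s ⪯ C` and `t_γ C ⪯ C s`, and the latter can be translated by `γ`.
    obtain ⟨D, hD⟩ := exists_isImage (translation_mem_affineWeyl b hγ) A
    have hDC : LeT k b T D C := (h.translate hγ hD him').trans hC
    have him₂ : IsImage (translation (γ + γ)) C D := by
      rw [translation_add]; exact hD.mul him
    have h2 := neg_mem_posCone_of_leT (add_mem hγ hγ) him₂ hDC
    refine mem_posCone_of_coord_nonneg (neg_mem hγ) fun l => ?_
    have := coord_posCone_nonneg h2 l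
    rw [map_neg, map_add] at this
    rw [map_neg]
    linarith
  · exact neg_mem_posCone_of_leT hγ him' hC

/-- The companion of `IsRightTranslation.leT_of_leT_apply` for alcoves in the orbit of `B s`. -/
lemma IsRightTranslation.leT_apply_of_leT (hr : IsRightTranslation b s r) {A B : Alcove b}
    (hAB : orbit A = orbit (r B)) (h : LeT k b T A B) : LeT k b T A (r B) :=
  hr.leT_of_leT_apply hAB (by rwa [hr.involutive])

section BaseChange

variable {T' : Type u} [CommRing T'] [Algebra (SymRing k P) T'] [Algebra T T']
  [IsScalarTower (SymRing k P) T T']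

/-- Let `X` lie in a single orbit `x`. For the orbits `y = x` and `y = x s`, taking the part of
`X^♯` in `y` commutes with passing from `T'`-open to `T`-open sets. -/
lemma IsRightTranslation.orbitPart_openHull_sharp (hr : IsRightTranslation b s r)
    {X : Set (Alcove b)} {A₀ : Alcove b} (hX : ∀ A ∈ X, orbit A = orbit A₀) {y : Orbit b}
    (hy : y = orbit A₀ ∨ y = orbit (r A₀)) :
    orbitPart (openHull k b T (openHull k b T' (sharp b s (openHull k b T' X).1)).1) y ≤
      openHull k b T (orbitPart (openHull k b T' (sharp b s (openHull k b T' X).1)) y).1 := by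
  refine openHull_le _ ?_
  rintro B ⟨hB, hBy⟩
  rw [openHull_openHull] at hB
  have hB' : B ∈ (openHull k b T (sharp b s X)).1 := by
    have h1 := openHull_mono (k := k) (T := T) (sharp_mono (s := s)
      (fun A (hA : A ∈ (openHull k b T' X).1) =>
        show A ∈ (openHull k b T X).1 from let ⟨C, hC, hAC⟩ := hA; ⟨C, hC, hAC.of_algebra⟩)) hB
    rw [openHull_eq_of_isTOpen (hr.isTOpen_sharp (openHull k b T X).2)] at h1
    rwa [hr.openHull_sharp]
  obtain ⟨C, hC, hBC⟩ : ∃ C ∈ X, LeT k b T B C ∨ LeT k b T B (r C) := by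
    obtain ⟨C, hC, hBC⟩ := hB'
    rw [hr.sharp_eq] at hC
    rcases hC with hC | ⟨D, hD, rfl⟩
    · exact ⟨C, hC, Or.inl hBC⟩
    · exact ⟨D, hD, Or.inr hBC⟩
  have hCX : C ∈ sharp b s (openHull k b T' X).1 := subset_sharp _ (subset_openHull X hC)
  have hCo := hX C hC
  have hBy' : orbit B = y := hBy
  rcases hy with rfl | rfl
  · have hle : LeT k b T B C := hBC.elim id (hr.leT_of_leT_apply (hBy'.trans hCo.symm))
    exact ⟨C, subset_openHull _ ⟨subset_openHull _ hCX, hCo⟩, hle⟩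
  · have hle : LeT k b T B (r C) :=
      hBC.elim (hr.leT_apply_of_leT (hBy'.trans (hr.orbit_congr hCo).symm)) id
    exact ⟨r C, subset_openHull _ ⟨subset_openHull _ (hr.apply_mem_sharp hCX),
      hr.orbit_congr hCo⟩, hle⟩

end BaseChange

variable [P.IsReduced]

variable (k T) in
/-- A finite set of alcoves is dominated, in each orbit, by another finite set. -/
lemma exists_finite_dominating_set {X : Set (Alcove b)} (hX : X.Finite) :
    ∃ X' : Set (Alcove b), X'.Finite ∧ ∀ A ∈ X, ∀ B, LeT k b T A B →
      ∃ C ∈ X', orbit C = orbit B ∧ LeT k b T A C ∧ ∃ γ ∈ posCone b, IsImage (translation γ) C B := by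
  have := finite_orbit (b := b)
  choose F hF hdom using fun (A : Alcove b) (x : Orbit b) => exists_finite_dominating (k := k) (T := T) A x
  refine ⟨⋃ A ∈ X, ⋃ x, F A x, hX.biUnion fun A _ => Set.finite_iUnion fun x => hF A x,
    fun A hA B hAB => ?_⟩
  obtain ⟨C, hC, h⟩ := hdom A _ B rfl hAB
  exact ⟨C, Set.mem_biUnion hA (Set.mem_iUnion.2 ⟨_, hC⟩), h⟩

end Sharp

/-! ### Idempotents of the structure algebra up to coroots -/

section StructureAlgebraElements

open Classical in
/-- The product of all positive coroots. -/
def corootProd {ι V N : Type u} [AddCommGroup V] [Module ℝ V] [AddCommGroup N] [Module ℝ N]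
    {P : RootPairing ι ℝ V N} [P.IsCrystallographic] (k : Type u) [Field k] (b : P.Base)
    [Finite ι] : SymRing k P :=
  ∏ i ∈ (Set.toFinite (PosRoot b)).toFinset, corootIn k P (SymRing k P) i

variable {ι V N : Type u} [AddCommGroup V] [Module ℝ V] [AddCommGroup N] [Module ℝ N]
  [TopologicalSpace V] {P : RootPairing ι ℝ V N} [P.IsCrystallographic]
  (k : Type u) [Field k] {b : P.Base} (T : Type u) [CommRing T] [Algebra (SymRing k P) T]

variable (b) in
lemma corootZ_mem_corootMonoid {i : ι} (hi : i ∈ PosRoot b) :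
    corootZ k b T i ∈ corootMonoid k b T := Submonoid.subset_closure ⟨i, hi, rfl⟩

/-- The elements that are killed by `e` up to a product of positive coroots. -/
def rootTorsion (e : ZT k b T) (M : Type u) [AddCommGroup M] [Module (ZT k b T) M] :
    Submodule (ZT k b T) M where
  carrier := {m | ∃ d ∈ corootMonoid k b T, d • e • m = 0}
  zero_mem' := ⟨1, one_mem _, by simp⟩
  add_mem' := by
    rintro m n ⟨d, hd, hm⟩ ⟨c, hc, hn⟩
    refine ⟨d * c, mul_mem hd hc, ?_⟩
    rw [smul_add, smul_add, mul_smul, mul_smul, hn, smul_zero, add_zero, smul_comm d c, hm, smul_zero]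
  smul_mem' := by
    rintro z m ⟨d, hd, hm⟩
    refine ⟨d, hd, ?_⟩
    rw [smul_comm e, smul_comm d, hm, smul_zero]

variable {M : Type u} [AddCommGroup M] [Module (ZT k b T) M]

variable {k T} in
lemma smul_mem_rootTorsion {e d : ZT k b T} (hd : d ∈ corootMonoid k b T) {m : M} :
    d • m ∈ rootTorsion k T e M ↔ m ∈ rootTorsion k T e M := by
  constructor
  · rintro ⟨c, hc, h⟩
    refine ⟨c * d, mul_mem hc hd, ?_⟩
    rw [mul_smul, smul_comm d, h]
  · exact fun h => Submodule.smul_mem _ _ h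

lemma mem_rootTorsion_of_map {M' : Type u} [AddCommGroup M'] [Module (ZT k b T) M'] {e : ZT k b T}
    {f : M →ₗ[ZT k b T] M'} (hf : Function.Injective f) {m : M}
    (hm : f m ∈ rootTorsion k T e M') : m ∈ rootTorsion k T e M := by
  obtain ⟨d, hd, h⟩ := hm
  exact ⟨d, hd, hf (by rw [map_smul, map_smul, h, map_zero])⟩

lemma stalkMap_surjective {M' : Type u} [AddCommGroup M'] [Module (ZT k b T) M'] (x : Orbit b)
    {f : M →ₗ[ZT k b T] M'} (hf : Function.Surjective f) :
    Function.Surjective (stalkMap k T x f) := by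
  intro q
  obtain ⟨m, rfl⟩ := Submodule.Quotient.mk_surjective (stalkKer k T x M') q
  obtain ⟨n, rfl⟩ := hf m
  exact ⟨Submodule.Quotient.mk n, rfl⟩

variable [Finite ι]

open Classical in
/-- The element of `𝒵_T` whose coordinates are the product of all positive coroots on a set `X` of
orbits and zero elsewhere: up to a product of coroots, the idempotent that belongs to `X`. -/
def orbitElem (X : Set (Orbit b)) : ZT k b T :=
  1 ⊗ₜ ⟨fun x => if x ∈ X then corootProd k b else 0, fun i hi A B _ => by
    have h : corootIn k P (SymRing k P) i ∣ corootProd k b :=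
      Finset.dvd_prod_of_mem _ ((Set.toFinite (PosRoot b)).mem_toFinset.2 hi)
    refine dvd_sub ?_ ?_ <;> dsimp only <;> split_ifs <;> simp [h]⟩

variable (b) in
/-- The image in `𝒵_T` of the product of all positive coroots. -/
def corootProdZ : ZT k b T := algebraMap T _ (algebraMap (SymRing k P) T (corootProd k b))

open Classical in
lemma coord_orbitElem (X : Set (Orbit b)) (y : Orbit b) :
    coord k T y (orbitElem k T X) =
      if y ∈ X then algebraMap (SymRing k P) T (corootProd k b) else 0 := by
  rw [orbitElem, coord_tmul, one_mul]
  simp only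
  split_ifs <;> simp

/-- On `orbitElem {x}` the algebra `𝒵_T` acts through the coordinate at `x`. -/
lemma mul_orbitElem_singleton (x : Orbit b) (z : ZT k b T) :
    z * orbitElem k T {x} = algebraMap T _ (coord k T x z) * orbitElem k T {x} := by
  induction z using TensorProduct.induction_on with
  | zero => simp
  | add y z hy hz => rw [add_mul, hy, hz, map_add, map_add, add_mul]
  | tmul t z =>
    rw [coord_tmul, orbitElem, Algebra.TensorProduct.algebraMap_apply,
      Algebra.TensorProduct.tmul_mul_tmul, Algebra.TensorProduct.tmul_mul_tmul, one_mul,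
      Algebra.algebraMap_self, RingHom.id_apply, mul_one, mul_one, mul_comm t, ← Algebra.smul_def,
      TensorProduct.smul_tmul]
    congr 1
    ext y
    by_cases h : y = x
    · subst h
      simp
    · simp [h]

lemma orbitElem_mul_self (x : Orbit b) :
    orbitElem k T {x} * orbitElem k T {x} = corootProdZ k b T * orbitElem k T {x} := by
  rw [mul_orbitElem_singleton, coord_orbitElem]
  simp [corootProdZ]

lemma orbitElem_mul_of_mem {x : Orbit b} {X : Set (Orbit b)} (h : x ∈ X) :
    orbitElem k T X * orbitElem k T {x} = corootProdZ k b T * orbitElem k T {x} := by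
  rw [mul_orbitElem_singleton, coord_orbitElem]
  simp [corootProdZ, h]

lemma orbitElem_mul_of_ne {x y : Orbit b} (h : x ≠ y) :
    orbitElem k T {x} * orbitElem k T {y} = 0 := by
  rw [mul_orbitElem_singleton, coord_orbitElem]
  simp [h.symm]

variable (b) in
lemma corootProdZ_mem_corootMonoid : corootProdZ k b T ∈ corootMonoid k b T := by
  rw [corootProdZ, corootProd, map_prod, map_prod]
  refine prod_mem fun i hi => ?_
  have := corootZ_mem_corootMonoid k b T ((Set.toFinite (PosRoot b)).mem_toFinset.1 hi)
  exact this

lemma orbitElem_pair (x y : Orbit b) (h : x ≠ y) :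
    orbitElem k T {x, y} = orbitElem k T {x} + orbitElem k T {y} := by
  rw [orbitElem, orbitElem, orbitElem, ← TensorProduct.tmul_add]
  congr 1
  ext z
  by_cases h1 : z = x
  · subst h1; simp [h]
  · by_cases h2 : z = y
    · subst h2; simp [h1]
    · simp [h1, h2]

/-- The kernel of `M → M^x` consists of the elements that `orbitElem {x}` kills up to root
torsion. -/
lemma stalkKer_eq_rootTorsion (x : Orbit b) :
    stalkKer k T x M = rootTorsion k T (orbitElem k T {x}) M := by
  ext m
  constructor
  · rintro ⟨d, hd, hm⟩
    refine ⟨d, hd, ?_⟩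
    rw [smul_comm]
    refine Submodule.smul_induction_on hm (fun a ha n _ => ?_) fun n n' hn hn' => ?_
    · rw [smul_smul, mul_comm, mul_orbitElem_singleton, (RingHom.mem_ker).1 ha, map_zero, zero_mul]
      exact zero_smul (ZT k b T) n
    · rw [smul_add, hn, hn', add_zero]
  · rintro ⟨d, hd, hm⟩
    refine ⟨d * corootProdZ k b T, mul_mem hd (corootProdZ_mem_corootMonoid k b T), ?_⟩
    have h1 : (d * corootProdZ k b T) • m =
        (corootProdZ k b T - orbitElem k T {x}) • d • m := by
      rw [sub_smul, smul_comm _ d m, smul_comm (orbitElem k T {x}), hm, sub_zero, mul_smul]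
    rw [h1]
    refine Submodule.smul_mem_smul ?_ trivial
    rw [RingHom.mem_ker, map_sub, coord_orbitElem, corootProdZ, AlgHom.commutes]
    simp

variable {k T} in
lemma orbitElem_smul_mem_rootTorsion {x : Orbit b} {m : M} :
    orbitElem k T {x} • m ∈ rootTorsion k T (orbitElem k T {x}) M ↔
      m ∈ rootTorsion k T (orbitElem k T {x}) M := by
  refine ⟨fun ⟨d, hd, h⟩ => ⟨d * corootProdZ k b T,
    mul_mem hd (corootProdZ_mem_corootMonoid k b T), ?_⟩, fun h => Submodule.smul_mem _ _ h⟩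
  rw [mul_smul, ← h, ← mul_smul (orbitElem k T {x}) (orbitElem k T {x}) m, orbitElem_mul_self,
    mul_smul]

variable {k T} in
lemma orbitElem_smul_mem_rootTorsion_of_ne {x y : Orbit b} (h : y ≠ x) (m : M) :
    orbitElem k T {x} • m ∈ rootTorsion k T (orbitElem k T {y}) M := by
  refine ⟨1, one_mem _, ?_⟩
  rw [smul_smul _ _ m, orbitElem_mul_of_ne k T h]
  exact (congrArg _ (zero_smul (ZT k b T) m)).trans (smul_zero _)

lemma stalkMap_injective {M' : Type u} [AddCommGroup M'] [Module (ZT k b T) M'] {x : Orbit b}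
    {f : M →ₗ[ZT k b T] M'} (h : ∀ m, f m ∈ rootTorsion k T (orbitElem k T {x}) M' →
      m ∈ rootTorsion k T (orbitElem k T {x}) M) : Function.Injective (stalkMap k T x f) := by
  rw [← LinearMap.ker_eq_bot, eq_bot_iff]
  rintro q hq
  obtain ⟨m, rfl⟩ := Submodule.Quotient.mk_surjective (stalkKer k T x M) q
  have h1 : f m ∈ stalkKer k T x M' := (Submodule.Quotient.mk_eq_zero _).1 hq
  refine (Submodule.Quotient.mk_eq_zero _).2 ?_
  rw [stalkKer_eq_rootTorsion] at h1 ⊢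
  exact h m h1

lemma mem_rootTorsion_of_stalkMap_injective {M' : Type u} [AddCommGroup M']
    [Module (ZT k b T) M'] {x : Orbit b} {f : M →ₗ[ZT k b T] M'}
    (hf : Function.Injective (stalkMap k T x f)) {m : M}
    (h : f m ∈ rootTorsion k T (orbitElem k T {x}) M') :
    m ∈ rootTorsion k T (orbitElem k T {x}) M := by
  rw [← stalkKer_eq_rootTorsion] at h ⊢
  refine (Submodule.Quotient.mk_eq_zero _).1 (hf ?_)
  rw [map_zero]
  exact (Submodule.Quotient.mk_eq_zero _).2 h

end StructureAlgebraElements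

section BaseChangeElements

variable {ι V N : Type u} [AddCommGroup V] [Module ℝ V] [AddCommGroup N] [Module ℝ N]
  [TopologicalSpace V] {P : RootPairing ι ℝ V N} [P.IsCrystallographic]
  (k : Type u) [Field k] {b : P.Base} (T : Type u) [CommRing T] [Algebra (SymRing k P) T]
  (T' : Type u) [CommRing T'] [Algebra (SymRing k P) T'] [Algebra T T']
  [IsScalarTower (SymRing k P) T T']

lemma changeZ_tmul (t : T) (z : structureAlgebra k b) :
    changeZ k b T T' (t ⊗ₜ z) = algebraMap T T' t ⊗ₜ z := rfl

lemma changeZ_algebraMap (t : T) :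
    changeZ k b T T' (algebraMap T _ t) = algebraMap T' _ (algebraMap T T' t) := rfl

lemma changeZ_orbitElem [Finite ι] (X : Set (Orbit b)) :
    changeZ k b T T' (orbitElem k T X) = orbitElem k T' X := by
  rw [orbitElem, changeZ_tmul, map_one]; rfl

lemma changeZ_mem_corootMonoid {d : ZT k b T} (hd : d ∈ corootMonoid k b T) :
    changeZ k b T T' d ∈ corootMonoid k b T' := by
  induction hd using Submonoid.closure_induction with
  | mem x hx =>
    obtain ⟨i, hi, rfl⟩ := hx
    refine Submonoid.subset_closure ⟨i, hi, ?_⟩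
    rw [corootZ, corootZ, changeZ_algebraMap, corootIn, corootIn,
      ← IsScalarTower.algebraMap_apply (SymRing k P) T T']
  | one => rw [map_one]; exact one_mem _
  | mul x y _ _ hx hy => rw [map_mul]; exact mul_mem hx hy

lemma coord_changeZ (x : Orbit b) (z : ZT k b T) :
    coord k T' x (changeZ k b T T' z) = algebraMap T T' (coord k T x z) := by
  induction z using TensorProduct.induction_on with
  | zero => rw [RingHom.map_zero, map_zero, map_zero, map_zero]
  | add y z hy hz => rw [RingHom.map_add, map_add, hy, hz, map_add, map_add]
  | tmul t z =>
    rw [changeZ_tmul, coord_tmul, coord_tmul, map_mul,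
      ← IsScalarTower.algebraMap_apply (SymRing k P) T T']

end BaseChangeElements

/-! ### The presheaf `M⁺` -/

section PresheafLemmas

variable {ι V N : Type u} [AddCommGroup V] [Module ℝ V] [AddCommGroup N] [Module ℝ N]
  [TopologicalSpace V] {P : RootPairing ι ℝ V N} [P.IsCrystallographic]
  {k : Type u} [Field k] {b : P.Base} {T : Type u} [CommRing T] [Algebra (SymRing k P) T]

lemma res_self (M : PSh k b T) {J : TOpen k b T} (h : J ≤ J) (m : M.obj (op J)) :
    res M h m = m := by
  have : (homOfLE h).op = 𝟙 (op J) := rfl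
  rw [res, this, M.map_id]
  rfl

/-- Restriction between equal open sets is bijective. -/
lemma res_bijective_of_le (M : PSh k b T) {J J' : TOpen k b T} (h : J' ≤ J) (h' : J ≤ J') :
    Function.Bijective (res M h) := by
  refine Function.bijective_iff_has_inverse.2 ⟨res M h', fun m => ?_, fun m => ?_⟩ <;>
  rw [res_res, res_self]

/-- If `M` is supported on `X`, sections over `K` do not change on passing to an open subset that
contains `K ∩ X`. -/
lemma SupportedOn.res_bijective {M : PSh k b T} {X : Set (Alcove b)} (hM : SupportedOn M X)
    {L K : TOpen k b T} (h : L ≤ K) (hX : K.1 ∩ X ⊆ L.1) : Function.Bijective (res M h) := by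
  have h1 : openHull k b T (L.1 ∩ X) ≤ L := openHull_le L Set.inter_subset_left
  have h2 : openHull k b T (K.1 ∩ X) ≤ openHull k b T (L.1 ∩ X) :=
    openHull_mono fun A hA => ⟨hX hA, hA.2⟩
  have key : Function.Bijective (res M h1 ∘ res M h) := by
    have : res M h1 ∘ res M h = res M (openHull_mono (Set.inter_subset_inter_left X h)) ∘
        res M (openHull_le K Set.inter_subset_left) := by
      funext m
      simp only [Function.comp_apply, res_res]
    rw [this]
    exact (res_bijective_of_le M _ h2).comp (hM K)
  exact (Function.Bijective.of_comp_iff' (hM L) (res M h)).1 key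

lemma orbitPart_orbitPart (J : TOpen k b T) (x : Orbit b) :
    orbitPart J x ≤ orbitPart (orbitPart J x) x :=
  openHull_mono fun _ hA => ⟨subset_openHull _ hA, hA.2⟩

/-- The projection of sections of `M` onto those of `M⁺`. -/
def plusMk (M : PSh k b T) (J : TOpen k b T) :
    M.obj (op J) →ₗ[ZT k b T] (plusObj M).obj (op J) := (gammaKer M J).mkQ

lemma plusMk_surjective (M : PSh k b T) (J : TOpen k b T) : Function.Surjective (plusMk M J) :=
  Submodule.mkQ_surjective _

lemma plusMk_eq_zero {M : PSh k b T} {J : TOpen k b T} {m : M.obj (op J)} :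
    plusMk M J m = 0 ↔ m ∈ gammaKer M J := Submodule.Quotient.mk_eq_zero _

lemma res_plusMk (M : PSh k b T) {J' J : TOpen k b T} (h : J' ≤ J) (m : M.obj (op J)) :
    res (plusObj M) h (plusMk M J m) = plusMk M J' (res M h m) := rfl

lemma flabby_plusObj {M : PSh k b T} (hM : Flabby M) : Flabby (plusObj M) := by
  intro J' J h q
  obtain ⟨m, rfl⟩ := plusMk_surjective M J' q
  obtain ⟨n, rfl⟩ := hM J' J h m
  exact ⟨plusMk M J n, res_plusMk M h n⟩

variable [Finite ι]

lemma mem_gammaKer' {M : PSh k b T} {J : TOpen k b T} {m : M.obj (op J)} :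
    m ∈ gammaKer M J ↔ ∀ x : Orbit b, res M (orbitPart_le J x) m ∈
      rootTorsion k T (orbitElem k T {x}) (M.obj (op (orbitPart J x))) := by
  rw [mem_gammaKer]
  exact forall_congr' fun x => by rw [stalkKer_eq_rootTorsion]

lemma smul_mem_gammaKer {M : PSh k b T} {J : TOpen k b T} {m : M.obj (op J)} {d : ZT k b T}
    (hd : d ∈ corootMonoid k b T) : d • m ∈ gammaKer M J ↔ m ∈ gammaKer M J := by
  rw [mem_gammaKer', mem_gammaKer']
  exact forall_congr' fun x => by rw [map_smul, smul_mem_rootTorsion hd]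

/-- Only the stalk at `x` matters for membership of `e_x m` in the kernel of `γ`. -/
lemma orbitElem_smul_mem_gammaKer {M : PSh k b T} {J : TOpen k b T} {m : M.obj (op J)}
    {x : Orbit b} : orbitElem k T {x} • m ∈ gammaKer M J ↔ res M (orbitPart_le J x) m ∈
      rootTorsion k T (orbitElem k T {x}) (M.obj (op (orbitPart J x))) := by
  rw [mem_gammaKer', ← orbitElem_smul_mem_rootTorsion, ← map_smul]
  refine ⟨fun h => h x, fun h y => ?_⟩
  by_cases hxy : y = x
  · subst hxy; exact h
  · rw [map_smul]
    exact orbitElem_smul_mem_rootTorsion_of_ne hxy _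

lemma rootTorsionFree_plusObj (M : PSh k b T) (J : TOpen k b T) :
    RootTorsionFree k b T ((plusObj M).obj (op J)) := by
  intro i hi m m' hmm
  rw [← sub_eq_zero]
  have hsub : corootZ k b T i • (m - m') = 0 := by
    rw [smul_sub, sub_eq_zero]; exact hmm
  obtain ⟨n, hn⟩ := plusMk_surjective M J (m - m')
  rw [← hn] at hsub ⊢
  rw [← map_smul, plusMk_eq_zero] at hsub
  rw [plusMk_eq_zero]
  exact (smul_mem_gammaKer (corootZ_mem_corootMonoid k b T hi)).1 hsub

lemma mem_rootTorsion_plusMk {M : PSh k b T} {J : TOpen k b T} {e : ZT k b T} {m : M.obj (op J)} :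
    plusMk M J m ∈ rootTorsion k T e ((plusObj M).obj (op J)) ↔ e • m ∈ gammaKer M J := by
  constructor
  · rintro ⟨d, hd, h⟩
    rw [← map_smul, ← map_smul, plusMk_eq_zero, smul_mem_gammaKer hd] at h
    exact h
  · intro h
    refine ⟨1, one_mem _, ?_⟩
    rw [← map_smul, plusMk_eq_zero.2 h, smul_zero]

lemma supportCondition_plusObj {M : PSh k b T} (hM : Flabby M) :
    SupportCondition (plusObj M) := by
  intro J x
  constructor
  · refine stalkMap_injective k T fun q h1 => ?_
    obtain ⟨m, rfl⟩ := plusMk_surjective M J q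
    rw [res_plusMk, mem_rootTorsion_plusMk, orbitElem_smul_mem_gammaKer] at h1
    rw [mem_rootTorsion_plusMk, orbitElem_smul_mem_gammaKer]
    exact mem_rootTorsion_of_map k T
      (res_bijective_of_le M (orbitPart_le _ x) (orbitPart_orbitPart J x)).injective h1
  · exact stalkMap_surjective k T x (flabby_plusObj hM _ _ (orbitPart_le J x))

variable [IsTopologicalAddGroup V] [ContinuousSMul ℝ V] [T2Space V] [P.IsRootSystem] [P.IsReduced]

/-- A flabby presheaf with finite support yields an object of `𝐏_T` on passing to `M⁺`. The support
has to be enlarged so that it dominates, in every orbit, the alcoves above the given support. -/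
theorem isP_plusObj {M : PSh k b T} (hM : Flabby M) (hfin : Finitary M) :
    IsP k b T (plusObj M) := by
  obtain ⟨hzero, X, hX, hsupp⟩ := hfin
  obtain ⟨X', hX', hdom⟩ := exists_finite_dominating_set k T hX
  refine ⟨flabby_plusObj hM, ⟨?_, X', hX', fun J => ⟨?_, flabby_plusObj hM _ _ _⟩⟩, rootTorsionFree_plusObj M,
    supportCondition_plusObj hM⟩
  · exact (plusMk_surjective M _).subsingleton
  · rw [injective_iff_map_eq_zero]
    intro q hq
    obtain ⟨m, rfl⟩ := plusMk_surjective M J q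
    rw [res_plusMk, plusMk_eq_zero, mem_gammaKer'] at hq
    rw [plusMk_eq_zero, mem_gammaKer']
    intro x
    have hle : orbitPart (openHull k b T (J.1 ∩ X')) x ≤ orbitPart J x :=
      orbitPart_mono (openHull_le J Set.inter_subset_left) x
    have hinj := (hsupp.res_bijective hle (by
      rintro A ⟨⟨B, ⟨hBJ, hBx⟩, hAB⟩, hA⟩
      obtain ⟨C, hC, hCB, hAC, γ, hγ, him⟩ := hdom A hA B hAB
      have hCJ : C ∈ J.1 := J.2 B hBJ C (leT_of_posCone hγ him)
      exact ⟨C, ⟨subset_openHull _ ⟨hCJ, hC⟩, hCB.trans hBx⟩, hAC⟩)).injective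
    refine mem_rootTorsion_of_map k T hinj ?_
    have := hq x
    rw [res_res] at this ⊢
    exact this

end PresheafLemmas

/-! ### Extension of scalars -/

section ExtensionOfScalars

open ModuleCat ChangeOfRings

variable {R S : Type u} [CommRing R] [CommRing S] (f : R →+* S)

/-- The canonical element `s ⊗ m` of an extension of scalars. -/
def extTmul {M : ModuleCat.{u} R} (s : S) (m : M) : (extendScalars f).obj M := s ⊗ₜ[R,f] m

variable {f}

lemma extendScalars_induction {M : ModuleCat.{u} R} {p : (extendScalars f).obj M → Prop}
    (zero : p 0) (tmul : ∀ s m, p (extTmul f s m)) (add : ∀ x y, p x → p y → p (x + y))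
    (x : (extendScalars f).obj M) : p x := by
  let := f.toAlgebra
  exact TensorProduct.induction_on (motive := p) x zero tmul (fun x y => add x y)

lemma smul_extTmul {M : ModuleCat.{u} R} (s t : S) (m : M) :
    s • extTmul f t m = extTmul f (s * t) m := rfl

lemma extTmul_smul {M : ModuleCat.{u} R} (s : S) (r : R) (m : M) :
    extTmul f s (r • m) = extTmul f (s * f r) m := by
  let := f.toAlgebra
  have := (TensorProduct.smul_tmul (R := R) r (s : S) m)
  rw [Algebra.smul_def, mul_comm] at this
  exact this.symm

lemma extTmul_zero {M : ModuleCat.{u} R} (s : S) : extTmul f s (0 : M) = 0 := by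
  let := f.toAlgebra
  exact TensorProduct.tmul_zero _ _

lemma extTmul_add {M : ModuleCat.{u} R} (s : S) (m n : M) :
    extTmul f s (m + n) = extTmul f s m + extTmul f s n := by
  let := f.toAlgebra
  exact TensorProduct.tmul_add _ _ _

lemma extendScalars_map_surjective {M N : ModuleCat.{u} R} {g : M ⟶ N}
    (hg : Function.Surjective g.hom) : Function.Surjective ((extendScalars f).map g).hom := by
  intro y
  induction y using extendScalars_induction with
  | zero => exact ⟨0, map_zero _⟩
  | tmul s n =>
    obtain ⟨m, rfl⟩ := hg n
    exact ⟨extTmul f s m, rfl⟩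
  | add x y hx hy =>
    obtain ⟨a, rfl⟩ := hx
    obtain ⟨c, rfl⟩ := hy
    exact ⟨a + c, map_add _ _ _⟩

lemma bijective_of_isIso {A : Type u} [CommRing A] {M N : ModuleCat.{u} A} (g : M ⟶ N) [IsIso g] :
    Function.Bijective g.hom :=
  ConcreteCategory.bijective_of_isIso g

lemma isIso_of_bijective {A : Type u} [CommRing A] {M N : ModuleCat.{u} A} {g : M ⟶ N}
    (hg : Function.Bijective g.hom) : IsIso g :=
  (ConcreteCategory.isIso_iff_bijective g).2 hg

lemma extendScalars_map_bijective {M N : ModuleCat.{u} R} {g : M ⟶ N}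
    (hg : Function.Bijective g.hom) : Function.Bijective ((extendScalars f).map g).hom := by
  have := isIso_of_bijective hg
  exact bijective_of_isIso _

lemma extendScalars_subsingleton {M : ModuleCat.{u} R} (h : Subsingleton M) :
    Subsingleton ((extendScalars f).obj M) := by
  refine ⟨fun x y => ?_⟩
  have key : ∀ x : (extendScalars f).obj M, x = 0 := fun x => by
    induction x using extendScalars_induction with
    | zero => rfl
    | tmul s n => rw [Subsingleton.elim n 0, extTmul_zero]
    | add x y hx hy => rw [hx, hy, add_zero]
  rw [key x, key y]

/-- If `g` is surjective, the kernel of the extension of `g` is generated by the `1 ⊗ m` with `m` in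
the kernel of `g`. -/
lemma mem_of_extendScalars_map_eq_zero {M N : ModuleCat.{u} R} {g : M ⟶ N}
    (hg : Function.Surjective g.hom) {p : AddSubgroup ((extendScalars f).obj M)}
    (hp : ∀ s m, g.hom m = 0 → extTmul f s m ∈ p) {x : (extendScalars f).obj M}
    (hx : ((extendScalars f).map g).hom x = 0) : x ∈ p := by
  let := f.toAlgebra
  have hex : Function.Exact (LinearMap.ker g.hom).subtype g.hom :=
    LinearMap.exact_subtype_ker_map _
  obtain ⟨y, rfl⟩ := (lTensor_exact S hex hg x).1 hx
  clear hx
  refine TensorProduct.induction_on (motive := fun y =>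
    LinearMap.lTensor S (LinearMap.ker g.hom).subtype y ∈ p) y ?_ (fun s m => hp s m m.2)
    fun y z hy hz => ?_
  · rw [map_zero]
    exact p.zero_mem
  · rw [map_add]
    exact p.add_mem hy hz

/-- Suppose that every `m` in the kernel of a surjective map `g` is killed by some `w` with
`e w = c e` in `S`, where `c` lies in a multiplicative set `Q`. Then the elements in the kernel of the
extension of `g` are killed by `e`, up to multiplication by elements of `Q`. -/
lemma exists_smul_eq_zero_of_extendScalars_map_eq_zero {M N : ModuleCat.{u} R} {g : M ⟶ N}
    (hg : Function.Surjective g.hom) (Q : Submonoid S) (e : S)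
    (h : ∀ m, g.hom m = 0 → ∃ w : R, ∃ c ∈ Q, w • m = 0 ∧ e * f w = c * e)
    {x : (extendScalars f).obj M} (hx : ((extendScalars f).map g).hom x = 0) :
    ∃ d ∈ Q, d • e • x = 0 := by
  refine mem_of_extendScalars_map_eq_zero
    (p := { carrier := {x | ∃ d ∈ Q, d • e • x = 0}
            zero_mem' := ⟨1, one_mem _, by rw [smul_zero, smul_zero]⟩
            add_mem' := ?_
            neg_mem' := ?_ }) hg (fun s m hm => ?_) hx
  · rintro x y ⟨d, hd, hx⟩ ⟨c, hc, hy⟩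
    refine ⟨d * c, mul_mem hd hc, ?_⟩
    rw [smul_add, smul_add, mul_smul, mul_smul, hy, smul_zero, add_zero, smul_comm d c, hx,
      smul_zero]
  · rintro x ⟨d, hd, hx⟩
    exact ⟨d, hd, by rw [smul_neg, smul_neg, hx, neg_zero]⟩
  · obtain ⟨w, c, hc, hwm, hew⟩ := h m hm
    refine ⟨c, hc, ?_⟩
    rw [smul_extTmul, smul_extTmul, ← mul_assoc, ← hew, mul_right_comm, ← extTmul_smul, hwm,
      extTmul_zero]

variable (f) in
/-- Restriction followed by extension of scalars. -/
def indRes : ModuleCat.{u} S ⥤ ModuleCat.{u} S := restrictScalars f ⋙ extendScalars f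

lemma indRes_map_surjective {M N : ModuleCat.{u} S} {g : M ⟶ N}
    (hg : Function.Surjective g.hom) : Function.Surjective ((indRes f).map g).hom :=
  extendScalars_map_surjective hg

lemma indRes_map_bijective {M N : ModuleCat.{u} S} {g : M ⟶ N}
    (hg : Function.Bijective g.hom) : Function.Bijective ((indRes f).map g).hom :=
  extendScalars_map_bijective hg

lemma indRes_subsingleton {M : ModuleCat.{u} S} (h : Subsingleton M) :
    Subsingleton ((indRes f).obj M) :=
  extendScalars_subsingleton (M := (restrictScalars f).obj M) h

/-- `exists_smul_eq_zero_of_extendScalars_map_eq_zero` for restriction followed by extension. -/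
lemma exists_smul_eq_zero_of_indRes_map_eq_zero {M N : ModuleCat.{u} S} {g : M ⟶ N}
    (hg : Function.Surjective g.hom) (Q : Submonoid S) (e : S)
    (h : ∀ m, g.hom m = 0 → ∃ w : R, ∃ c ∈ Q, f w • m = 0 ∧ e * f w = c * e)
    {x : (indRes f).obj M} (hx : ((indRes f).map g).hom x = 0) : ∃ d ∈ Q, d • e • x = 0 :=
  exists_smul_eq_zero_of_extendScalars_map_eq_zero (g := (restrictScalars f).map g) hg Q e h hx

end ExtensionOfScalars

/-! ### Wall crossing and base change before `(·)⁺` -/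

section Epsilon

open ModuleCat

variable {ι V N : Type u} [AddCommGroup V] [Module ℝ V] [AddCommGroup N] [Module ℝ N]
  [TopologicalSpace V] {P : RootPairing ι ℝ V N} [P.IsCrystallographic]
  {k : Type u} [Field k] {b : P.Base} {T : Type u} [CommRing T] [Algebra (SymRing k P) T]
  {s : V ≃ᵃ[ℝ] V} {r : Alcove b → Alcove b}

variable (k T s) in
/-- The open set `(J^♯)_{⪯_T}`. -/
def sharpHull (X : Set (Alcove b)) : TOpen k b T := openHull k b T (sharp b s X)

lemma sharpHull_mono {X Y : Set (Alcove b)} (h : X ⊆ Y) : sharpHull k T s X ≤ sharpHull k T s Y :=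
  openHull_mono (sharp_mono h)

variable (k b T s) in
/-- The inclusion of the invariants `𝒵_T^s` into `𝒵_T`. -/
def invariantsIncl : invariants k b T s →+* ZT k b T := (invariants k b T s).val.toRingHom

variable (k b T s) in
/-- The functor `𝒵_T ⊗_{𝒵_T^s} ·`. -/
def twist : ModuleCat.{u} (ZT k b T) ⥤ ModuleCat.{u} (ZT k b T) :=
  indRes (R := invariants k b T s) (S := ZT k b T) (invariantsIncl k b T s)

lemma exists_smul_eq_zero_of_twist_map_eq_zero {M N : ModuleCat.{u} (ZT k b T)} {g : M ⟶ N}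
    (hg : Function.Surjective g.hom) (Q : Submonoid (ZT k b T)) (e : ZT k b T)
    (h : ∀ m, g.hom m = 0 → ∃ w ∈ invariants k b T s, ∃ c ∈ Q, w • m = 0 ∧ e * w = c * e)
    {x : (twist k b T s).obj M} (hx : ((twist k b T s).map g).hom x = 0) :
    ∃ d ∈ Q, d • e • x = 0 := by
  refine exists_smul_eq_zero_of_indRes_map_eq_zero (R := invariants k b T s) (S := ZT k b T)
    hg Q e (fun m hm => ?_) hx
  obtain ⟨w, hw, c, hc, h1, h2⟩ := h m hm
  refine ⟨⟨w, hw⟩, c, hc, ?_, ?_⟩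
  · exact h1
  · exact h2

lemma res_epsilon (M : PSh k b T) {J' J : TOpen k b T} (h : J' ≤ J) :
    res ((epsilon k b T s).obj M) h =
      ((twist k b T s).map (M.map (homOfLE (sharpHull_mono (s := s) h)).op)).hom := rfl

lemma flabby_epsilon {M : PSh k b T} (hM : Flabby M) (s : V ≃ᵃ[ℝ] V) :
    Flabby ((epsilon k b T s).obj M) := by
  intro J' J h
  rw [res_epsilon]
  exact indRes_map_surjective (hM _ _ (sharpHull_mono h))

lemma finitary_epsilon (hr : IsRightTranslation b s r) {M : PSh k b T} (hM : Finitary M) :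
    Finitary ((epsilon k b T s).obj M) := by
  obtain ⟨hzero, X, hX, hsupp⟩ := hM
  refine ⟨?_, X ∪ r '' X, hX.union (hX.image r), fun J => ?_⟩
  · have h : sharpHull k T s (openHull k b T (∅ : Set (Alcove b))).1 ≤ openHull k b T ∅ := by
      refine openHull_le _ (hr.sharp_subset subset_rfl ?_)
      rintro A ⟨B, hB, -⟩
      exact hB.elim
    exact indRes_subsingleton
      (res_bijective_of_le M (openHull_mono (Set.empty_subset _)) h).injective.subsingleton
  · rw [res_epsilon]
    refine indRes_map_bijective (hsupp.res_bijective (sharpHull_mono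
      (openHull_le J Set.inter_subset_left)) ?_)
    rintro A ⟨hA, hAX⟩
    rw [sharpHull, openHull_eq_of_isTOpen (hr.isTOpen_sharp J.2), hr.sharp_eq] at hA
    refine subset_openHull _ ?_
    rw [hr.sharp_eq]
    rcases hA with hA | ⟨B, hB, rfl⟩
    · exact Or.inl (subset_openHull _ ⟨hA, Or.inl hAX⟩)
    · exact Or.inr ⟨B, subset_openHull _ ⟨hB, Or.inr ⟨r B, hAX, hr.involutive B⟩⟩, rfl⟩

end Epsilon

section BaseChange

open ModuleCat

variable {ι V N : Type u} [AddCommGroup V] [Module ℝ V] [AddCommGroup N] [Module ℝ N]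
  [TopologicalSpace V] {P : RootPairing ι ℝ V N} [P.IsCrystallographic]
  {k : Type u} [Field k] {b : P.Base} {T : Type u} [CommRing T] [Algebra (SymRing k P) T]
  {T' : Type u} [CommRing T'] [Algebra (SymRing k P) T'] [Algebra T T']
  [IsScalarTower (SymRing k P) T T']

variable (k b T T') in
/-- The base change functor before passing to `M⁺`. -/
def preBaseChange : PSh k b T ⥤ PSh k b T' :=
  (Functor.whiskeringRight _ _ _).obj (ModuleCat.extendScalars (changeZ k b T T')) ⋙
    (Functor.whiskeringLeft _ _ _).obj (hullFunctor k b T T').op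

lemma res_preBaseChange (M : PSh k b T) {J' J : TOpen k b T'} (h : J' ≤ J) :
    res ((preBaseChange k b T T').obj M) h =
      ((extendScalars (changeZ k b T T')).map
          (M.map (homOfLE (openHull_mono (k := k) (T := T) h)).op)).hom := rfl

lemma flabby_preBaseChange {M : PSh k b T} (hM : Flabby M) :
    Flabby ((preBaseChange k b T T').obj M) := by
  intro J' J h
  rw [res_preBaseChange]
  exact extendScalars_map_surjective (hM _ _ (openHull_mono h))

variable [Finite ι] [IsTopologicalAddGroup V] [ContinuousSMul ℝ V] [T2Space V] [P.IsRootSystem]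
  [P.IsReduced]

/-- If `M` is supported on a finite set `X`, its base change is supported on a finite set of alcoves
that dominates, in every orbit, the alcoves above `X`: the `T`-open hull of `J` meets `X` only in
alcoves below a dominating alcove that belongs to `J`. -/
lemma finitary_preBaseChange {M : PSh k b T} (hM : Finitary M) :
    Finitary ((preBaseChange k b T T').obj M) := by
  obtain ⟨hzero, X, hX, hsupp⟩ := hM
  obtain ⟨X', hX', hdom⟩ := exists_finite_dominating_set k T hX
  refine ⟨?_, X', hX', fun J => ?_⟩
  · exact extendScalars_subsingleton
      (res_bijective_of_le M (openHull_mono (Set.empty_subset _))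
        (openHull_openHull k T T' (∅ : Set (Alcove b))).le).injective.subsingleton
  · rw [res_preBaseChange]
    refine extendScalars_map_bijective (hsupp.res_bijective (openHull_mono
      (openHull_le J Set.inter_subset_left)) ?_)
    rintro A ⟨⟨B, hB, hAB⟩, hA⟩
    obtain ⟨C, hC, -, hAC, γ, hγ, him⟩ := hdom A hA B hAB
    exact ⟨C, subset_openHull _ ⟨J.2 B hB C (leT_of_posCone hγ him), hC⟩, hAC⟩

end BaseChange

/-! ### Insensitivity to `(·)⁺` -/

section PlusUnit

variable {ι V N : Type u} [AddCommGroup V] [Module ℝ V] [AddCommGroup N] [Module ℝ N]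
  [TopologicalSpace V] {P : RootPairing ι ℝ V N} [P.IsCrystallographic]
  {k : Type u} [Field k] {b : P.Base} {T : Type u} [CommRing T] [Algebra (SymRing k P) T]

variable (k b T) in
/-- The canonical projection `M → M⁺`. -/
def plusUnit : 𝟭 (PSh k b T) ⟶ plus k b T where
  app M :=
    { app := fun J => ModuleCat.ofHom (plusMk M J.unop)
      naturality := fun _ _ _ => rfl }
  naturality _ _ _ := rfl

variable [Finite ι]

/-- A surjective morphism induces an isomorphism of `M⁺` with `M'⁺` if, on the open sets generated by
alcoves in an orbit `x`, its kernel vanishes in the stalk at `x`. -/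
lemma isIso_plus_map {M M' : PSh k b T} {f : M ⟶ M'}
    (hsurj : ∀ J, Function.Surjective (f.app (op J)).hom)
    (hker : ∀ J x, ∀ z : M.obj (op (orbitPart J x)), (f.app (op (orbitPart J x))).hom z = 0 →
      z ∈ rootTorsion k T (orbitElem k T {x}) (M.obj (op (orbitPart J x)))) :
    IsIso ((plus k b T).map f) := by
  have happ : ∀ J : (TOpen k b T)ᵒᵖ, IsIso (((plus k b T).map f).app J) := fun J => by
    have hmk : ∀ m : M.obj J, (((plus k b T).map f).app J).hom (plusMk M J.unop m) =
        plusMk M' J.unop ((f.app J).hom m) := fun m => rfl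
    refine isIso_of_bijective ⟨?_, fun q => ?_⟩
    · rw [injective_iff_map_eq_zero]
      intro q hq
      obtain ⟨m, rfl⟩ := plusMk_surjective M J.unop q
      have hq' := mem_gammaKer'.1 (plusMk_eq_zero.1 ((hmk m).symm.trans hq))
      refine plusMk_eq_zero.2 (mem_gammaKer'.2 fun x => ?_)
      obtain ⟨d, hd, h⟩ := hq' x
      rw [res_naturality, ← map_smul, ← map_smul] at h
      have := hker _ _ _ h
      rwa [smul_mem_rootTorsion hd, orbitElem_smul_mem_rootTorsion] at this
    · obtain ⟨m', rfl⟩ := plusMk_surjective M' J.unop q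
      obtain ⟨m, rfl⟩ := hsurj J.unop m'
      exact ⟨plusMk M J.unop m, hmk m⟩
  exact NatIso.isIso_of_isIso_app _

end PlusUnit

section BaseChangePlus

open ModuleCat

variable {ι V N : Type u} [AddCommGroup V] [Module ℝ V] [AddCommGroup N] [Module ℝ N]
  [TopologicalSpace V] {P : RootPairing ι ℝ V N} [P.IsCrystallographic]
  {k : Type u} [Field k] {b : P.Base} {T : Type u} [CommRing T] [Algebra (SymRing k P) T]
  {T' : Type u} [CommRing T'] [Algebra (SymRing k P) T'] [Algebra T T']
  [IsScalarTower (SymRing k P) T T']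

variable (T') in
lemma orbitPart_openHull_orbitPart (J : TOpen k b T') (x : Orbit b) :
    openHull k b T (orbitPart J x).1 ≤ orbitPart (openHull k b T (orbitPart J x).1) x := by
  rw [orbitPart, openHull_openHull]
  exact openHull_mono fun A hA => ⟨subset_openHull _ hA, hA.2⟩

variable [Finite ι]

/-- Elements that vanish in the stalk at `X` keep doing so after base change. -/
lemma extTmul_mem_rootTorsion {M : ModuleCat.{u} (ZT k b T)} {X : Set (Orbit b)} {m : M}
    (hm : m ∈ rootTorsion k T (orbitElem k T X) M) (z : ZT k b T') :
    extTmul (changeZ k b T T') z m ∈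
      rootTorsion k T' (orbitElem k T' X) ((extendScalars (changeZ k b T T')).obj M) := by
  obtain ⟨d, hd, h⟩ := hm
  refine ⟨changeZ k b T T' d, changeZ_mem_corootMonoid k T T' hd, ?_⟩
  rw [smul_extTmul, smul_extTmul, ← changeZ_orbitElem k T T', mul_comm _ z, mul_comm _ (z * _),
    ← extTmul_smul, ← extTmul_smul, smul_comm, h, extTmul_zero]

/-- Base change followed by `(·)⁺` does not distinguish between `M` and `M⁺`. -/
lemma isIso_plus_preBaseChange_plusUnit (M : PSh k b T) :
    IsIso ((plus k b T').map ((preBaseChange k b T T').map ((plusUnit k b T).app M))) := by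
  refine isIso_plus_map (fun J => ?_) fun J x z hz => ?_
  · exact extendScalars_map_surjective (plusMk_surjective M _)
  · refine mem_of_extendScalars_map_eq_zero
      (g := ModuleCat.ofHom (plusMk M (openHull k b T (orbitPart J x).1)))
      (p := (rootTorsion k T' (orbitElem k T' {x}) _).toAddSubgroup)
      (plusMk_surjective M _) (fun s m hm => ?_) hz
    refine extTmul_mem_rootTorsion ?_ s
    have hm' : m ∈ gammaKer M (openHull k b T (orbitPart J x).1) := plusMk_eq_zero.1 hm
    exact mem_rootTorsion_of_map k T (res_bijective_of_le M (orbitPart_le _ x)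
      (orbitPart_openHull_orbitPart T' J x)).injective (mem_gammaKer'.1 hm' x)

end BaseChangePlus

section EpsilonPlus

open ModuleCat

variable {ι V N : Type u} [AddCommGroup V] [Module ℝ V] [AddCommGroup N] [Module ℝ N]
  [TopologicalSpace V] {P : RootPairing ι ℝ V N} [P.IsCrystallographic]
  {k : Type u} [Field k] {b : P.Base} {T : Type u} [CommRing T] [Algebra (SymRing k P) T]
  {s : V ≃ᵃ[ℝ] V} {r : Alcove b → Alcove b}

lemma corootMonoid_le_invariants {d : ZT k b T} (hd : d ∈ corootMonoid k b T) :
    d ∈ invariants k b T s := by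
  have : corootMonoid k b T ≤ (invariants k b T s).toSubmonoid := by
    refine Submonoid.closure_le.2 ?_
    rintro _ ⟨i, -, rfl⟩
    exact (invariants k b T s).algebraMap_mem _
  exact this hd

variable [Finite ι]

/-- The element of `𝒵_T` attached to `{x, x s}` is invariant under right translation. -/
lemma IsRightTranslation.orbitElem_mem_invariants (hr : IsRightTranslation b s r) (A : Alcove b) :
    orbitElem k T {orbit A, orbit (r A)} ∈ invariants k b T s := by
  intro B C h
  obtain rfl := (hr.isRightTranslate_iff B C).1 h
  rw [coord_orbitElem, coord_orbitElem]
  suffices orbit (r B) ∈ ({orbit A, orbit (r A)} : Set (Orbit b)) ↔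
      orbit B ∈ ({orbit A, orbit (r A)} : Set (Orbit b)) by
    by_cases h : orbit B ∈ ({orbit A, orbit (r A)} : Set (Orbit b))
    · rw [if_pos h, if_pos (this.2 h)]
    · rw [if_neg h, if_neg (mt this.1 h)]
  constructor
  · rintro (h | h)
    · have := hr.orbit_congr h
      rw [hr.involutive] at this
      exact Or.inr this
    · have := hr.orbit_congr h
      rw [hr.involutive, hr.involutive] at this
      exact Or.inl this
  · rintro (h | h)
    · exact Or.inr (hr.orbit_congr h)
    · have := hr.orbit_congr h
      rw [hr.involutive] at this
      exact Or.inl this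

/-- If `m` vanishes in the stalks at `x` and `x s`, then some `w ∈ 𝒵_T^s` kills `m` and agrees at
`x` with a product of coroots. It is a multiple of the idempotent of `{x, x s}`. -/
lemma IsRightTranslation.exists_invariant_smul_eq_zero (hr : IsRightTranslation b s r) (A : Alcove b)
    {M : Type u} [AddCommGroup M] [Module (ZT k b T) M] {m : M}
    (h1 : m ∈ rootTorsion k T (orbitElem k T {orbit A}) M)
    (h2 : m ∈ rootTorsion k T (orbitElem k T {orbit (r A)}) M) :
    ∃ w ∈ invariants k b T s, ∃ c ∈ corootMonoid k b T, w • m = 0 ∧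
      orbitElem k T {orbit A} * w = c * orbitElem k T {orbit A} := by
  have h3 : m ∈ rootTorsion k T (orbitElem k T {orbit A, orbit (r A)}) M := by
    by_cases h : orbit A = orbit (r A)
    · rwa [← h, Set.pair_eq_singleton]
    · obtain ⟨d, hd, hm⟩ := h1
      obtain ⟨d', hd', hm'⟩ := h2
      refine ⟨d * d', mul_mem hd hd', ?_⟩
      rw [orbitElem_pair k T _ _ h, add_smul, smul_add, mul_smul, mul_smul, hm', smul_zero,
        add_zero, smul_comm d d', hm, smul_zero]
  obtain ⟨d, hd, hm⟩ := h3
  refine ⟨_, mul_mem (corootMonoid_le_invariants (s := s) hd)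
    (hr.orbitElem_mem_invariants (T := T) A), d * corootProdZ k b T,
    mul_mem hd (corootProdZ_mem_corootMonoid k b T), (mul_smul _ _ m).trans hm, ?_⟩
  have := orbitElem_mul_of_mem k T (x := orbit A) (X := {orbit A, orbit (r A)}) (by simp)
  linear_combination d * this

/-- Suppose that, on sections over `(Y_{⪯_T}^♯)_{⪯_T}` with `Y` contained in an orbit `x`, the stalks
at `x` and `x s` can be computed after restriction to the parts of these orbits. Then `ε_s` followed
by `(·)⁺` does not distinguish between `M` and `M⁺`. -/
lemma IsRightTranslation.isIso_plus_epsilon_plusUnit (hr : IsRightTranslation b s r) {M : PSh k b T}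
    (hM : ∀ (Y : Set (Alcove b)) (A : Alcove b), (∀ B ∈ Y, orbit B = orbit A) → ∀ y,
      (y = orbit A ∨ y = orbit (r A)) → ∀ m : M.obj (op (sharpHull k T s (openHull k b T Y).1)),
      res M (orbitPart_le _ y) m ∈ rootTorsion k T (orbitElem k T {y}) (M.obj (op (orbitPart _ y))) →
      m ∈ rootTorsion k T (orbitElem k T {y}) _) :
    IsIso ((plus k b T).map ((epsilon k b T s).map ((plusUnit k b T).app M))) := by
  refine isIso_plus_map (fun J => ?_) fun J x z hz => ?_
  · exact indRes_map_surjective (plusMk_surjective M _)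
  · obtain ⟨A, rfl⟩ : ∃ A : Alcove b, orbit A = x := Quotient.exists_rep x
    refine exists_smul_eq_zero_of_twist_map_eq_zero
      (g := ModuleCat.ofHom (plusMk M (sharpHull k T s (orbitPart J (orbit A)).1)))
      (plusMk_surjective M _) (corootMonoid k b T) (orbitElem k T {orbit A}) (fun m hm => ?_) hz
    have hm' : m ∈ gammaKer M (sharpHull k T s (orbitPart J (orbit A)).1) := plusMk_eq_zero.1 hm
    rw [mem_gammaKer'] at hm'
    have hy : ∀ y, (y = orbit A ∨ y = orbit (r A)) → m ∈ rootTorsion k T (orbitElem k T {y}) _ :=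
      fun y hy => hM (J.1 ∩ {B | orbit B = orbit A}) A (fun B hB => hB.2) y hy m (hm' y)
    exact hr.exists_invariant_smul_eq_zero A (hy _ (Or.inl rfl)) (hy _ (Or.inr rfl))

variable {T' : Type u} [CommRing T'] [Algebra (SymRing k P) T'] [Algebra T T']
  [IsScalarTower (SymRing k P) T T']
  [IsTopologicalAddGroup V] [ContinuousSMul ℝ V] [T2Space V] [P.IsRootSystem]

/-- The base change of an object of `𝐏_T` satisfies the hypothesis of
`IsRightTranslation.isIso_plus_epsilon_plusUnit`, by the support condition. -/
lemma IsRightTranslation.isIso_plus_epsilon_preBaseChange (hr : IsRightTranslation b s r)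
    {M : PSh k b T} (hM : IsP k b T M) :
    IsIso ((plus k b T').map ((epsilon k b T' s).map
      ((plusUnit k b T').app ((preBaseChange k b T T').obj M)))) := by
  refine hr.isIso_plus_epsilon_plusUnit fun Y A hY y hy m hm => ?_
  obtain ⟨hflab, -, -, hsupp⟩ := hM
  obtain ⟨d, hd, h⟩ := hm
  rw [← map_smul, ← map_smul] at h
  rw [← orbitElem_smul_mem_rootTorsion, ← smul_mem_rootTorsion hd]
  rw [res_preBaseChange] at h
  refine mem_of_extendScalars_map_eq_zero
      (p := (rootTorsion k T' (orbitElem k T' {y}) _).toAddSubgroup)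
      (hflab _ _ _) (fun w n hn => ?_) h
  refine extTmul_mem_rootTorsion ?_ w
  have hle := hr.orbitPart_openHull_sharp (k := k) (T := T) (T' := T') hY hy
  refine mem_rootTorsion_of_stalkMap_injective k T (hsupp _ y).injective ?_
  have hn' : res M (openHull_mono (orbitPart_le (sharpHull k T' s (openHull k b T' Y).1) y)) n = 0 :=
    hn
  have hzero : res M (orbitPart_le _ y) n = 0 :=
    (res_res M _ hle n).symm.trans ((congrArg _ hn').trans (map_zero _))
  rw [hzero]
  exact zero_mem _

end EpsilonPlus

/-! ### Base change for pushout squares -/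

section BeckChevalley

open ModuleCat

variable {R Z R' Z' : Type u} [CommRing R] [CommRing Z] [CommRing R'] [CommRing Z']
  {a : R →+* Z} {c : R →+* R'} {e : Z →+* Z'} {d : R' →+* Z'}

/-- The map `M → Z' ⊗_Z M`, `m ↦ 1 ⊗ m`, as a homomorphism of `R`-modules, where `R` acts on the
target through `R'`. -/
def beckChevalleyAux (h : e.comp a = d.comp c) (M : ModuleCat.{u} Z) :
    (restrictScalars a).obj M ⟶
      (restrictScalars c).obj ((restrictScalars d).obj ((extendScalars e).obj M)) :=
  ofHom (X := (restrictScalars a).obj M)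
    (Y := (restrictScalars c).obj ((restrictScalars d).obj ((extendScalars e).obj M)))
    { toFun := fun m => extTmul e 1 (M := M) m
      map_add' := fun m n => extTmul_add (M := M) 1 m n
      map_smul' := fun r m => by
        have h1 : e (a r) = d (c r) := RingHom.congr_fun h r
        refine (extTmul_smul (M := M) (f := e) 1 (a r) m).trans ?_
        rw [one_mul, h1, ← mul_one (d (c r))]
        rfl }

/-- The base change map `R' ⊗_R M → Z' ⊗_Z M`. -/
def beckChevalley (h : e.comp a = d.comp c) :
    restrictScalars.{u} a ⋙ extendScalars c ⟶ extendScalars e ⋙ restrictScalars d where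
  app M := (ExtendRestrictScalarsAdj.homEquiv c).symm (beckChevalleyAux h M)
  naturality M M' g := by
    refine ExtendScalars.hom_ext fun m => ?_
    have h1 : ∀ (M : ModuleCat.{u} Z) (x : M),
      ((ExtendRestrictScalarsAdj.homEquiv c).symm (beckChevalleyAux h M)).hom
        (extTmul (M := (restrictScalars a).obj M) c 1 x) = extTmul e 1 (M := M) x := fun M x =>
      (congrArg (fun g => g.hom x) ((ExtendRestrictScalarsAdj.homEquiv c).apply_symm_apply
        (beckChevalleyAux h M)) :)
    have h2 := h1 M m
    have h3 := h1 M' (g.hom m)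
    refine h3.trans ?_
    exact (congrArg (fun z => ((extendScalars e).map g).hom z) h2).symm

lemma beckChevalley_extTmul (h : e.comp a = d.comp c) (M : ModuleCat.{u} Z) (r : R') (m : M) :
    ((beckChevalley h).app M).hom (extTmul (M := (restrictScalars a).obj M) c r m) =
      extTmul e (d r) (M := M) m := by
  have h1 : ((beckChevalley h).app M).hom (extTmul (M := (restrictScalars a).obj M) c 1 m) =
      extTmul e 1 (M := M) m :=
    (congrArg (fun g => g.hom m) ((ExtendRestrictScalarsAdj.homEquiv c).apply_symm_apply
        (beckChevalleyAux h M)) :)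
  have h2 : extTmul (M := (restrictScalars a).obj M) c r m =
      r • extTmul (M := (restrictScalars a).obj M) c 1 m :=
    (congrArg (fun t => extTmul (M := (restrictScalars a).obj M) c t m) (mul_one r)).symm
  rw [h2, map_smul, h1]
  refine (smul_extTmul (M := M) (f := e) (d r) 1 m).trans ?_
  rw [mul_one]

/-- Base change is an isomorphism if the square of rings is a pushout. -/
lemma beckChevalley_bijective (h : e.comp a = d.comp c)
    (hpush : IsPushout (CommRingCat.ofHom a) (CommRingCat.ofHom c) (CommRingCat.ofHom e)
      (CommRingCat.ofHom d)) (M : ModuleCat.{u} Z) :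
    Function.Bijective ((beckChevalley h).app M).hom := by
  let := a.toAlgebra
  let := c.toAlgebra
  let := e.toAlgebra
  let := d.toAlgebra
  let := (e.comp a).toAlgebra
  let : Module R M := Module.compHom M a
  have : IsScalarTower R Z M := ⟨fun r z m => mul_smul (a r) z m⟩
  have : IsScalarTower R Z Z' := .of_algebraMap_eq' rfl
  have : IsScalarTower R R' Z' := .of_algebraMap_eq' h
  have : Algebra.IsPushout R R' Z Z' := CommRingCat.isPushout_iff_isPushout.1 hpush.flip
  have key : ∀ x : R' ⊗[R] M, ((beckChevalley h).app M).hom x =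
      (Algebra.IsPushout.cancelBaseChange R R' Z Z' M).symm x := fun x => by
    refine TensorProduct.induction_on (motive := fun x => ((beckChevalley h).app M).hom x =
      (Algebra.IsPushout.cancelBaseChange R R' Z Z' M).symm x) x ?_ (fun r m => ?_)
      fun x y hx hy => ?_
    · exact (map_zero ((beckChevalley h).app M).hom).trans
        (map_zero (Algebra.IsPushout.cancelBaseChange R R' Z Z' M).symm).symm
    · exact (beckChevalley_extTmul h M r m).trans
        (Algebra.IsPushout.cancelBaseChange_symm_tmul R R' Z Z' M r m).symm
    · exact (map_add ((beckChevalley h).app M).hom x y).trans ((congrArg₂ (· + ·) hx hy).trans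
        (map_add (Algebra.IsPushout.cancelBaseChange R R' Z Z' M).symm x y).symm)
  have := (Algebra.IsPushout.cancelBaseChange R R' Z Z' M).symm.bijective
  exact (funext key : (⇑((beckChevalley h).app M).hom) = _) ▸ this

/-- For a pushout square of rings, the functor `Z ⊗_R ·` on `Z`-modules and the functor `Z' ⊗_{R'} ·`
on `Z'`-modules correspond to each other under base change from `Z` to `Z'`. -/
def indResCompIso
    (hpush : IsPushout (CommRingCat.ofHom a) (CommRingCat.ofHom c) (CommRingCat.ofHom e)
      (CommRingCat.ofHom d)) :
    indRes a ⋙ extendScalars.{u, u, u} e ≅ extendScalars e ⋙ indRes d :=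
  have h : e.comp a = d.comp c := congrArg CommRingCat.Hom.hom hpush.w
  have : IsIso (beckChevalley h) :=
    have (M : ModuleCat.{u} Z) : IsIso ((beckChevalley h).app M) :=
      isIso_of_bijective (beckChevalley_bijective h hpush M)
    NatIso.isIso_of_isIso_app _
  Functor.associator _ _ _ ≪≫
    Functor.isoWhiskerLeft (restrictScalars a) ((extendScalarsComp a e).symm ≪≫
      eqToIso (congrArg extendScalars h) ≪≫ extendScalarsComp c d) ≪≫
    (Functor.associator _ _ _).symm ≪≫
    Functor.isoWhiskerRight (asIso (beckChevalley h)) (extendScalars d) ≪≫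
    Functor.associator _ _ _

end BeckChevalley

/-! ### Equalizers under flat base change -/

section Equalizer

variable {T T' A A' I : Type u} [CommRing T] [CommRing T'] [CommRing A] [CommRing A']
  [Algebra T T'] [Algebra T A] [Algebra T' A'] [Finite I]

/-- Flat base change commutes with the formation of the subalgebra of all `z` with `f z = g z`, where
`f` and `g` have values in a finite product of copies of the base ring. It follows that the square
formed by this subalgebra and the ambient algebra is a pushout. -/
lemma isPushout_of_flat [Module.Flat T T'] (f g : A →ₐ[T] (I → T)) (f' g' : A' →ₐ[T'] (I → T'))
    (E : Subalgebra T A) (E' : Subalgebra T' A') (hE : ∀ z, z ∈ E ↔ f z = g z)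
    (hE' : ∀ z, z ∈ E' ↔ f' z = g' z) (eqv : T' ⊗[T] A ≃ₐ[T'] A') (φ : A →+* A')
    (hφ : ∀ z, eqv (1 ⊗ₜ z) = φ z) (hf : ∀ z i, f' (φ z) i = algebraMap T T' (f z i))
    (hg : ∀ z i, g' (φ z) i = algebraMap T T' (g z i)) (ψ : E →+* E')
    (hψ : ∀ z, (ψ z : A') = φ z) :
    IsPushout (CommRingCat.ofHom E.val.toRingHom) (CommRingCat.ofHom ψ) (CommRingCat.ofHom φ)
      (CommRingCat.ofHom E'.val.toRingHom) := by
  classical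
  cases nonempty_fintype I
  have htmul : ∀ t z, eqv (t ⊗ₜ z) = algebraMap T' A' t * φ z := fun t z => by
    rw [← hφ, ← Algebra.smul_def, ← map_smul, smul_tmul', smul_eq_mul, mul_one]
  let Φ : T' ⊗[T] E →ₐ[T'] A' :=
    eqv.toAlgHom.comp (Algebra.TensorProduct.map (AlgHom.id T' T') E.val)
  have hΦ : ∀ t z, Φ (t ⊗ₜ z) = algebraMap T' A' t * φ z := fun t z => htmul t z
  have hinj : Function.Injective Φ := eqv.injective.comp
    (Module.Flat.lTensor_preserves_injective_linearMap (M := T') E.val.toLinearMap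
      Subtype.val_injective)
  have hloc : ∀ (f : A →ₐ[T] (I → T)) (f' : A' →ₐ[T'] (I → T')),
      (∀ z i, f' (φ z) i = algebraMap T T' (f z i)) → ∀ x, f' (eqv x) =
        TensorProduct.piScalarRight T T' T' I (f.toLinearMap.lTensor T' x) := by
    intro f f' hf x
    induction x using TensorProduct.induction_on with
    | zero => simp
    | tmul t z =>
      ext i
      simp [htmul, hf, Algebra.smul_def, mul_comm]
    | add x y hx hy => rw [map_add, map_add, hx, hy, map_add, map_add]
  have hrange : Φ.range = E' := by
    refine le_antisymm ?_ fun z hz => ?_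
    · rintro _ ⟨x, rfl⟩
      induction x using TensorProduct.induction_on with
      | zero => rw [map_zero]; exact E'.zero_mem
      | tmul t z =>
        show Φ (t ⊗ₜ z) ∈ E'
        rw [hΦ, ← hψ]
        exact E'.mul_mem (E'.algebraMap_mem t) (ψ z).2
      | add x y hx hy => rw [map_add]; exact E'.add_mem hx hy
    · obtain ⟨x, rfl⟩ := eqv.surjective z
      rw [hE', hloc f f' hf, hloc g g' hg] at hz
      have hx : x ∈ LinearMap.eqLocus (AlgebraTensorModule.lTensor T' T' f.toLinearMap)
          (AlgebraTensorModule.lTensor T' T' g.toLinearMap) :=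
        (TensorProduct.piScalarRight T T' T' I).injective hz
      rw [Module.Flat.eqLocus_lTensor_eq] at hx
      obtain ⟨y, rfl⟩ := hx
      clear hz
      induction y using TensorProduct.induction_on with
      | zero => rw [map_zero, map_zero]; exact Φ.range.zero_mem
      | tmul t z => exact ⟨t ⊗ₜ ⟨z, (hE z).2 z.2⟩, rfl⟩
      | add x y hx hy =>
        rw [map_add, map_add]
        exact add_mem hx hy
  let e₂ : T' ⊗[T] E ≃ₐ[T'] E' :=
    (AlgEquiv.ofInjective Φ hinj).trans (Subalgebra.equivOfEq _ _ hrange)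
  have he₂ : ∀ z, e₂ (1 ⊗ₜ z) = ψ z := fun z => Subtype.ext <| by
    rw [hψ]
    exact (hΦ 1 z).trans (by rw [map_one, one_mul])
  have hsq1 : IsPushout (CommRingCat.ofHom (algebraMap T E)) (CommRingCat.ofHom (algebraMap T T'))
      (CommRingCat.ofHom ψ) (CommRingCat.ofHom (algebraMap T' E')) :=
    (CommRingCat.isPushout_tensorProduct T T' E).flip.of_iso (Iso.refl _) (Iso.refl _) (Iso.refl _)
      e₂.toRingEquiv.toCommRingCatIso (by simp) (by simp)
      (CommRingCat.hom_ext (RingHom.ext he₂)) (CommRingCat.hom_ext (RingHom.ext e₂.commutes))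
  have hsq2 : IsPushout (CommRingCat.ofHom (algebraMap T A)) (CommRingCat.ofHom (algebraMap T T'))
      (CommRingCat.ofHom φ) (CommRingCat.ofHom (algebraMap T' A')) :=
    (CommRingCat.isPushout_tensorProduct T T' A).flip.of_iso (Iso.refl _) (Iso.refl _) (Iso.refl _)
      eqv.toRingEquiv.toCommRingCatIso (by simp) (by simp)
      (CommRingCat.hom_ext (RingHom.ext hφ)) (CommRingCat.hom_ext (RingHom.ext eqv.commutes))
  refine IsPushout.of_left (h₁₁ := CommRingCat.ofHom (algebraMap T E))
    (h₂₁ := (CommRingCat.ofHom (algebraMap T' E'))) hsq2 ?_ hsq1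
  ext z
  exact (hψ z).symm

end Equalizer

/-! ### Wall crossing commutes with base change before `(·)⁺` -/

section TwistBaseChange

variable {ι V N : Type u} [AddCommGroup V] [Module ℝ V] [AddCommGroup N] [Module ℝ N]
  [TopologicalSpace V] {P : RootPairing ι ℝ V N} [P.IsCrystallographic]
  {k : Type u} [Field k] {b : P.Base} {T : Type u} [CommRing T] [Algebra (SymRing k P) T]
  {T' : Type u} [CommRing T'] [Algebra (SymRing k P) T'] [Algebra T T']
  [IsScalarTower (SymRing k P) T T']
  {s : V ≃ᵃ[ℝ] V} {r : Alcove b → Alcove b}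

/-- The right translation on the set of orbits. -/
def IsRightTranslation.orbitMap (hr : IsRightTranslation b s r) : Orbit b → Orbit b :=
  Quotient.map r fun _ _ h => Quotient.exact (hr.orbit_congr (Quotient.sound h))

lemma IsRightTranslation.mem_invariants_iff (hr : IsRightTranslation b s r) {z : ZT k b T} :
    z ∈ invariants k b T s ↔ ∀ x, coord k T (hr.orbitMap x) z = coord k T x z := by
  refine ⟨fun h x => ?_, fun h A B hAB => ?_⟩
  · obtain ⟨A, rfl⟩ : ∃ A : Alcove b, orbit A = x := Quotient.exists_rep x
    exact h A (r A) ((hr.isRightTranslate_iff A _).2 rfl)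
  · obtain rfl := (hr.isRightTranslate_iff A B).1 hAB
    exact h (orbit A)

variable (k b T T' s) in
/-- The homomorphism `𝒵_T^s → 𝒵_{T'}^s` induced by `T → T'`. -/
def changeInvariants : invariants k b T s →+* invariants k b T' s :=
  ((changeZ k b T T').comp (invariants k b T s).val.toRingHom).codRestrict
    (invariants k b T' s) fun z A B h => by
      have h1 := congrArg (algebraMap T T') (z.2 A B h)
      rw [← coord_changeZ, ← coord_changeZ] at h1
      exact h1

lemma cancelBaseChange_one_tmul (z : ZT k b T) :
    Algebra.TensorProduct.cancelBaseChange (SymRing k P) T T' T' (structureAlgebra k b) (1 ⊗ₜ z) =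
      changeZ k b T T' z := by
  induction z using TensorProduct.induction_on with
  | zero => rw [TensorProduct.tmul_zero, map_zero, RingHom.map_zero]
  | tmul t z =>
    rw [Algebra.TensorProduct.cancelBaseChange_tmul, changeZ_tmul, Algebra.algebraMap_eq_smul_one]
  | add y z hy hz => rw [TensorProduct.tmul_add, map_add, hy, hz, RingHom.map_add]

/-- The inclusions `𝒵_T^s → 𝒵_T` and `𝒵_{T'}^s → 𝒵_{T'}` form a pushout square: `𝒵_T^s` is the
equalizer of the coordinate map with its composition with right translation, and there are only
finitely many orbits. -/
lemma IsRightTranslation.isPushout_invariants (hr : IsRightTranslation b s r) [Finite (Orbit b)]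
    [Module.Flat T T'] :
    IsPushout
      (CommRingCat.ofHom (R := invariants k b T s) (S := ZT k b T) (invariantsIncl k b T s))
      (CommRingCat.ofHom (R := invariants k b T s) (S := invariants k b T' s)
        (changeInvariants k b T T' s))
      (CommRingCat.ofHom (R := ZT k b T) (S := ZT k b T') (changeZ k b T T'))
      (CommRingCat.ofHom (R := invariants k b T' s) (S := ZT k b T') (invariantsIncl k b T' s)) :=
  isPushout_of_flat (I := Orbit b) (AlgHom.pi fun x => coord k T (hr.orbitMap x))
    (AlgHom.pi fun x => coord k T x) (AlgHom.pi fun x => coord k T' (hr.orbitMap x))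
    (AlgHom.pi fun x => coord k T' x) (invariants k b T s) (invariants k b T' s)
    (fun z => hr.mem_invariants_iff.trans funext_iff.symm)
    (fun z => hr.mem_invariants_iff.trans funext_iff.symm)
    (Algebra.TensorProduct.cancelBaseChange (SymRing k P) T T' T' (structureAlgebra k b))
    (changeZ k b T T') (fun z => cancelBaseChange_one_tmul z)
    (fun z x => by exact coord_changeZ k T T' _ z) (fun z x => by exact coord_changeZ k T T' _ z)
    (changeInvariants k b T T' s) (fun z => rfl)

/-- Base change to `T'` turns the functor `𝒵_T ⊗_{𝒵_T^s} ·` into `𝒵_{T'} ⊗_{𝒵_{T'}^s} ·`. -/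
def IsRightTranslation.twistBaseChangeIso (hr : IsRightTranslation b s r) [Finite (Orbit b)]
    [Module.Flat T T'] :
    twist k b T s ⋙ ModuleCat.extendScalars.{u, u, u} (changeZ k b T T') ≅
      ModuleCat.extendScalars (changeZ k b T T') ⋙ twist k b T' s :=
  indResCompIso hr.isPushout_invariants

end TwistBaseChange

section ThetaIso

/-- Compatibility of precomposition and postcomposition functors, applied to two commuting squares. -/
def whiskeringIso {C C' A A' : Type*} [Category* C] [Category* C'] [Category* A] [Category* A']
    {S : C ⥤ C} {S' : C' ⥤ C'} {H : C' ⥤ C} {F : A ⥤ A} {F' : A' ⥤ A'} {E : A ⥤ A'}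
    (σ : H ⋙ S ≅ S' ⋙ H) (θ : F ⋙ E ≅ E ⋙ F') :
    ((Functor.whiskeringLeft _ _ _).obj S ⋙ (Functor.whiskeringRight _ _ _).obj F) ⋙
        ((Functor.whiskeringRight _ _ _).obj E ⋙ (Functor.whiskeringLeft _ _ _).obj H) ≅
      ((Functor.whiskeringRight _ _ _).obj E ⋙ (Functor.whiskeringLeft _ _ _).obj H) ⋙
        ((Functor.whiskeringLeft _ _ _).obj S' ⋙ (Functor.whiskeringRight _ _ _).obj F') :=
  NatIso.hcomp ((Functor.whiskeringLeft _ _ A).mapIso σ) ((Functor.whiskeringRight _ _ _).mapIso θ)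

variable {ι V N : Type u} [AddCommGroup V] [Module ℝ V] [AddCommGroup N] [Module ℝ N]
  [TopologicalSpace V] {P : RootPairing ι ℝ V N} [P.IsCrystallographic]
  {k : Type u} [Field k] {b : P.Base} {T : Type u} [CommRing T] [Algebra (SymRing k P) T]
  {T' : Type u} [CommRing T'] [Algebra (SymRing k P) T'] [Algebra T T']
  [IsScalarTower (SymRing k P) T T']
  {s : V ≃ᵃ[ℝ] V} {r : Alcove b → Alcove b}

variable (k T T') in
/-- For a `T'`-open set `J`, the `T`-open sets generated by `(J_{⪯_T})^♯` and by `J^♯` coincide. -/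
def IsRightTranslation.sharpHullIso (hr : IsRightTranslation b s r) :
    hullFunctor k b T T' ⋙ sharpFunctor k b T s ≅ sharpFunctor k b T' s ⋙ hullFunctor k b T T' :=
  NatIso.ofComponents (fun J => eqToIso (by
    show openHull k b T (sharp b s (openHull k b T J.1).1) =
      openHull k b T (openHull k b T' (sharp b s J.1)).1
    rw [openHull_openHull, ← hr.openHull_sharp]
    exact Subtype.ext (openHull_eq_of_isTOpen (openHull k b T _).2)))
    fun _ => Subsingleton.elim _ _

variable [Finite (Orbit b)] [Module.Flat T T']

variable (k T T') in
/-- The functors `ε_s` commute with base change before `(·)⁺` is applied. This combines the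
compatibility of the open sets with that of the coefficient functors. -/
def IsRightTranslation.epsilonPreBaseChangeIso (hr : IsRightTranslation b s r) :
    epsilon k b T s ⋙ preBaseChange k b T T' ≅ preBaseChange k b T T' ⋙ epsilon k b T' s :=
  whiskeringIso (NatIso.op (hr.sharpHullIso k T T').symm)
    (hr.twistBaseChangeIso (k := k) (T := T) (T' := T'))

end ThetaIso

/-! ### The commutation isomorphism -/

section CategoryTheory

variable {C C₁ D : Type*} [Category* C] [Category* C₁] [Category* D]

/-- Let `p` and `p'` be functors with natural transformations `u : 𝟭 ⟶ p` and `u' : 𝟭 ⟶ p'`, and let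
`ε` and `ε'` correspond to each other under the functor `A ⋙ B`. If `A ⋙ B ⋙ p'` inverts `u` on
objects `ε X`, and `ε' ⋙ p'` inverts `u'` on the images of objects with the property `Q`, then
`ε ⋙ p` and `ε' ⋙ p'` correspond to each other under `A ⋙ B ⋙ p'`, on objects with the property
`Q`. -/
def compIsoOfUnits {ε p : C ⥤ C} {A : C ⥤ C₁} {B : C₁ ⥤ D} {ε' p' : D ⥤ D} (u : 𝟭 C ⟶ p)
    (u' : 𝟭 D ⟶ p') (Q : ObjectProperty C) (θ : ε ⋙ A ⋙ B ≅ (A ⋙ B) ⋙ ε')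
    (h : ∀ X, IsIso (p'.map (B.map (A.map (u.app (ε.obj X))))))
    (h' : ∀ X, Q X → IsIso (p'.map (ε'.map (u'.app (B.obj (A.obj X)))))) :
    Q.ι ⋙ (ε ⋙ p) ⋙ A ⋙ B ⋙ p' ≅ Q.ι ⋙ (A ⋙ B ⋙ p') ⋙ ε' ⋙ p' :=
  NatIso.ofComponents
    (fun X =>
      have := h X.obj
      have := h' X.obj X.property
      (asIso (p'.map (B.map (A.map (u.app (ε.obj X.obj)))))).symm ≪≫ p'.mapIso (θ.app X.obj) ≪≫
        asIso (p'.map (ε'.map (u'.app (B.obj (A.obj X.obj))))))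
    (fun {X Y} f => by
      have := h X.obj
      have := h Y.obj
      have h1 := u.naturality (ε.map f.hom)
      have h2 := u'.naturality (B.map (A.map f.hom))
      have h3 := θ.hom.naturality f.hom
      dsimp at h1 h2 h3 ⊢
      rw [← cancel_epi (p'.map (B.map (A.map (u.app (ε.obj X.obj)))))]
      simp only [IsIso.hom_inv_id_assoc, Category.assoc]
      rw [← Functor.map_comp_assoc, ← Functor.map_comp, ← Functor.map_comp, ← h1]
      simp only [Functor.map_comp, Category.assoc, IsIso.hom_inv_id_assoc]
      rw [← Functor.map_comp_assoc, h3]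
      simp only [← Functor.map_comp, Category.assoc, h2])

end CategoryTheory

section Main

variable {ι V N : Type u} [AddCommGroup V] [Module ℝ V] [AddCommGroup N] [Module ℝ N]
  [TopologicalSpace V] {P : RootPairing ι ℝ V N} [P.IsCrystallographic]
  {k : Type u} [Field k] {b : P.Base} {T : Type u} [CommRing T] [Algebra (SymRing k P) T]
  {T' : Type u} [CommRing T'] [Algebra (SymRing k P) T'] [Algebra T T']
  [IsScalarTower (SymRing k P) T T']
  {s : V ≃ᵃ[ℝ] V} {r : Alcove b → Alcove b}
  [Finite ι] [IsTopologicalAddGroup V] [ContinuousSMul ℝ V] [T2Space V] [P.IsRootSystem]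

/-- On `𝐏_T`, wall crossing commutes with base change. -/
def IsRightTranslation.wallCrossingBaseChangeIso (hr : IsRightTranslation b s r) [Finite (Orbit b)]
    [Module.Flat T T'] :
    (IsP k b T).ι ⋙ wallCrossing k b T s ⋙ baseChange k b T T' ≅
      (IsP k b T).ι ⋙ baseChange k b T T' ⋙ wallCrossing k b T' s :=
  compIsoOfUnits (plusUnit k b T) (plusUnit k b T') (IsP k b T) (hr.epsilonPreBaseChangeIso k T T')
    (fun M => isIso_plus_preBaseChange_plusUnit ((epsilon k b T s).obj M))
    (fun _ hM => hr.isIso_plus_epsilon_preBaseChange hM)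

end Main

end AlcoveSheaf

end

open AlcoveSheaf in
theorem mainTheorem4 {ι V N : Type u} [Finite ι]
    [AddCommGroup V] [Module ℝ V] [TopologicalSpace V] [IsTopologicalAddGroup V]
    [ContinuousSMul ℝ V] [T2Space V] [AddCommGroup N] [Module ℝ N]
    {P : RootPairing ι ℝ V N} [P.IsRootSystem] [P.IsCrystallographic] [P.IsReduced]
    [P.IsIrreducible] (b : P.Base)
    (k : Type u) [Field k] (hk : GKM k b)
    (T T' : Type u) [CommRing T] [CommRing T'] [Algebra (SymRing k P) T]
    [Algebra (SymRing k P) T'] [Algebra T T'] [IsScalarTower (SymRing k P) T T']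
    (hT : IsBaseRing k b T) (hT' : IsBaseRing k b T') (hflat : Module.Flat T T')
    (s : V ≃ᵃ[ℝ] V) (hs : IsSimpleAffineReflection b s) :
    (∀ J : Set (Alcove b), IsTOpen k b T J → IsTOpen k b T (sharp b s J)) ∧
    (∀ J : Set (Alcove b), IsTOpen k b T' J → IsTOpen k b T' (sharp b s J)) ∧
    ∃ (h₁ : ∀ M : (IsP k b T).FullSubcategory, IsP k b T ((wallCrossing k b T s).obj M.obj))
      (h₂ : ∀ M : (IsP k b T').FullSubcategory, IsP k b T' ((wallCrossing k b T' s).obj M.obj))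
      (h₃ : ∀ M : (IsP k b T).FullSubcategory, IsP k b T' ((baseChange k b T T').obj M.obj)),
      Nonempty
        ((IsP k b T).lift ((IsP k b T).ι ⋙ wallCrossing k b T s) h₁ ⋙
            (IsP k b T').lift ((IsP k b T).ι ⋙ baseChange k b T T') h₃ ≅
          (IsP k b T').lift ((IsP k b T).ι ⋙ baseChange k b T T') h₃ ⋙
            (IsP k b T').lift ((IsP k b T').ι ⋙ wallCrossing k b T' s) h₂) := by
  obtain ⟨r, hr⟩ := hs.exists_isRightTranslation
  have := finite_orbit (b := b)
  refine ⟨fun J hJ => hr.isTOpen_sharp hJ, fun J hJ => hr.isTOpen_sharp hJ,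
    fun M => isP_plusObj (flabby_epsilon M.2.1 s) (finitary_epsilon hr M.2.2.1),
    fun M => isP_plusObj (flabby_epsilon M.2.1 s) (finitary_epsilon hr M.2.2.1),
    fun M => isP_plusObj (flabby_preBaseChange M.2.1) (finitary_preBaseChange M.2.2.1), ⟨?_⟩⟩
  exact Functor.fullyFaithfulCancelRight (IsP k b T').ι
    (hr.wallCrossingBaseChangeIso (k := k) (T := T) (T' := T'))
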